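/- **Setting.** Let $\mathcal L$ be a (possibly multi-sorted) first-order language with a distinguished field sort; the other sorts are called auxiliary. On the field sort, $\mathcal L$ is a relational extension of $\{+,-,\cdot,{}^{-1},0,1\}\cup\Omega$, where $\Omega$ is a set of constant symbols; all other function symbols of $\mathcal L$ take values in auxiliary sorts. Let $K_0$ be an $\mathcal L$-structure whose field sort is a field of characteristic $0$ (with $0^{-1}=0$), and let $\chi(x,z)$ be an $\mathcal L$-formula, $x$ a single field-sort variable, such that the sets $\chi(K_0,c)$, with $c$ ranging over all tuples of the sorts of $z$, form a basis of neighbourhoods of $0$ for a non-discrete Hausdorff field topology. Let $T=\mathrm{Th}(K_0)$; in every model of $T$ the field carries the topology defined by $\chi$. Let $\mathbb Q(\Omega)$ be the subfield generated by the constants. Assume that $T$ is an *open theory of topological fields*, i.e. 1. modulo $T$ every $\mathcal L$-formula is equivalent to one without quantifiers over the field sort; 2. every $\mathcal L$-formula $\varphi(x,w)$ without field-sort quantifiers, $x$ a tuple of field-sort variables and $w$ a tuple of variables of auxiliary sorts, is equivalent modulo $T$ to a finite disjunction $\bigvee_i\big(\bigwedge_{j} P_{ij}(x)=0\wedge\theta_i(x,w)\big)$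 with finite (possibly empty) inner conjunctions, where $P_{ij}\in\mathbb Q(\Omega)[x]\setminus\{0\}$ and, in every model $K$ of $T$ and for every tuple $e$ of the sorts of $w$, $\theta_i(x,e)$ defines an open set. Let $\mathcal L_\delta=\mathcal L\cup\{\delta\}$, with $\delta$ a unary function symbol on the field sort. A model of $T_\delta^*$ is a pair $(K,\delta)$ where $K\models T$, $\delta$ is a derivation of the field with $\delta(c)=0$ for all $c\in\Omega$, and the following holds: for every $m\ge 1$, every polynomial $P\in K[y_0,\dots,y_m]$ of positive degree in $y_m$, every $a\in K^{m+1}$ with $P(a)=0$ and $\frac{\partial P}{\partial y_m}(a)\neq 0$, and every neighbourhood $U=\chi(K,c)$ of $0$, there is $b\in K$ such that, with $\bar b=(b,\delta b,\dots,\delta^m b)$, $P(\bar b)=0$, $\frac{\partial P}{\partial y_m}(\bar b)\ne 0$ and all entries of $\bar b-a$ lie in $U$. **Theorem.** $T_\delta^*$ eliminates the field-sort quantifier $\exists^\infty$: for every $\mathcal L_\delta$-formula $\varphi(x,y)$, $x$ a single field-sort variable and $y$ a tuple of variables of any sorts, there is $N\in\mathbb N$ such that for every model $(K,\delta)$ of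 $T_\delta^*$ and every tuple $b$ of the sorts of $y$, the set $\varphi(K,b)$ is either infinite or has at most $N$ elements. Moreover, suppose that $\mathcal L$ is one-sorted and that $T_\delta^*$ is consistent. Let $\mathcal L_P=\mathcal L\cup\{P\}$ with $P$ a unary predicate, and let $T_P$ be the theory of the pairs $(K,P(K))$ where $K\models T$, $P(K)$ is $\mathrm{acl}$-closed in $K$ (in the sense of $\mathcal L$), and $P(K)$ meets every infinite $\mathcal L$-definable (with parameters) subset of $K$. Then $T_P$ eliminates $\exists^\infty$: for every $\mathcal L_P$-formula $\varphi(x,y)$ there is $N\in\mathbb N$ such that for every model $(K,P(K))$ of $T_P$ and every tuple $b$ from $K$, the set $\varphi(K,b)$ is either infinite or has at most $N$ elements. -/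

import Mathlib

open Filter Topology

universe u

namespace TopFieldDer

/-! Many-sorted first-order logic with equality. -/

/-- A many-sorted first-order language: sorts, function symbols (with a list of argument sorts and
a value sort; a constant symbol has the empty list) and relation symbols. -/
structure Language where
  Sorts : Type u
  Fun : List Sorts → Sorts → Type u
  Rel : List Sorts → Type u

/-- Terms. Every sort `s` has the variables `(s, n)`, `n : ℕ`. -/
inductive Term (L : Language.{u}) : L.Sorts → Type u
  | var (s : L.Sorts) (n : ℕ) : Term L s
  | app {d : List L.Sorts} {s : L.Sorts} (f : L.Fun d s)
      (t : ∀ i : Fin d.length, Term L (d.get i)) : Term L s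

/-- First-order formulas (the other connectives and `∃` are classical abbreviations). -/
inductive Formula (L : Language.{u}) : Type u
  | falsum : Formula L
  | eq {s : L.Sorts} (t t' : Term L s) : Formula L
  | rel {d : List L.Sorts} (r : L.Rel d) (t : ∀ i : Fin d.length, Term L (d.get i)) : Formula L
  | imp (φ ψ : Formula L) : Formula L
  | all (s : L.Sorts) (n : ℕ) (φ : Formula L) : Formula L

/-- Structures; as usual every sort is non-empty. -/
structure Structure (L : Language.{u}) where
  carrier : L.Sorts → Type u
  nonempty : ∀ s, Nonempty (carrier s)
  fn : ∀ {d : List L.Sorts} {s : L.Sorts}, L.Fun d s →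
    (∀ i : Fin d.length, carrier (d.get i)) → carrier s
  rl : ∀ {d : List L.Sorts}, L.Rel d → (∀ i : Fin d.length, carrier (d.get i)) → Prop

/-- Assignments of values to all variables. -/
abbrev Structure.Assignment {L : Language.{u}} (M : Structure L) : Type u :=
  ∀ x : L.Sorts × ℕ, M.carrier x.1

open Classical in
/-- The assignment `v` with the value of the variable `(s, n)` changed to `a`. -/
noncomputable def Structure.assign {L : Language.{u}} (M : Structure L) (v : M.Assignment)
    (s : L.Sorts) (n : ℕ) (a : M.carrier s) : M.Assignment :=
  Function.update v (s, n) a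

/-- The value of a term. -/
def Term.eval {L : Language.{u}} (M : Structure L) (v : M.Assignment) :
    {s : L.Sorts} → Term L s → M.carrier s
  | _, .var s n => v (s, n)
  | _, .app f t => M.fn f fun i => (t i).eval M v

/-- Satisfaction of a formula under an assignment. -/
def Formula.Sat {L : Language.{u}} (M : Structure L) : M.Assignment → Formula L → Prop
  | _, .falsum => False
  | v, .eq t t' => t.eval M v = t'.eval M v
  | v, .rel r t => M.rl r fun i => (t i).eval M v
  | v, .imp φ ψ => φ.Sat M v → ψ.Sat M v
  | v, .all s n φ => ∀ a : M.carrier s, φ.Sat M (M.assign v s n a)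

/-- `φ` is valid in `M`: it holds under every assignment, that is, its universal closure is
true in `M`. -/
def Formula.Valid {L : Language.{u}} (M : Structure L) (φ : Formula L) : Prop :=
  ∀ v : M.Assignment, φ.Sat M v

/-- The complete theory of `M` (sentences are given as formulas, read as their universal
closures). -/
def Structure.theory {L : Language.{u}} (M : Structure L) : Set (Formula L) :=
  {φ | φ.Valid M}

/-- `N` is a model of the set of axioms `T`. -/
def Structure.Models {L : Language.{u}} (N : Structure L) (T : Set (Formula L)) : Prop :=
  ∀ φ ∈ T, φ.Valid N

/-- The set defined by `φ` in the variable `(s, n)`, all other free variables being parameters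
with the values given by `v`. -/
def Structure.solutions {L : Language.{u}} (M : Structure L) (φ : Formula L) (v : M.Assignment)
    (s : L.Sorts) (n : ℕ) : Set (M.carrier s) :=
  {a | φ.Sat M (M.assign v s n a)}

/-- `φ` contains no quantifier over the sort `s` (quantifiers over other sorts are allowed). -/
def Formula.QuantifierFreeIn {L : Language.{u}} (s : L.Sorts) : Formula L → Prop
  | .falsum => True
  | .eq _ _ => True
  | .rel _ _ => True
  | .imp φ ψ => φ.QuantifierFreeIn s ∧ ψ.QuantifierFreeIn s
  | .all s' _ φ => s' ≠ s ∧ φ.QuantifierFreeIn s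

/-- Elimination of the quantifier `∃^∞` over the sort `s`, for a theory given by its class `C` of
models: for every formula `φ(x, y)` with `x` a single variable of sort `s` and `y` a tuple of
variables of arbitrary sorts there is `N` such that in every model of the theory, every finite
set `φ(M, b)` has at most `N` elements. -/
def EliminatesExistsInfinity {L : Language.{u}} (s : L.Sorts) (C : Structure L → Prop) : Prop :=
  ∀ (φ : Formula L) (n : ℕ), ∃ N : ℕ, ∀ M : Structure L, C M → ∀ v : M.Assignment,
    (M.solutions φ v s n).Finite → (M.solutions φ v s n).ncard ≤ N

/-! Languages and structures of fields with auxiliary sorts. -/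

/-- The data of a language extending the language of fields. The sorts are the field sort `none`
and the auxiliary sorts `some a`. On the field sort the language is a relational extension of
`{+, -, ·, ⁻¹, 0, 1} ∪ Const`; so all further function symbols take values in auxiliary sorts.
Relation symbols are arbitrary. -/
structure FieldLanguage where
  Aux : Type u
  Const : Type u
  AuxFun : List (Option Aux) → Aux → Type u
  Rel : List (Option Aux) → Type u

/-- The function symbols. -/
inductive FieldLanguage.Fun (L : FieldLanguage.{u}) : List (Option L.Aux) → Option L.Aux → Type u
  | zero : FieldLanguage.Fun L [] none
  | one : FieldLanguage.Fun L [] none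
  | add : FieldLanguage.Fun L [none, none] none
  | mul : FieldLanguage.Fun L [none, none] none
  | neg : FieldLanguage.Fun L [none] none
  | inv : FieldLanguage.Fun L [none] none
  | const (c : L.Const) : FieldLanguage.Fun L [] none
  | aux {d : List (Option L.Aux)} {a : L.Aux} (f : L.AuxFun d a) : FieldLanguage.Fun L d (some a)

/-- The function symbols, together with a unary function symbol on the field sort. -/
inductive FieldLanguage.DeltaFun (L : FieldLanguage.{u}) :
    List (Option L.Aux) → Option L.Aux → Type u
  | base {d : List (Option L.Aux)} {s : Option L.Aux} (f : L.Fun d s) :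
      FieldLanguage.DeltaFun L d s
  | delta : FieldLanguage.DeltaFun L [none] none

/-- The relation symbols, together with a unary predicate on the field sort. -/
inductive FieldLanguage.PairRel (L : FieldLanguage.{u}) : List (Option L.Aux) → Type u
  | base {d : List (Option L.Aux)} (r : L.Rel d) : FieldLanguage.PairRel L d
  | pred : FieldLanguage.PairRel L [none]

/-- The language `L`. -/
abbrev FieldLanguage.lang (L : FieldLanguage.{u}) : Language.{u} :=
  ⟨Option L.Aux, L.Fun, L.Rel⟩

/-- The language `L_δ`. -/
abbrev FieldLanguage.deltaLang (L : FieldLanguage.{u}) : Language.{u} :=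
  ⟨Option L.Aux, L.DeltaFun, L.Rel⟩

/-- The language `L_P`. -/
abbrev FieldLanguage.pairLang (L : FieldLanguage.{u}) : Language.{u} :=
  ⟨Option L.Aux, L.Fun, L.PairRel⟩

/-- The carriers of the sorts: `K` for the field sort, `A a` for the auxiliary sort `a`. -/
abbrev sortCarrier {Aux : Type u} (K : Type u) (A : Aux → Type u) : Option Aux → Type u
  | none => K
  | some a => A a

/-- A field endowed with an `L`-structure, in which the symbols of the language of fields have
their meaning (with `0⁻¹ = 0`). Every model of the theory of such a structure is again one, since
the field axioms belong to the theory. -/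
structure FieldStructure (L : FieldLanguage.{u}) where
  K : Type u
  field : Field K
  const : L.Const → K
  aux : L.Aux → Type u
  aux_nonempty : ∀ a, Nonempty (aux a)
  auxFn : ∀ {d : List (Option L.Aux)} {a : L.Aux}, L.AuxFun d a →
    (∀ i : Fin d.length, sortCarrier K aux (d.get i)) → aux a
  rl : ∀ {d : List (Option L.Aux)}, L.Rel d →
    (∀ i : Fin d.length, sortCarrier K aux (d.get i)) → Prop

attribute [instance] FieldStructure.field

namespace FieldStructure

variable {L : FieldLanguage.{u}} (M : FieldStructure L)

/-- The carriers of the sorts. -/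
abbrev carrier (s : Option L.Aux) : Type u := sortCarrier M.K M.aux s

theorem carrier_nonempty : ∀ s : Option L.Aux, Nonempty (M.carrier s)
  | none => ⟨(0 : M.K)⟩
  | some a => M.aux_nonempty a

/-- Interpretation of the function symbols of `L`. -/
def interp : {d : List (Option L.Aux)} → {s : Option L.Aux} → L.Fun d s →
    (∀ i : Fin d.length, M.carrier (d.get i)) → M.carrier s
  | _, _, .zero, _ => (0 : M.K)
  | _, _, .one, _ => (1 : M.K)
  | _, _, .add, t => (show M.K from t (0 : Fin 2)) + (show M.K from t (1 : Fin 2))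
  | _, _, .mul, t => (show M.K from t (0 : Fin 2)) * (show M.K from t (1 : Fin 2))
  | _, _, .neg, t => -(show M.K from t (0 : Fin 1))
  | _, _, .inv, t => (show M.K from t (0 : Fin 1))⁻¹
  | _, _, .const c, _ => M.const c
  | _, _, .aux f, t => M.auxFn f t

/-- Interpretation of the function symbols of `L_δ`. -/
def interpDelta (δ : M.K → M.K) : {d : List (Option L.Aux)} → {s : Option L.Aux} →
    L.DeltaFun d s → (∀ i : Fin d.length, M.carrier (d.get i)) → M.carrier s
  | _, _, .base f, t => M.interp f t
  | _, _, .delta, t => δ (show M.K from t (0 : Fin 1))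

/-- Interpretation of the relation symbols of `L_P`. -/
def interpPair (P : Set M.K) : {d : List (Option L.Aux)} →
    L.PairRel d → (∀ i : Fin d.length, M.carrier (d.get i)) → Prop
  | _, .base r, t => M.rl r t
  | _, .pred, t => (show M.K from t (0 : Fin 1)) ∈ P

/-- `M` as an `L`-structure. -/
abbrev str : Structure L.lang :=
  ⟨M.carrier, M.carrier_nonempty, fun f => M.interp f, fun r => M.rl r⟩

/-- The `L_δ`-structure `(M, δ)`. -/
abbrev deltaStr (δ : M.K → M.K) : Structure L.deltaLang :=
  ⟨M.carrier, M.carrier_nonempty, fun f => M.interpDelta δ f, fun r => M.rl r⟩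

/-- The `L_P`-structure `(M, P)`. -/
abbrev pairStr (P : Set M.K) : Structure L.pairLang :=
  ⟨M.carrier, M.carrier_nonempty, fun f => M.interp f, fun r => M.interpPair P r⟩

/-! Definable field topologies. Throughout, `χ(x, z)` is an `L`-formula, `x` is the field
variable `(none, 0)`, and `z` is the tuple of the other variables. -/

/-- The set `χ(M, z)`, where `z` is given by `v`. -/
def nhd (χ : Formula L.lang) (v : M.str.Assignment) : Set M.K :=
  M.str.solutions χ v none 0

/-- The topology on the field whose neighbourhood filter at `a` is generated by the sets
`a + χ(M, z)`. -/
@[reducible] def topology (χ : Formula L.lang) : TopologicalSpace M.K :=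
  TopologicalSpace.mkOfNhds fun a => ⨅ v : M.str.Assignment, 𝓟 {b | b - a ∈ M.nhd χ v}

/-- The sets `χ(M, z)` form a basis of neighbourhoods of `0` of a non-discrete Hausdorff field
topology. -/
def DefinesFieldTopology (χ : Formula L.lang) : Prop :=
  letI := M.topology χ
  IsTopologicalDivisionRing M.K ∧ T2Space M.K ∧ ¬ DiscreteTopology M.K ∧
    (𝓝 (0 : M.K)).HasBasis (fun _ : M.str.Assignment => True) (M.nhd χ)

/-- The assignment whose field variables take the values `u`, and whose other variables take the
values given by `v`. -/
def withField (v : M.str.Assignment) (u : ℕ → M.K) : M.str.Assignment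
  | (none, n) => u n
  | (some a, n) => v (some a, n)

/-- For all values of its variables of auxiliary sorts, `θ` defines an open set in its field
variables. (The formula involves only finitely many variables, so that it makes no difference
whether `n`-tuples or sequences with the product topology are considered.) -/
def DefinesOpen (χ θ : Formula L.lang) : Prop :=
  letI := M.topology χ
  ∀ v : M.str.Assignment, IsOpen {u : ℕ → M.K | θ.Sat M.str (M.withField v u)}

/-- A polynomial over `ℤ[Ω]` in the field variables as a polynomial over the field. Up to a
non-zero constant factor these are the polynomials over the subfield `ℚ(Ω)`. -/
noncomputable def poly (P : MvPolynomial ℕ (MvPolynomial L.Const ℤ)) : MvPolynomial ℕ M.K :=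
  MvPolynomial.map (MvPolynomial.aeval M.const).toRingHom P

/-- `M` is a model of the theory of `K₀`. -/
def IsModelOf (K₀ : FieldStructure L) : Prop := M.str.Models K₀.str.theory

end FieldStructure

variable {L : FieldLanguage.{u}}

/-- The theory of `K₀` is a theory of topological fields: `K₀` has characteristic `0`, and `χ`
defines a field topology on it. -/
structure IsTopologicalFieldTheory (K₀ : FieldStructure L) (χ : Formula L.lang) : Prop where
  charZero : CharZero K₀.K
  topology : K₀.DefinesFieldTopology χ

/-- The theory `T` of `K₀` is an open theory of topological fields. -/
structure IsOpenTheory (K₀ : FieldStructure L) (χ : Formula L.lang) : Prop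
    extends IsTopologicalFieldTheory K₀ χ where
  /-- `T` eliminates field sort quantifiers. -/
  elim : ∀ φ : Formula L.lang, ∃ ψ : Formula L.lang, ψ.QuantifierFreeIn none ∧
    ∀ M : FieldStructure L, M.IsModelOf K₀ →
      ∀ v : M.str.Assignment, φ.Sat M.str v ↔ ψ.Sat M.str v
  /-- Modulo `T`, every field sort quantifier-free formula is equivalent to a finite disjunction
  of formulas `⋀ⱼ Pⱼ(x) = 0 ∧ θ(x, w)` with non-zero polynomials `Pⱼ` over `ℚ(Ω)` in the field
  variables `x`, such that `θ` defines an open set in every model of `T` for all values of the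
  variables `w` of auxiliary sorts. -/
  open_form : ∀ φ : Formula L.lang, φ.QuantifierFreeIn none →
    ∃ D : List (List (MvPolynomial ℕ (MvPolynomial L.Const ℤ)) × Formula L.lang),
      (∀ c ∈ D, ∀ P ∈ c.1, K₀.poly P ≠ 0) ∧
      ∀ M : FieldStructure L, M.IsModelOf K₀ →
        (∀ c ∈ D, M.DefinesOpen χ c.2) ∧
        ∀ v : M.str.Assignment, φ.Sat M.str v ↔
          ∃ c ∈ D, (∀ P ∈ c.1, MvPolynomial.eval (fun n => v (none, n)) (M.poly P) = 0) ∧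
            c.2.Sat M.str v

/-! Generic derivations. -/

/-- The scheme (DL): for every differential polynomial `P` of order `m ≥ 1` in one variable, with
associated ordinary polynomial `P` in `y₀, …, yₘ` and separant `∂P/∂yₘ`, every regular zero `y` of
the ordinary polynomial and every neighbourhood `χ(M, z)` of `0`, there is a regular zero `x` of the
differential polynomial such that `(x, δ x, …, δᵐ x) - y` has its entries in `χ(M, z)`. -/
def SchemeDL (M : FieldStructure L) (χ : Formula L.lang) (δ : M.K → M.K) : Prop :=
  ∀ m : ℕ, 1 ≤ m → ∀ P : MvPolynomial (Fin (m + 1)) M.K, 0 < P.degreeOf (Fin.last m) →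
    ∀ y : Fin (m + 1) → M.K, MvPolynomial.eval y P = 0 →
      MvPolynomial.eval y (MvPolynomial.pderiv (Fin.last m) P) ≠ 0 →
      ∀ z : M.str.Assignment, ∃ x : M.K,
        MvPolynomial.eval (fun i : Fin (m + 1) => δ^[i] x) P = 0 ∧
        MvPolynomial.eval (fun i : Fin (m + 1) => δ^[i] x)
          (MvPolynomial.pderiv (Fin.last m) P) ≠ 0 ∧
        ∀ i : Fin (m + 1), δ^[i] x - y i ∈ M.nhd χ z

/-- The models `(M, δ)` of `T_δ^*`, for `T` the theory of `K₀`: the field `M` is a model of `T`, `δ`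
is a derivation which vanishes on the constants, and the scheme (DL) holds. -/
def TDeltaStar (K₀ : FieldStructure L) (χ : Formula L.lang) (N : Structure L.deltaLang) : Prop :=
  ∃ (M : FieldStructure L) (δ : Derivation ℤ M.K M.K), N = M.deltaStr δ ∧ M.IsModelOf K₀ ∧
    (∀ c : L.Const, δ (M.const c) = 0) ∧ SchemeDL M χ δ

/-! Dense pairs (used for one-sorted languages). -/

/-- `P` is `acl`-closed: every finite set definable with parameters from `P` is contained in `P`.
As `0` is algebraic over the empty set, `P` is non-empty; so values in `P` can be assigned to all
variables, and no generality is lost by doing so. -/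
def IsAclClosed (M : FieldStructure L) (P : Set M.K) : Prop :=
  P.Nonempty ∧ ∀ (φ : Formula L.lang) (v : M.str.Assignment) (n : ℕ),
    (∀ k : ℕ, v (none, k) ∈ P) → (M.str.solutions φ v none n).Finite →
      (M.str.solutions φ v none n : Set M.K) ⊆ P

/-- `P` is dense: it meets every `M`-definable subset of the field of `acl`-dimension `1`. A
definable subset of the field has `acl`-dimension `1` (that is, it has a point outside `acl(M)` in
some elementary extension) if and only if it is infinite. -/
def IsDensePredicate (M : FieldStructure L) (P : Set M.K) : Prop :=
  ∀ (φ : Formula L.lang) (v : M.str.Assignment) (n : ℕ),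
    (M.str.solutions φ v none n).Infinite →
      ∃ a : M.K, a ∈ P ∧ a ∈ (M.str.solutions φ v none n : Set M.K)

/-- The models `(M, P)` of the theory `T_P` of dense pairs, for `T` the theory of `K₀`. -/
def TPair (K₀ : FieldStructure L) (N : Structure L.pairLang) : Prop :=
  ∃ (M : FieldStructure L) (P : Set M.K), N = M.pairStr P ∧ M.IsModelOf K₀ ∧
    IsAclClosed M P ∧ IsDensePredicate M P

end TopFieldDer

/-! Idea of the first half. Once field quantifiers have been removed, an `L_δ`-formula in `x` is an
`L`-formula `φ` evaluated at the jet `x, δ x, δ² x, …` (`exists_term_jet`). Since `T` is open, `φ`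
is a disjunction of polynomial equations joined with an open condition on finitely many jets. The
solutions are sorted by the equations which their jets satisfy.

If no equation truly restricts the jet, `φ` holds on a whole neighbourhood of it, and as jets are
dense there are infinitely many solutions. Otherwise the jet is a zero of one of finitely many
polynomials `q` of some order `l` whose leading coefficient does not vanish (`Crit`). These cases
are treated by induction on the pair consisting of `l` and the degree of `q`. Outside the smaller
cases the separant of `q` is nonzero, and any equation, reduced modulo `q` and its total
derivatives, persists on the regular zeros of `q` and these derivatives
(`exists_crit_of_regularZero`). So `φ` holds at all regular zeros near the given one. Scheme (DL)
finds true jets among them: infinitely many if `l ≥ 1` (`IsGenericDerivation.exists_regularZero`),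
whereas for `l = 0` every solution is a root of one nonzero polynomial of degree at most that of
`q`.

That such a regular zero exists is an `L`-condition on the parameters. If it holds, there is a
solution, and there are infinitely many or at most `deg q` of them; if it fails, only the smaller
cases remain. Therefore `∃` and `∃^∞` are eliminated in the same induction (`Good.of_step`,
`Good.of_crit`, `good_formula`).

Idea of the second half. In a model of `T_δ^*` the kernel of `δ` is a proper dense `acl`-closed
subset (`IsGenericDerivation.isDensePair`), and the first half bounds finite definable sets in this
one pair. The bound passes to all proper dense pairs because their theory is complete
(`IsPartialIso.sat_iff`, `IsDensePair.def_iff`). Completeness is proved by a back-and-forth between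
tuples of equal `L`-type which are algebraic over a part in `P` and a finite part independent over
`P`; partners are found in ultrapowers. A new element is algebraic over the tuple, or in `P`, where
density helps, or independent over `P`. The last case needs points of an infinite definable set
which avoid finitely many families of algebraic relations over `P`
(`IsDensePair.exists_not_algOver`). Such a point is `a + t * c` with `a`, `c` in `P` and `t` a high
power of an element outside `P`. If `P` is the whole field, the predicate carries no information and
the bound for `T` itself applies. -/

namespace TopFieldDer

/-! Connectives, finite support, substitution and definability. -/

section Logic

variable {Λ : Language.{u}}

/-- Negation. -/
def Formula.neg (φ : Formula Λ) : Formula Λ := φ.imp .falsum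

/-- Conjunction. -/
def Formula.and (φ ψ : Formula Λ) : Formula Λ := (φ.imp ψ.neg).neg

/-- Existential quantification. -/
def Formula.ex (s : Λ.Sorts) (n : ℕ) (φ : Formula Λ) : Formula Λ := (Formula.all s n φ.neg).neg

variable {M : Structure Λ} {v w : M.Assignment}

@[simp] theorem Formula.sat_falsum : ¬ (Formula.falsum : Formula Λ).Sat M v := id

@[simp] theorem Formula.sat_imp {φ ψ : Formula Λ} :
    (φ.imp ψ).Sat M v ↔ (φ.Sat M v → ψ.Sat M v) := Iff.rfl

@[simp] theorem Formula.sat_all {s : Λ.Sorts} {n : ℕ} {φ : Formula Λ} :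
    (Formula.all s n φ).Sat M v ↔ ∀ a, φ.Sat M (M.assign v s n a) := Iff.rfl

@[simp] theorem Formula.sat_eq {s : Λ.Sorts} {t t' : Term Λ s} :
    (Formula.eq t t').Sat M v ↔ t.eval M v = t'.eval M v := Iff.rfl

@[simp] theorem Formula.sat_rel {d : List Λ.Sorts} {r : Λ.Rel d}
    {t : ∀ i : Fin d.length, Term Λ (d.get i)} :
    (Formula.rel r t).Sat M v ↔ M.rl r fun i => (t i).eval M v := Iff.rfl

@[simp] theorem Formula.sat_neg {φ : Formula Λ} : φ.neg.Sat M v ↔ ¬ φ.Sat M v := Iff.rfl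

@[simp] theorem Formula.sat_and {φ ψ : Formula Λ} :
    (φ.and ψ).Sat M v ↔ φ.Sat M v ∧ ψ.Sat M v := by
  simp [Formula.and]

@[simp] theorem Formula.sat_ex {s : Λ.Sorts} {n : ℕ} {φ : Formula Λ} :
    (Formula.ex s n φ).Sat M v ↔ ∃ a, φ.Sat M (M.assign v s n a) := by
  simp [Formula.ex]

@[simp] theorem Term.eval_var {s : Λ.Sorts} {n : ℕ} :
    (Term.var s n : Term Λ s).eval M v = v (s, n) := rfl

@[simp] theorem Term.eval_app {d : List Λ.Sorts} {s : Λ.Sorts} {f : Λ.Fun d s}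
    {t : ∀ i : Fin d.length, Term Λ (d.get i)} :
    (Term.app f t).eval M v = M.fn f fun i => (t i).eval M v := rfl

@[simp] theorem Structure.assign_self (v : M.Assignment) (s : Λ.Sorts) (n : ℕ) (a : M.carrier s) :
    M.assign v s n a (s, n) = a := by
  simp [Structure.assign]

theorem Structure.assign_of_ne (v : M.Assignment) {s : Λ.Sorts} {n : ℕ} (a : M.carrier s)
    {x : Λ.Sorts × ℕ} (h : x ≠ (s, n)) : M.assign v s n a x = v x := by
  simp [Structure.assign, h]

theorem Structure.assignment_nonempty (M : Structure Λ) : Nonempty M.Assignment :=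
  ⟨fun x => (M.nonempty x.1).some⟩

theorem Term.exists_support {s : Λ.Sorts} (t : Term Λ s) : ∃ S : Finset (Λ.Sorts × ℕ),
    ∀ (M : Structure Λ) (v w : M.Assignment), (∀ x ∈ S, v x = w x) →
      t.eval M v = t.eval M w := by
  classical
  induction t with
  | var s n => exact ⟨{(s, n)}, fun M v w h => h _ (by simp)⟩
  | app f t ih =>
    choose S hS using ih
    refine ⟨Finset.univ.biUnion S, fun M v w h => ?_⟩
    simp only [Term.eval_app]
    congr 1
    funext i
    exact hS i M v w fun x hx => h x (Finset.mem_biUnion.2 ⟨i, Finset.mem_univ _, hx⟩)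

/-- Stands in for the set of free variables: it is chosen before the structure, and it supplies
fresh variables. -/
theorem Formula.exists_support (φ : Formula Λ) : ∃ S : Finset (Λ.Sorts × ℕ),
    ∀ (M : Structure Λ) (v w : M.Assignment), (∀ x ∈ S, v x = w x) →
      (φ.Sat M v ↔ φ.Sat M w) := by
  classical
  induction φ with
  | falsum => exact ⟨∅, fun M v w h => Iff.rfl⟩
  | eq t t' =>
    obtain ⟨S, hS⟩ := t.exists_support
    obtain ⟨S', hS'⟩ := t'.exists_support
    refine ⟨S ∪ S', fun M v w h => ?_⟩
    rw [sat_eq, sat_eq, hS M v w fun x hx => h x (by simp [hx]),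
      hS' M v w fun x hx => h x (by simp [hx])]
  | rel r t =>
    choose S hS using fun i => (t i).exists_support
    refine ⟨Finset.univ.biUnion S, fun M v w h => ?_⟩
    rw [sat_rel, sat_rel, show (fun i => (t i).eval M v) = fun i => (t i).eval M w from
      funext fun i => hS i M v w fun x hx => h x (Finset.mem_biUnion.2 ⟨i, Finset.mem_univ _, hx⟩)]
  | imp φ ψ ih ih' =>
    obtain ⟨S, hS⟩ := ih
    obtain ⟨S', hS'⟩ := ih'
    refine ⟨S ∪ S', fun M v w h => ?_⟩
    rw [sat_imp, sat_imp, hS M v w fun x hx => h x (by simp [hx]),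
      hS' M v w fun x hx => h x (by simp [hx])]
  | all s n φ ih =>
    obtain ⟨S, hS⟩ := ih
    refine ⟨S, fun M v w h => forall_congr' fun a => hS _ _ _ fun x hx => ?_⟩
    by_cases hxs : x = (s, n)
    · subst hxs; simp
    · rw [Structure.assign_of_ne _ _ hxs, Structure.assign_of_ne _ _ hxs, h x hx]

/-- The assignment obtained from `v` by evaluating a substitution. -/
def Structure.substAssign (M : Structure Λ) (σ : ∀ x : Λ.Sorts × ℕ, Term Λ x.1)
    (v : M.Assignment) : M.Assignment := fun x => (σ x).eval M v

theorem Term.exists_subst {s : Λ.Sorts} (t : Term Λ s) (σ : ∀ x : Λ.Sorts × ℕ, Term Λ x.1) :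
    ∃ t' : Term Λ s, ∀ (M : Structure Λ) (v : M.Assignment),
      t'.eval M v = t.eval M (M.substAssign σ v) := by
  induction t with
  | var s n => exact ⟨σ (s, n), fun M v => rfl⟩
  | app f t ih =>
    choose t' ht' using ih
    exact ⟨.app f t', fun M v => by simp [ht']⟩

/-- To avoid capture, a bound variable is renamed to one which occurs in none of the terms put for
variables of the support. The substitution is quantified inside the induction because it changes at
the bound variable. -/
theorem Formula.exists_subst (φ : Formula Λ) : ∀ σ : (∀ x : Λ.Sorts × ℕ, Term Λ x.1),
    ∃ φ' : Formula Λ, ∀ (M : Structure Λ) (v : M.Assignment),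
      φ'.Sat M v ↔ φ.Sat M (M.substAssign σ v) := by
  classical
  induction φ with
  | falsum => exact fun σ => ⟨.falsum, fun M v => Iff.rfl⟩
  | eq t t' =>
    intro σ
    obtain ⟨s, hs⟩ := t.exists_subst σ
    obtain ⟨s', hs'⟩ := t'.exists_subst σ
    exact ⟨.eq s s', fun M v => by simp [hs, hs']⟩
  | rel r t =>
    intro σ
    choose s hs using fun i => (t i).exists_subst σ
    exact ⟨.rel r s, fun M v => by simp [hs]⟩
  | imp φ ψ ih ih' =>
    intro σ
    obtain ⟨s, hs⟩ := ih σ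
    obtain ⟨s', hs'⟩ := ih' σ
    exact ⟨.imp s s', fun M v => by simp [hs, hs']⟩
  | all s n φ ih =>
    intro σ
    obtain ⟨S, hS⟩ := φ.exists_support
    choose T hT using fun x => (σ x).exists_support
    obtain ⟨m, hm⟩ : ∃ m, ∀ x ∈ S, (s, m) ∉ T x := by
      obtain ⟨m, hm⟩ := Infinite.exists_notMem_finset ((S.biUnion T).image Prod.snd)
      exact ⟨m, fun x hx hmx => hm (Finset.mem_image.2
        ⟨(s, m), Finset.mem_biUnion.2 ⟨x, hx, hmx⟩, rfl⟩)⟩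
    obtain ⟨φ', hφ'⟩ := ih (Function.update σ (s, n) (.var s m))
    refine ⟨.all s m φ', fun M v => forall_congr' fun a => ?_⟩
    rw [hφ']
    refine hS _ _ _ fun x hx => ?_
    by_cases hxs : x = (s, n)
    · subst hxs; simp [Structure.substAssign]
    · rw [Structure.assign_of_ne _ _ hxs]
      simp only [Structure.substAssign, Function.update_of_ne hxs]
      refine hT x _ _ _ fun y hy => Structure.assign_of_ne _ _ ?_
      rintro rfl
      exact hm x hx hy

theorem Formula.exists_exList (φ : Formula Λ) (l : List (Λ.Sorts × ℕ)) :
    ∃ φ' : Formula Λ, ∀ (M : Structure Λ) (v : M.Assignment),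
      φ'.Sat M v ↔ ∃ w : M.Assignment, (∀ x, x ∉ l → w x = v x) ∧ φ.Sat M w := by
  induction l with
  | nil =>
    refine ⟨φ, fun M v => ⟨fun h => ⟨v, by simp, h⟩, ?_⟩⟩
    rintro ⟨w, hw, h⟩
    rwa [← show w = v from funext fun x => hw x (by simp)]
  | cons y l ih =>
    obtain ⟨φ', hφ'⟩ := ih
    refine ⟨.ex y.1 y.2 φ', fun M v => ?_⟩
    simp only [sat_ex, hφ']
    constructor
    · rintro ⟨a, w, hw, h⟩
      refine ⟨w, fun x hx => ?_, h⟩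
      simp only [List.mem_cons, not_or] at hx
      rw [hw x hx.2, Structure.assign_of_ne _ _ hx.1]
    · rintro ⟨w, hw, h⟩
      refine ⟨w y, w, fun x hx => ?_, h⟩
      by_cases hxy : x = y
      · subst hxy; exact (Structure.assign_self v x.1 x.2 (w x)).symm
      · rw [Structure.assign_of_ne _ _ hxy]
        exact hw x (by simp [hxy, hx])

/-- Only finitely many variables of `V` lie in the support, so a finite block of quantifiers does
the work of an infinite one. -/
theorem Formula.exists_exSet (φ : Formula Λ) (V : Set (Λ.Sorts × ℕ)) :
    ∃ φ' : Formula Λ, ∀ (M : Structure Λ) (v : M.Assignment),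
      φ'.Sat M v ↔ ∃ w : M.Assignment, (∀ x, x ∉ V → w x = v x) ∧ φ.Sat M w := by
  classical
  obtain ⟨S, hS⟩ := φ.exists_support
  obtain ⟨φ', hφ'⟩ := φ.exists_exList (S.filter (· ∈ V)).toList
  refine ⟨φ', fun M v => (hφ' M v).trans ⟨?_, ?_⟩⟩
  · rintro ⟨w, hw, h⟩
    exact ⟨w, fun x hx => hw x (by simp [hx]), h⟩
  · rintro ⟨w, hw, h⟩
    refine ⟨fun x => if x ∈ (S.filter (· ∈ V)).toList then w x else v x,
      fun x hx => if_neg hx, (hS M _ w fun x hx => ?_).2 h⟩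
    by_cases hxV : x ∈ V
    · simp [hx, hxV]
    · simp [hxV, hw x hxV]

/-! Definable relations on assignments, uniformly in a class of structures. -/

/-- The relation `R` on assignments is defined by one formula in all structures of a family. -/
def Def {ι : Type*} (str : ι → Structure Λ) (R : ∀ i, (str i).Assignment → Prop) : Prop :=
  ∃ φ : Formula Λ, ∀ i v, φ.Sat (str i) v ↔ R i v

/-- A sequence of assignments coded as one assignment. -/
def Structure.join (M : Structure Λ) (vs : ℕ → M.Assignment) : M.Assignment :=
  fun x => vs (Nat.unpair x.2).1 (x.1, (Nat.unpair x.2).2)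

@[simp] theorem Structure.join_pair (vs : ℕ → M.Assignment) (s : Λ.Sorts) (i n : ℕ) :
    M.join vs (s, Nat.pair i n) = vs i (s, n) := by
  change vs (Nat.unpair (Nat.pair i n)).1 (s, (Nat.unpair (Nat.pair i n)).2) = _
  rw [Nat.unpair_pair]

/-- The assignments coded by one assignment. -/
def Structure.unjoin (M : Structure Λ) (v : M.Assignment) : ℕ → M.Assignment :=
  fun i x => v (x.1, Nat.pair i x.2)

/-- The relation `R` on sequences of assignments is defined by one formula in all structures of
a family. -/
def DefS {ι : Type*} (str : ι → Structure Λ) (R : ∀ i, (ℕ → (str i).Assignment) → Prop) : Prop :=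
  ∃ φ : Formula Λ, ∀ i vs, φ.Sat (str i) ((str i).join vs) ↔ R i vs

/-- The function `f` from sequences of assignments to assignments is given by terms. -/
def TermMap {ι : Type*} (str : ι → Structure Λ)
    (f : ∀ i, (ℕ → (str i).Assignment) → (str i).Assignment) : Prop :=
  ∀ x : Λ.Sorts × ℕ, ∃ t : Term Λ x.1, ∀ i vs, t.eval (str i) ((str i).join vs) = f i vs x

variable {ι : Type*} {str : ι → Structure Λ}

theorem TermMap.slot (j : ℕ) : TermMap str (fun _ vs => vs j) :=
  fun x => ⟨.var x.1 (Nat.pair j x.2), fun i vs => by simp⟩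

theorem Def.comp {R : ∀ i, (str i).Assignment → Prop} (hR : Def str R)
    {f : ∀ i, (ℕ → (str i).Assignment) → (str i).Assignment} (hf : TermMap str f) :
    DefS str fun i vs => R i (f i vs) := by
  obtain ⟨φ, hφ⟩ := hR
  choose σ hσ using hf
  obtain ⟨φ', hφ'⟩ := φ.exists_subst σ
  refine ⟨φ', fun i vs => ?_⟩
  refine (hφ' _ _).trans (Iff.trans (iff_of_eq ?_) (hφ i _))
  exact congrArg (fun w => φ.Sat (str i) w) (funext fun x => hσ x i vs)

theorem Def.slot {R : ∀ i, (str i).Assignment → Prop} (hR : Def str R) (j : ℕ) :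
    DefS str fun i vs => R i (vs j) := hR.comp (TermMap.slot j)

theorem DefS.toDef {R : ∀ i, (ℕ → (str i).Assignment) → Prop} (hR : DefS str R) :
    Def str fun i v => R i fun _ => v := by
  obtain ⟨φ, hφ⟩ := hR
  obtain ⟨φ', hφ'⟩ := φ.exists_subst fun x => .var x.1 (Nat.unpair x.2).2
  exact ⟨φ', fun i v => (hφ' _ _).trans (hφ i fun _ => v)⟩

theorem Def.congr {R R' : ∀ i, (str i).Assignment → Prop} (hR : Def str R)
    (h : ∀ i v, R i v ↔ R' i v) : Def str R' :=
  hR.imp fun _ hφ i v => (hφ i v).trans (h i v)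

theorem DefS.congr {R R' : ∀ i, (ℕ → (str i).Assignment) → Prop} (hR : DefS str R)
    (h : ∀ i v, R i v ↔ R' i v) : DefS str R' :=
  hR.imp fun _ hφ i v => (hφ i v).trans (h i v)

theorem DefS.of_def {R : ∀ i, (ℕ → (str i).Assignment) → Prop}
    (hR : Def str fun i v => R i ((str i).unjoin v)) : DefS str R := by
  obtain ⟨φ, hφ⟩ := hR
  refine ⟨φ, fun i vs => (hφ i _).trans (iff_of_eq (congrArg _ ?_))⟩
  funext j x
  simp [Structure.unjoin]

theorem Def.imp {R R' : ∀ i, (str i).Assignment → Prop} (hR : Def str R) (hR' : Def str R') :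
    Def str fun i v => R i v → R' i v := by
  obtain ⟨φ, hφ⟩ := hR
  obtain ⟨ψ, hψ⟩ := hR'
  exact ⟨φ.imp ψ, fun i v => by simp [hφ, hψ]⟩

theorem Def.and {R R' : ∀ i, (str i).Assignment → Prop} (hR : Def str R) (hR' : Def str R') :
    Def str fun i v => R i v ∧ R' i v := by
  obtain ⟨φ, hφ⟩ := hR
  obtain ⟨ψ, hψ⟩ := hR'
  exact ⟨φ.and ψ, fun i v => by simp [hφ, hψ]⟩

theorem Def.not {R : ∀ i, (str i).Assignment → Prop} (hR : Def str R) :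
    Def str fun i v => ¬ R i v := by
  obtain ⟨φ, hφ⟩ := hR
  exact ⟨φ.neg, fun i v => by simp [hφ]⟩

theorem Def.const (p : Prop) : Def str fun _ _ => p := by
  by_cases hp : p
  · exact ⟨.imp .falsum .falsum, fun i v => by simp [hp]⟩
  · exact ⟨.falsum, fun i v => by simp [hp]⟩

theorem Def.forall_mem {α : Type*} (s : Finset α) {R : α → ∀ i, (str i).Assignment → Prop}
    (hR : ∀ a ∈ s, Def str (R a)) : Def str fun i v => ∀ a ∈ s, R a i v := by
  classical
  induction s using Finset.induction_on with
  | empty => exact (Def.const True).congr fun _ _ => by simp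
  | insert a s _ ih =>
    exact ((hR a (by simp)).and (ih fun b hb => hR b (by simp [hb]))).congr fun _ _ => by simp

theorem Def.ex {R : ∀ i, (str i).Assignment → Prop} (hR : Def str R) (s : Λ.Sorts) (n : ℕ) :
    Def str fun i v => ∃ a, R i ((str i).assign v s n a) := by
  obtain ⟨φ, hφ⟩ := hR
  exact ⟨φ.ex s n, fun i v => by simp [hφ]⟩

theorem Def.exAll {R : ∀ i, (str i).Assignment → Prop} (hR : Def str R) :
    Def str fun i _ => ∃ w, R i w := by
  obtain ⟨φ, hφ⟩ := hR
  obtain ⟨φ', hφ'⟩ := φ.exists_exSet Set.univ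
  exact ⟨φ', fun i v => by simp [hφ', hφ]⟩

theorem DefS.imp {R R' : ∀ i, (ℕ → (str i).Assignment) → Prop} (hR : DefS str R)
    (hR' : DefS str R') : DefS str fun i v => R i v → R' i v := by
  obtain ⟨φ, hφ⟩ := hR
  obtain ⟨ψ, hψ⟩ := hR'
  exact ⟨φ.imp ψ, fun i v => by simp [hφ, hψ]⟩

theorem DefS.and {R R' : ∀ i, (ℕ → (str i).Assignment) → Prop} (hR : DefS str R)
    (hR' : DefS str R') : DefS str fun i v => R i v ∧ R' i v := by
  obtain ⟨φ, hφ⟩ := hR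
  obtain ⟨ψ, hψ⟩ := hR'
  exact ⟨φ.and ψ, fun i v => by simp [hφ, hψ]⟩

theorem DefS.not {R : ∀ i, (ℕ → (str i).Assignment) → Prop} (hR : DefS str R) :
    DefS str fun i v => ¬ R i v := by
  obtain ⟨φ, hφ⟩ := hR
  exact ⟨φ.neg, fun i v => by simp [hφ]⟩

theorem DefS.const (p : Prop) : DefS str fun _ _ => p :=
  DefS.of_def (Def.const p)

theorem DefS.forall_mem {α : Type*} (s : Finset α)
    {R : α → ∀ i, (ℕ → (str i).Assignment) → Prop}
    (hR : ∀ a ∈ s, DefS str (R a)) : DefS str fun i v => ∀ a ∈ s, R a i v := by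
  classical
  induction s using Finset.induction_on with
  | empty => exact (DefS.const True).congr fun _ _ => by simp
  | insert a s _ ih =>
    exact ((hR a (by simp)).and (ih fun b hb => hR b (by simp [hb]))).congr fun _ _ => by simp

/-- The `j`-th assignment occupies the variables `(s, Nat.pair j n)`. Hence quantifying over a whole
assignment is quantifying over this set of variables. -/
theorem DefS.ex {R : ∀ i, (ℕ → (str i).Assignment) → Prop} (hR : DefS str R) (j : ℕ) :
    DefS str fun i vs => ∃ w, R i (Function.update vs j w) := by
  obtain ⟨φ, hφ⟩ := hR
  obtain ⟨φ', hφ'⟩ := φ.exists_exSet {x | (Nat.unpair x.2).1 = j}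
  refine ⟨φ', fun i vs => (hφ' _ _).trans ⟨?_, ?_⟩⟩
  · rintro ⟨w, hw, h⟩
    refine ⟨(str i).unjoin w j, (hφ i _).1 ?_⟩
    convert h using 1
    funext ⟨s, n⟩
    by_cases hn : (Nat.unpair n).1 = j
    · subst hn
      simp only [Structure.join, Function.update_self]
      have h : ∀ k, k = n → (show (str i).carrier s from w (s, k)) = w (s, n) := by
        rintro _ rfl; rfl
      exact h _ (Nat.pair_unpair n)
    · rw [hw _ hn]; simp [Structure.join, hn]
  · rintro ⟨w, h⟩
    refine ⟨_, fun x hx => ?_, (hφ i _).2 h⟩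
    simp only [Set.mem_ofPred_eq] at hx
    simp [Structure.join, hx]

theorem DefS.all {R : ∀ i, (ℕ → (str i).Assignment) → Prop} (hR : DefS str R) (j : ℕ) :
    DefS str fun i vs => ∀ w, R i (Function.update vs j w) :=
  (hR.not.ex j).not.congr fun _ _ => by simp

/-- The relation "there are at least `k` solutions" is definable. -/
theorem Formula.exists_card_le (φ : Formula Λ) (s : Λ.Sorts) (n k : ℕ) :
    ∃ φ' : Formula Λ, ∀ (M : Structure Λ) (v : M.Assignment),
      φ'.Sat M v ↔ (k : ℕ∞) ≤ (M.solutions φ v s n).encard := by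
  induction k generalizing φ with
  | zero => exact ⟨.imp .falsum .falsum, fun M v => by simp⟩
  | succ k ih =>
    obtain ⟨S, hS⟩ := φ.exists_support
    obtain ⟨m, hm⟩ := Infinite.exists_notMem_finset (insert n (S.image Prod.snd))
    simp only [Finset.mem_insert, Finset.mem_image, not_or, not_exists, not_and] at hm
    obtain ⟨ψ, hψ⟩ := ih (φ.and (Formula.neg (.eq (.var s n) (.var s m))))
    have hne : ((s, m) : Λ.Sorts × ℕ) ≠ (s, n) := fun h => hm.1 (congrArg Prod.snd h)
    have key : ∀ (M : Structure Λ) (v : M.Assignment) (a b : M.carrier s),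
        φ.Sat M (M.assign (M.assign v s m b) s n a) ↔ φ.Sat M (M.assign v s n a) := by
      intro M v a b
      refine hS M _ _ fun x hx => ?_
      by_cases hxn : x = (s, n)
      · subst hxn; simp
      · rw [Structure.assign_of_ne _ _ hxn, Structure.assign_of_ne _ _ hxn,
          Structure.assign_of_ne]
        rintro rfl
        exact hm.2 _ hx rfl
    -- At least `k + 1` solutions: some solution, stored in the fresh variable `m`, and at least `k`
    -- solutions different from it.
    refine ⟨.ex s m (Formula.and (.ex s n (φ.and (.eq (.var s n) (.var s m)))) ψ), fun M v => ?_⟩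
    have h2 : ∀ b, M.solutions (φ.and (Formula.neg (.eq (.var s n) (.var s m))))
        (M.assign v s m b) s n = M.solutions φ v s n \ {b} := by
      intro b
      ext a
      simp only [Structure.solutions, Set.mem_ofPred_eq, Formula.sat_and, key, Formula.sat_neg,
        Formula.sat_eq, Term.eval_var, Structure.assign_self, Set.mem_sdiff, Set.mem_singleton_iff,
        Structure.assign_of_ne _ _ hne]
    simp only [sat_ex, sat_and, sat_eq, Term.eval_var, Structure.assign_self,
      Structure.assign_of_ne _ _ hne, hψ, h2, key]
    constructor
    · rintro ⟨b, ⟨a, ha, rfl⟩, h⟩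
      have : a ∈ M.solutions φ v s n := ha
      rw [← Set.encard_sdiff_singleton_add_one this]
      push_cast
      gcongr
    · intro h
      have hne : (M.solutions φ v s n).Nonempty := by
        rw [← Set.encard_pos]
        refine lt_of_lt_of_le ?_ h
        simp
      obtain ⟨a, ha⟩ := hne
      refine ⟨a, ⟨a, ha, rfl⟩, ?_⟩
      rw [← Set.encard_sdiff_singleton_add_one ha] at h
      push_cast at h
      exact (ENat.add_le_add_iff_right (by simp)).1 h

end Logic

end TopFieldDer

namespace TopFieldDer

/-! Field terms, and the topology of the models of a theory of topological fields. -/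

section FieldTerms

variable {L : FieldLanguage.{u}}

/-- Sum of terms. -/
def Term.add (t t' : Term L.lang none) : Term L.lang none :=
  Term.app (L := L.lang) FieldLanguage.Fun.add fun | ⟨0, _⟩ => t | ⟨1, _⟩ => t'

/-- Product of terms. -/
def Term.mul (t t' : Term L.lang none) : Term L.lang none :=
  Term.app (L := L.lang) FieldLanguage.Fun.mul fun | ⟨0, _⟩ => t | ⟨1, _⟩ => t'

/-- Negative of a term. -/
def Term.neg (t : Term L.lang none) : Term L.lang none :=
  Term.app (L := L.lang) FieldLanguage.Fun.neg fun | ⟨0, _⟩ => t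

/-- Inverse of a term. -/
def Term.inv (t : Term L.lang none) : Term L.lang none :=
  Term.app (L := L.lang) FieldLanguage.Fun.inv fun | ⟨0, _⟩ => t

/-- The term `0`. -/
def Term.zero : Term L.lang none :=
  Term.app (L := L.lang) FieldLanguage.Fun.zero fun i => i.elim0

/-- The term `1`. -/
def Term.one : Term L.lang none :=
  Term.app (L := L.lang) FieldLanguage.Fun.one fun i => i.elim0

/-- A constant symbol as a term. -/
def Term.const (c : L.Const) : Term L.lang none :=
  Term.app (L := L.lang) (FieldLanguage.Fun.const c) fun i => i.elim0

section

variable (M : FieldStructure L) (v : M.str.Assignment) (t t' : Term L.lang none)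

@[simp] theorem Term.eval_add :
    (t.add t').eval M.str v = (show M.K from t.eval M.str v) + (show M.K from t'.eval M.str v) :=
  rfl

@[simp] theorem Term.eval_mul :
    (t.mul t').eval M.str v = (show M.K from t.eval M.str v) * (show M.K from t'.eval M.str v) :=
  rfl

@[simp] theorem Term.eval_neg : t.neg.eval M.str v = -(show M.K from t.eval M.str v) := rfl

@[simp] theorem Term.eval_inv : t.inv.eval M.str v = (show M.K from t.eval M.str v)⁻¹ := rfl

end

/-- The field coordinates of an assignment. -/
def FieldStructure.coord (M : FieldStructure L) (v : M.str.Assignment) : ℕ → M.K :=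
  fun n => v (none, n)

/-- Evaluation of polynomials over `ℤ[Ω]`. -/
noncomputable def FieldStructure.ev (M : FieldStructure L) (y : ℕ → M.K) :
    MvPolynomial ℕ (MvPolynomial L.Const ℤ) →+* M.K :=
  MvPolynomial.eval₂Hom (MvPolynomial.aeval M.const).toRingHom y

@[simp] theorem FieldStructure.ev_X (M : FieldStructure L) (y : ℕ → M.K) (n : ℕ) :
    M.ev y (MvPolynomial.X n) = y n := by
  simp [FieldStructure.ev]

@[simp] theorem FieldStructure.ev_C (M : FieldStructure L) (y : ℕ → M.K)
    (c : MvPolynomial L.Const ℤ) :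
    M.ev y (MvPolynomial.C c) = MvPolynomial.aeval M.const c := by
  simp [FieldStructure.ev]

theorem FieldStructure.eval_poly (M : FieldStructure L) (y : ℕ → M.K)
    (P : MvPolynomial ℕ (MvPolynomial L.Const ℤ)) :
    MvPolynomial.eval y (M.poly P) = M.ev y P := by
  rw [FieldStructure.poly, MvPolynomial.eval_map]; rfl

/-- The family of all `L`-structures of fields. -/
abbrev fieldStr (L : FieldLanguage.{u}) : FieldStructure L → Structure L.lang := fun M => M.str

/-- The field-valued function `f` on sequences of assignments is given by a term. -/
def TermFun (f : ∀ M : FieldStructure L, (ℕ → M.str.Assignment) → M.K) : Prop :=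
  ∃ t : Term L.lang none, ∀ (M : FieldStructure L) (vs : ℕ → M.str.Assignment),
    t.eval M.str (M.str.join vs) = f M vs

theorem TermFun.coord (i n : ℕ) : TermFun (L := L) fun _ vs => vs i (none, n) :=
  ⟨Term.var (L := L.lang) none (Nat.pair i n),
    fun M vs => Structure.join_pair (M := M.str) vs none i n⟩

variable {f g : ∀ M : FieldStructure L, (ℕ → M.str.Assignment) → M.K}

theorem TermFun.add (hf : TermFun f) (hg : TermFun g) : TermFun fun M vs => f M vs + g M vs := by
  obtain ⟨t, ht⟩ := hf
  obtain ⟨s, hs⟩ := hg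
  exact ⟨t.add s, fun M vs => by rw [Term.eval_add, ht, hs]⟩

theorem TermFun.mul (hf : TermFun f) (hg : TermFun g) : TermFun fun M vs => f M vs * g M vs := by
  obtain ⟨t, ht⟩ := hf
  obtain ⟨s, hs⟩ := hg
  exact ⟨t.mul s, fun M vs => by rw [Term.eval_mul, ht, hs]⟩

theorem TermFun.neg (hf : TermFun f) : TermFun fun M vs => -f M vs := by
  obtain ⟨t, ht⟩ := hf
  exact ⟨t.neg, fun M vs => by rw [Term.eval_neg, ht]⟩

theorem TermFun.sub (hf : TermFun f) (hg : TermFun g) : TermFun fun M vs => f M vs - g M vs := by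
  simpa only [sub_eq_add_neg] using hf.add hg.neg

theorem TermFun.inv (hf : TermFun f) : TermFun fun M vs => (f M vs)⁻¹ := by
  obtain ⟨t, ht⟩ := hf
  exact ⟨t.inv, fun M vs => by rw [Term.eval_inv, ht]⟩

theorem TermFun.zero : TermFun (L := L) fun _ _ => 0 := ⟨.zero, fun _ _ => rfl⟩

theorem TermFun.one : TermFun (L := L) fun _ _ => 1 := ⟨.one, fun _ _ => rfl⟩

theorem TermFun.natCast (n : ℕ) : TermFun (L := L) fun M _ => (n : M.K) := by
  induction n with
  | zero => simpa using TermFun.zero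
  | succ n ih => simpa using ih.add TermFun.one

theorem TermFun.aeval_const (c : MvPolynomial L.Const ℤ) :
    TermFun fun M _ => MvPolynomial.aeval M.const c := by
  induction c using MvPolynomial.induction_on with
  | C z =>
    rcases Int.eq_nat_or_neg z with ⟨n, rfl | rfl⟩
    · simpa using TermFun.natCast n
    · simpa using (TermFun.natCast n).neg
  | add p q hp hq => simpa using hp.add hq
  | mul_X p c hp =>
    have : TermFun (L := L) fun M _ => M.const c := ⟨.const c, fun _ _ => rfl⟩
    simpa using hp.mul this

theorem TermFun.ev {y : ∀ M : FieldStructure L, (ℕ → M.str.Assignment) → ℕ → M.K}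
    (hy : ∀ n, TermFun fun M vs => y M vs n) (P : MvPolynomial ℕ (MvPolynomial L.Const ℤ)) :
    TermFun fun M vs => M.ev (y M vs) P := by
  induction P using MvPolynomial.induction_on with
  | C c => simpa using TermFun.aeval_const c
  | add p q hp hq => simpa using hp.add hq
  | mul_X p n hp => simpa using hp.mul (hy n)

theorem TermFun.eq (hf : TermFun f) (hg : TermFun g) :
    DefS (fieldStr L) fun M vs => f M vs = g M vs := by
  obtain ⟨t, ht⟩ := hf
  obtain ⟨s, hs⟩ := hg
  exact ⟨.eq t s, fun M vs => by rw [Formula.sat_eq, ht, hs]⟩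

theorem Def.ev_eq_zero (P : MvPolynomial ℕ (MvPolynomial L.Const ℤ)) :
    Def (fieldStr L) fun M v => M.ev (M.coord v) P = 0 :=
  ((TermFun.ev (y := fun M vs => M.coord (vs 0)) (TermFun.coord 0) P).eq TermFun.zero).toDef

theorem TermMap.assign (hf : TermFun f) (j n : ℕ) :
    TermMap (fieldStr L) fun M vs => M.str.assign (vs j) none n (f M vs) := by
  obtain ⟨t, ht⟩ := hf
  intro x
  by_cases hx : x = (none, n)
  · subst hx
    exact ⟨t, fun M vs => (ht M vs).trans
      (Structure.assign_self (M := M.str) (vs j) none n (f M vs)).symm⟩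
  · exact ⟨Term.var (L := L.lang) x.1 (Nat.pair j x.2), fun M vs =>
      (Structure.join_pair (M := M.str) vs x.1 j x.2).trans
        (Structure.assign_of_ne (M := M.str) (vs j) (f M vs) hx).symm⟩

theorem TermMap.withField {y : ∀ M : FieldStructure L, (ℕ → M.str.Assignment) → ℕ → M.K}
    (hy : ∀ n, TermFun fun M vs => y M vs n) (j : ℕ) :
    TermMap (fieldStr L) fun M vs => M.withField (vs j) (y M vs) := by
  rintro ⟨_ | a, n⟩
  · obtain ⟨t, ht⟩ := hy n
    exact ⟨t, fun M vs => ht M vs⟩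
  · exact ⟨Term.var (L := L.lang) (some a) (Nat.pair j n),
      fun M vs => Structure.join_pair (M := M.str) vs (some a) j n⟩

theorem TermFun.mem_nhd (hf : TermFun f) (χ : Formula L.lang) (j : ℕ) :
    DefS (fieldStr L) fun M vs => f M vs ∈ M.nhd χ (vs j) :=
  Def.comp (str := fieldStr L) (R := fun M v => χ.Sat M.str v) ⟨χ, fun _ _ => Iff.rfl⟩
    (TermMap.assign hf j 0)

/-- A first-order property which holds in `K₀` holds in the models of its theory. -/
theorem Def.transfer {Q : FieldStructure L → Prop} (hQ : Def (fieldStr L) fun M _ => Q M)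
    {K₀ M : FieldStructure L} (hM : M.IsModelOf K₀) (h : Q K₀) : Q M := by
  obtain ⟨φ, hφ⟩ := hQ
  exact (hφ M M.str.assignment_nonempty.some).1 (hM φ (fun v => (hφ K₀ v).2 h) _)

end FieldTerms

end TopFieldDer

namespace TopFieldDer

/-! ### First-order axioms for the definable field topology -/

section Topology

variable {L : FieldLanguage.{u}}

/-- The first-order properties of the sets `χ(M, z)` which say that they form a basis of
neighbourhoods of `0` for a non-discrete Hausdorff field topology. -/
structure NhdAxioms (χ : Formula L.lang) (M : FieldStructure L) : Prop where
  zero : ∀ z, 0 ∈ M.nhd χ z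
  inter : ∀ z z', ∃ z'', M.nhd χ z'' ⊆ M.nhd χ z ∩ M.nhd χ z'
  add : ∀ z, ∃ z', ∀ x ∈ M.nhd χ z', ∀ y ∈ M.nhd χ z', x + y ∈ M.nhd χ z
  neg : ∀ z, ∃ z', ∀ x ∈ M.nhd χ z', -x ∈ M.nhd χ z
  mul : ∀ z, ∃ z', ∀ x ∈ M.nhd χ z', ∀ y ∈ M.nhd χ z', x * y ∈ M.nhd χ z
  mul_left : ∀ a z, ∃ z', ∀ x ∈ M.nhd χ z', a * x ∈ M.nhd χ z
  inv : ∀ z, ∃ z', ∀ x ∈ M.nhd χ z', (1 + x)⁻¹ - 1 ∈ M.nhd χ z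
  hausdorff : ∀ x, x ≠ 0 → ∃ z, x ∉ M.nhd χ z
  nondiscrete : ∀ z, ∃ x ∈ M.nhd χ z, x ≠ 0

/-- Continuity of the operations at `0`, and of inversion at `1`, read off from the basis of
neighbourhoods. -/
theorem nhdAxioms_of_definesFieldTopology {χ : Formula L.lang} {M : FieldStructure L}
    (h : M.DefinesFieldTopology χ) : NhdAxioms χ M := by
  let := M.topology χ
  obtain ⟨h1, h2, h3, hb⟩ := h
  have mem : ∀ z, M.nhd χ z ∈ 𝓝 (0 : M.K) := fun z => hb.mem_of_mem trivial
  have get : ∀ s ∈ 𝓝 (0 : M.K), ∃ z, M.nhd χ z ⊆ s := fun s hs => by simpa using hb.mem_iff.1 hs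
  have get2 : ∀ f : M.K × M.K → M.K, Continuous f → f (0, 0) = 0 → ∀ z, ∃ z',
      ∀ x ∈ M.nhd χ z', ∀ y ∈ M.nhd χ z', f (x, y) ∈ M.nhd χ z := by
    intro f hf hf0 z
    have h : f ⁻¹' M.nhd χ z ∈ 𝓝 ((0 : M.K), (0 : M.K)) :=
      hf.continuousAt.preimage_mem_nhds (by rw [hf0]; exact mem z)
    rw [nhds_prod_eq, mem_prod_same_iff] at h
    obtain ⟨t, ht, h⟩ := h
    obtain ⟨z', hz'⟩ := get t ht
    exact ⟨z', fun x hx y hy => h (Set.mk_mem_prod (hz' hx) (hz' hy))⟩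
  have get1 : ∀ f : M.K → M.K, ContinuousAt f 0 → f 0 = 0 → ∀ z, ∃ z',
      ∀ x ∈ M.nhd χ z', f x ∈ M.nhd χ z := by
    intro f hf hf0 z
    have h : f ⁻¹' M.nhd χ z ∈ 𝓝 (0 : M.K) :=
      hf.preimage_mem_nhds (by rw [hf0]; exact mem z)
    exact get _ h
  refine ⟨fun z => mem_of_mem_nhds (mem z), fun z z' => get _ (inter_mem (mem z) (mem z')),
    get2 (fun p => p.1 + p.2) (by fun_prop) (by simp), get1 _ (by fun_prop) (by simp),
    get2 (fun p => p.1 * p.2) (by fun_prop) (by simp),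
    fun a => get1 (fun x => a * x) (by fun_prop) (by simp), get1 _ ?_ (by simp), ?_, ?_⟩
  · refine ContinuousAt.sub (ContinuousAt.inv₀ (by fun_prop) (by simp)) (by fun_prop)
  · intro x hx
    obtain ⟨z, hz⟩ := get _ (isOpen_compl_singleton.mem_nhds hx.symm)
    exact ⟨z, fun hxz => hz hxz rfl⟩
  · intro z
    by_contra! hcon
    refine h3 (discreteTopology_of_isOpen_singleton_zero ?_)
    rw [isOpen_singleton_iff_nhds_eq_pure]
    refine le_antisymm (fun s hs => ?_) (pure_le_nhds _)
    exact mem_of_superset (mem z) fun x hx => by rw [hcon x hx]; exact hs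

/-- The assignment with the field coordinates `u` and arbitrary auxiliary coordinates. -/
noncomputable def FieldStructure.ofField (M : FieldStructure L) (u : ℕ → M.K) : M.str.Assignment :=
  M.withField M.str.assignment_nonempty.some u

theorem DefS.transfer {Q : FieldStructure L → Prop} (hQ : DefS (fieldStr L) fun M _ => Q M)
    {K₀ M : FieldStructure L} (hM : M.IsModelOf K₀) (h : Q K₀) : Q M :=
  Def.transfer hQ.toDef hM h

/-- Every axiom becomes a sentence when it quantifies over whole assignments only. An assignment is
used either as the parameter tuple of `χ` or, through its field coordinates `0` and `1`, as a name
for field elements. -/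
theorem NhdAxioms.transfer {χ : Formula L.lang} {K₀ M : FieldStructure L} (h : NhdAxioms χ K₀)
    (hM : M.IsModelOf K₀) : NhdAxioms χ M := by
  have mem : ∀ i n j, DefS (fieldStr L) fun M vs => (vs i (none, n) : M.K) ∈ M.nhd χ (vs j) :=
    fun i n j => (TermFun.coord i n).mem_nhd χ j
  refine ⟨?_, ?_, ?_, ?_, ?_, ?_, ?_, ?_, ?_⟩
  · exact DefS.transfer (Q := fun M => ∀ z, 0 ∈ M.nhd χ z)
      (((TermFun.zero.mem_nhd χ 0).all 0).congr fun _ _ => Iff.rfl) hM h.zero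
  · have := DefS.transfer (Q := fun M => ∀ z z', ∃ z'', ∀ w : M.str.Assignment,
        w (none, 0) ∈ M.nhd χ z'' → w (none, 0) ∈ M.nhd χ z ∧ w (none, 0) ∈ M.nhd χ z')
      (((((((mem 3 0 2).imp ((mem 3 0 0).and (mem 3 0 1))).all 3).ex 2).all 1).all 0).congr
        fun _ _ => Iff.rfl) hM fun z z' => (h.inter z z').imp fun _ h w hw => h hw
    exact fun z z' => (this z z').imp fun z'' h x hx => h (M.ofField fun _ => x) hx
  · have := DefS.transfer (Q := fun M => ∀ z, ∃ z', ∀ w : M.str.Assignment,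
        w (none, 0) ∈ M.nhd χ z' → w (none, 1) ∈ M.nhd χ z' →
          (w (none, 0) + w (none, 1) : M.K) ∈ M.nhd χ z)
      (((((mem 2 0 1).imp ((mem 2 1 1).imp (((TermFun.coord 2 0).add
        (TermFun.coord 2 1)).mem_nhd χ 0))).all 2).ex 1).all 0 |>.congr fun _ _ => Iff.rfl)
      hM fun z => (h.add z).imp fun _ h w hw hw' => h _ hw _ hw'
    exact fun z => (this z).imp fun z' h x hx y hy =>
      h (M.ofField fun n => if n = 0 then x else y) hx hy
  · have := DefS.transfer (Q := fun M => ∀ z, ∃ z', ∀ w : M.str.Assignment,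
        w (none, 0) ∈ M.nhd χ z' → (-w (none, 0) : M.K) ∈ M.nhd χ z)
      (((((mem 2 0 1).imp ((TermFun.coord 2 0).neg.mem_nhd χ 0)).all 2).ex 1).all 0
        |>.congr fun _ _ => Iff.rfl)
      hM fun z => (h.neg z).imp fun _ h w hw => h _ hw
    exact fun z => (this z).imp fun z' h x hx => h (M.ofField fun n => x) hx
  · have := DefS.transfer (Q := fun M => ∀ z, ∃ z', ∀ w : M.str.Assignment,
        w (none, 0) ∈ M.nhd χ z' → w (none, 1) ∈ M.nhd χ z' →
          (w (none, 0) * w (none, 1) : M.K) ∈ M.nhd χ z)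
      (((((mem 2 0 1).imp ((mem 2 1 1).imp (((TermFun.coord 2 0).mul
        (TermFun.coord 2 1)).mem_nhd χ 0))).all 2).ex 1).all 0 |>.congr fun _ _ => Iff.rfl)
      hM fun z => (h.mul z).imp fun _ h w hw hw' => h _ hw _ hw'
    exact fun z => (this z).imp fun z' h x hx y hy =>
      h (M.ofField fun n => if n = 0 then x else y) hx hy
  · have := DefS.transfer (Q := fun M => ∀ a : M.str.Assignment, ∀ z, ∃ z', ∀ w : M.str.Assignment,
        w (none, 0) ∈ M.nhd χ z' → (a (none, 0) * w (none, 0) : M.K) ∈ M.nhd χ z)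
      ((((((mem 2 0 1).imp (((TermFun.coord 3 0).mul
        (TermFun.coord 2 0)).mem_nhd χ 0)).all 2).ex 1).all 0).all 3 |>.congr fun _ _ => Iff.rfl)
      hM fun a z => (h.mul_left _ z).imp fun _ h w hw => h _ hw
    exact fun a z => (this (M.ofField fun _ => a) z).imp fun z' h x hx =>
      h (M.ofField fun _ => x) hx
  · have := DefS.transfer (Q := fun M => ∀ z, ∃ z', ∀ w : M.str.Assignment,
        w (none, 0) ∈ M.nhd χ z' → ((1 + w (none, 0))⁻¹ - 1 : M.K) ∈ M.nhd χ z)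
      (((((mem 2 0 1).imp (((TermFun.one.add (TermFun.coord 2 0)).inv.sub
        TermFun.one).mem_nhd χ 0)).all 2).ex 1).all 0 |>.congr fun _ _ => Iff.rfl)
      hM fun z => (h.inv z).imp fun _ h w hw => h _ hw
    exact fun z => (this z).imp fun z' h x hx => h (M.ofField fun n => x) hx
  · have := DefS.transfer (Q := fun M => ∀ w : M.str.Assignment, (w (none, 0) : M.K) ≠ 0 →
        ∃ z, ¬ w (none, 0) ∈ M.nhd χ z)
      (((((TermFun.coord 1 0).eq TermFun.zero).not.imp ((mem 1 0 0).not.ex 0)).all 1).congr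
        fun _ _ => Iff.rfl)
      hM fun w hw => h.hausdorff _ hw
    exact fun x hx => this (M.ofField fun _ => x) hx
  · have := DefS.transfer (Q := fun M => ∀ z, ∃ w : M.str.Assignment, w (none, 0) ∈ M.nhd χ z ∧
        (w (none, 0) : M.K) ≠ 0)
      ((((mem 1 0 0).and ((TermFun.coord 1 0).eq TermFun.zero).not).ex 1).all 0 |>.congr
        fun _ _ => Iff.rfl)
      hM fun z => by
        obtain ⟨x, hx, hx0⟩ := h.nondiscrete z
        exact ⟨K₀.ofField fun _ => x, hx, hx0⟩
    exact fun z => let ⟨w, hw, hw0⟩ := this z; ⟨_, hw, hw0⟩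

/-- The ring filter basis of the sets `χ(M, z)`. -/
@[reducible] def NhdAxioms.ringFilterBasis {χ : Formula L.lang} {M : FieldStructure L}
    (h : NhdAxioms χ M) :
    RingFilterBasis M.K where
  sets := Set.range (M.nhd χ)
  nonempty := ⟨_, M.str.assignment_nonempty.some, rfl⟩
  inter_sets := by
    rintro _ _ ⟨z, rfl⟩ ⟨z', rfl⟩
    obtain ⟨z'', hz⟩ := h.inter z z'
    exact ⟨_, ⟨z'', rfl⟩, hz⟩
  zero' := by
    rintro _ ⟨z, rfl⟩
    exact h.zero z
  add' := by
    rintro _ ⟨z, rfl⟩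
    obtain ⟨z', hz⟩ := h.add z
    refine ⟨_, ⟨z', rfl⟩, ?_⟩
    rintro _ ⟨x, hx, y, hy, rfl⟩
    exact hz x hx y hy
  neg' := by
    rintro _ ⟨z, rfl⟩
    obtain ⟨z', hz⟩ := h.neg z
    exact ⟨_, ⟨z', rfl⟩, hz⟩
  conj' := by
    rintro x _ ⟨z, rfl⟩
    exact ⟨_, ⟨z, rfl⟩, fun y hy => by simpa using hy⟩
  mul' := by
    rintro _ ⟨z, rfl⟩
    obtain ⟨z', hz⟩ := h.mul z
    refine ⟨_, ⟨z', rfl⟩, ?_⟩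
    rintro _ ⟨x, hx, y, hy, rfl⟩
    exact hz x hx y hy
  mul_left' := by
    rintro a _ ⟨z, rfl⟩
    obtain ⟨z', hz⟩ := h.mul_left a z
    exact ⟨_, ⟨z', rfl⟩, hz⟩
  mul_right' := by
    rintro a _ ⟨z, rfl⟩
    obtain ⟨z', hz⟩ := h.mul_left a z
    exact ⟨_, ⟨z', rfl⟩, fun x hx => by simpa [mul_comm] using hz x hx⟩

/-- By `inter` the infimum defining the neighbourhood filter is directed, so it is the filter
generated by the translated basis. This makes the general theory of ring filter bases available in
every model. -/
theorem NhdAxioms.topology_eq {χ : Formula L.lang} {M : FieldStructure L} (h : NhdAxioms χ M) :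
    M.topology χ = h.ringFilterBasis.topology := by
  unfold FieldStructure.topology
  change _ = TopologicalSpace.mkOfNhds _
  congr 1
  funext a
  have hd : Directed (· ≥ ·) fun v : M.str.Assignment => 𝓟 {b | b - a ∈ M.nhd χ v} := by
    intro z z'
    obtain ⟨z'', hz⟩ := h.inter z z'
    exact ⟨z'', principal_mono.2 fun b hb => (hz hb).1, principal_mono.2 fun b hb => (hz hb).2⟩
  have := M.str.assignment_nonempty
  ext s
  rw [mem_iInf_of_directed hd]
  refine Iff.trans ?_ (mem_map.symm.trans Iff.rfl)
  rw [FilterBasis.mem_filter_iff]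
  constructor
  · rintro ⟨z, hz⟩
    refine ⟨_, ⟨z, rfl⟩, fun x hx => hz ?_⟩
    simpa using hx
  · rintro ⟨_, ⟨z, rfl⟩, hz⟩
    refine ⟨z, fun b hb => ?_⟩
    simpa using hz hb

theorem NhdAxioms.definesFieldTopology {χ : Formula L.lang} {M : FieldStructure L}
    (h : NhdAxioms χ M) : M.DefinesFieldTopology χ := by
  unfold FieldStructure.DefinesFieldTopology
  rw [h.topology_eq]
  let : TopologicalSpace M.K := h.ringFilterBasis.topology
  have : IsTopologicalRing M.K := h.ringFilterBasis.isTopologicalRing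
  have hb : (𝓝 (0 : M.K)).HasBasis (fun _ : M.str.Assignment => True) (M.nhd χ) := by
    refine ⟨fun s => ?_⟩
    rw [(AddGroupFilterBasis.nhds_zero_hasBasis _).mem_iff]
    constructor
    · rintro ⟨_, ⟨z, rfl⟩, hz⟩
      exact ⟨z, trivial, hz⟩
    · rintro ⟨z, -, hz⟩
      exact ⟨_, ⟨z, rfl⟩, hz⟩
  have hinv : ContinuousInv₀ M.K := by
    refine ContinuousInv₀.of_nhds_one ?_
    rw [← map_add_left_nhds_zero (1 : M.K), tendsto_map'_iff]
    have hb1 := hb.map fun x => 1 + x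
    refine (hb.tendsto_iff hb1).2 fun z _ => ?_
    obtain ⟨z', hz⟩ := h.inv z
    exact ⟨z', trivial, fun x hx => ⟨_, hz x hx, by simp⟩⟩
  refine ⟨{}, ?_, ?_, hb⟩
  · refine IsTopologicalAddGroup.t2Space_of_zero_sep fun x hx => ?_
    obtain ⟨z, hz⟩ := h.hausdorff x hx
    exact ⟨_, hb.mem_of_mem trivial, hz⟩
  · intro hd
    have : ({0} : Set M.K) ∈ 𝓝 (0 : M.K) := by simp [nhds_discrete]
    obtain ⟨z, -, hz⟩ := hb.mem_iff.1 this
    obtain ⟨x, hx, hx0⟩ := h.nondiscrete z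
    exact hx0 (hz hx)

end Topology

end TopFieldDer

namespace TopFieldDer

/-! ### Models of the theory: topology, characteristic, boxes, open forms -/

section Models

variable {L : FieldLanguage.{u}} {K₀ M : FieldStructure L} {χ : Formula L.lang}

theorem IsTopologicalFieldTheory.nhdAxioms (hT : IsTopologicalFieldTheory K₀ χ)
    (hM : M.IsModelOf K₀) : NhdAxioms χ M :=
  (nhdAxioms_of_definesFieldTopology hT.topology).transfer hM

theorem IsTopologicalFieldTheory.charZero_of_model (hT : IsTopologicalFieldTheory K₀ χ)
    (hM : M.IsModelOf K₀) : CharZero M.K := by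
  have := hT.charZero
  refine charZero_of_inj_zero fun n hn => ?_
  by_contra hn0
  exact DefS.transfer (Q := fun M => (n : M.K) ≠ 0)
    ((TermFun.natCast n).eq TermFun.zero).not hM (Nat.cast_ne_zero.2 hn0) hn

theorem NhdAxioms.exists_subset (h : NhdAxioms χ M) {s : Set M.K}
    (hs : s ∈ @nhds _ (M.topology χ) 0) : ∃ z, M.nhd χ z ⊆ s := by
  let := M.topology χ
  simpa using h.definesFieldTopology.2.2.2.mem_iff.1 hs

/-- Around a point of a set defined by `θ`, which is open, the set contains a box. -/
theorem NhdAxioms.exists_box (h : NhdAxioms χ M) {θ : Formula L.lang} (hθ : M.DefinesOpen χ θ)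
    {v : M.str.Assignment} (hv : θ.Sat M.str v) (I : Finset ℕ) :
    ∃ z, ∀ v' : M.str.Assignment, (∀ x, (∀ j ∈ I, x ≠ (none, j)) → v' x = v x) →
      (∀ j ∈ I, (v' (none, j) - v (none, j) : M.K) ∈ M.nhd χ z) → θ.Sat M.str v' := by
  classical
  let := M.topology χ
  obtain ⟨h1, -, -, -⟩ := h.definesFieldTopology
  have hw : ∀ v : M.str.Assignment, M.withField v (M.coord v) = v := by
    intro v; funext x; rcases x with ⟨_ | a, n⟩ <;> rfl
  obtain ⟨I', U, hU, hsub⟩ := isOpen_pi_iff.1 (hθ v) (M.coord v)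
    (show Formula.Sat M.str (M.withField v (M.coord v)) θ by rwa [hw])
  -- A basic open set of the product restricts finitely many coordinates, so one neighbourhood of
  -- `0` serves them all.
  have hnb : (⋂ j ∈ I', {b : M.K | M.coord v j + b ∈ U j}) ∈ 𝓝 (0 : M.K) := by
    refine (biInter_finset_mem _).2 fun j hj => ?_
    have hc : ContinuousAt (fun b : M.K => M.coord v j + b) 0 := by fun_prop
    exact hc.preimage_mem_nhds (by simpa using (hU j hj).1.mem_nhds (hU j hj).2)
  obtain ⟨z, hz⟩ := h.exists_subset hnb
  refine ⟨z, fun v' hv' hn => ?_⟩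
  have hvv : v' = M.withField v (M.coord v') := by
    funext x
    rcases x with ⟨_ | a, n⟩
    · rfl
    · exact hv' _ (by simp)
  rw [hvv]
  refine hsub fun j hj => ?_
  by_cases hjI : j ∈ I
  · have := Set.mem_iInter₂.1 (hz (hn j hjI)) j hj
    simpa [FieldStructure.coord] using this
  · have : M.coord v' j = M.coord v j := hv' (none, j) (by
      rintro i hi h; cases h; exact hjI hi)
    rw [this]
    exact (hU j hj).2

theorem IsOpenTheory.exists_form (hT : IsOpenTheory K₀ χ) (φ : Formula L.lang) :
    ∃ D : List (List (MvPolynomial ℕ (MvPolynomial L.Const ℤ)) × Formula L.lang),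
      ∀ M : FieldStructure L, M.IsModelOf K₀ →
        (∀ c ∈ D, M.DefinesOpen χ c.2) ∧
        ∀ v : M.str.Assignment, φ.Sat M.str v ↔
          ∃ c ∈ D, (∀ P ∈ c.1, M.ev (M.coord v) P = 0) ∧ c.2.Sat M.str v := by
  obtain ⟨ψ, hψ, h⟩ := hT.elim φ
  obtain ⟨D, -, hD⟩ := hT.open_form ψ hψ
  refine ⟨D, fun M hM => ⟨(hD M hM).1, fun v => ?_⟩⟩
  rw [h M hM, (hD M hM).2]
  simp only [FieldStructure.eval_poly]
  rfl

end Models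

end TopFieldDer

namespace TopFieldDer

/-! Reduction of polynomials in the jets of one variable. -/

/-- Pseudo-division. -/
theorem exists_pseudo_division {R : Type*} [CommRing R] (q : Polynomial R) {d : ℕ}
    (hq : q.natDegree ≤ d) (p : Polynomial R) : ∃ (N : ℕ) (c r : Polynomial R),
      Polynomial.C (q.coeff d ^ N) * p = q * c + r ∧ r.degree < d := by
  suffices ∀ (n : ℕ) (p : Polynomial R), p.degree < n → ∃ (N : ℕ) (c r : Polynomial R),
      Polynomial.C (q.coeff d ^ N) * p = q * c + r ∧ r.degree < d from
    this (p.natDegree + 1) p (Polynomial.degree_lt_iff_coeff_zero _ _ |>.2 fun k hk =>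
      Polynomial.coeff_eq_zero_of_natDegree_lt (by omega))
  intro n
  induction n with
  | zero =>
    intro p hp
    exact ⟨0, 0, p, by simp, hp.trans_le (by exact_mod_cast Nat.zero_le d)⟩
  | succ e ih =>
    intro p hp
    by_cases hed : e + 1 ≤ d
    · exact ⟨0, 0, p, by simp, hp.trans_le (by exact_mod_cast hed)⟩
    have hde : d ≤ e := by omega
    rw [Polynomial.degree_lt_iff_coeff_zero] at hp
    -- The coefficient of degree `e` is cancelled. As `d` is only an upper bound for the degree of
    -- `q`, its coefficient there may be zero; nothing is divided by it.
    obtain ⟨N, c, r, h, hr⟩ := ih (Polynomial.C (q.coeff d) * p -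
        q * (Polynomial.C (p.coeff e) * Polynomial.X ^ (e - d))) (by
      rw [Polynomial.degree_lt_iff_coeff_zero]
      intro k hk
      rw [Polynomial.coeff_sub, Polynomial.coeff_C_mul, ← mul_assoc,
        mul_comm q, mul_assoc, Polynomial.coeff_C_mul]
      obtain ⟨i, rfl⟩ := Nat.exists_eq_add_of_le hk
      rw [show e + i = (d + i) + (e - d) by omega, Polynomial.coeff_mul_X_pow]
      rcases Nat.eq_zero_or_pos i with rfl | hi
      · rw [show d + 0 + (e - d) = e by omega, add_zero]; ring
      · rw [hp _ (by omega), Polynomial.coeff_eq_zero_of_natDegree_lt (by omega : _ < d + i)]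
        ring)
    refine ⟨N + 1, c + Polynomial.C (q.coeff d ^ N) * (Polynomial.C (p.coeff e) *
      Polynomial.X ^ (e - d)), r, ?_, hr⟩
    rw [pow_succ, Polynomial.C_mul]
    linear_combination h

/-! ### Jet polynomials, total derivative and critical polynomials -/

section Jets

variable {L : FieldLanguage.{u}}

/-- Indices of variables other than the jets of `xₙ` of order at least `l`. -/
def jetVars (n l : ℕ) : Set ℕ := {j | ∀ k, l ≤ k → j ≠ Nat.pair n k}

/-- Polynomials over `ℤ[Ω]`; the variable `Nat.pair n k` stands for the `k`-th derivative of
the `n`-th variable. -/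
abbrev JetPoly (L : FieldLanguage.{u}) := MvPolynomial ℕ (MvPolynomial L.Const ℤ)

/-- The polynomials of order less than `l` in the `n`-th variable. -/
noncomputable abbrev JetPoly.lt (L : FieldLanguage.{u}) (n l : ℕ) :
    Subalgebra (MvPolynomial L.Const ℤ) (JetPoly L) :=
  MvPolynomial.supported _ (jetVars n l)

/-- The ring of polynomials of order less than `l` in the `n`-th variable. -/
def LowJet (L : FieldLanguage.{u}) (n l : ℕ) : Type u := JetPoly.lt L n l

noncomputable instance (n l : ℕ) : CommRing (LowJet L n l) :=
  inferInstanceAs (CommRing (JetPoly.lt L n l))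

instance (n l : ℕ) : IsDomain (LowJet L n l) :=
  inferInstanceAs (IsDomain (JetPoly.lt L n l))

variable {n l : ℕ}

/-- The inclusion of the polynomials of order less than `l`. -/
noncomputable def LowJet.incl : LowJet L n l →+* JetPoly L := (JetPoly.lt L n l).val.toRingHom

theorem LowJet.incl_mem (c : LowJet L n l) : c.incl ∈ JetPoly.lt L n l := Subtype.prop c

theorem LowJet.exists_incl_eq {P : JetPoly L} (hP : P ∈ JetPoly.lt L n l) :
    ∃ c : LowJet L n l, c.incl = P := ⟨⟨P, hP⟩, rfl⟩

instance (n l : ℕ) : CharZero (LowJet L n l) := by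
  refine charZero_of_inj_zero fun k hk => ?_
  have := congrArg LowJet.incl hk
  simpa using this

theorem JetPoly.lt_mono {l l' : ℕ} (h : l ≤ l') : JetPoly.lt L n l ≤ JetPoly.lt L n l' :=
  MvPolynomial.supported_mono fun _ hj k hk => hj k (h.trans hk)

theorem JetPoly.lt_induction {p : JetPoly L → Prop} (hC : ∀ c, p (MvPolynomial.C c))
    (hX : ∀ j ∈ jetVars n l, p (MvPolynomial.X j)) (hadd : ∀ P Q, p P → p Q → p (P + Q))
    (hmul : ∀ P Q, p P → p Q → p (P * Q)) {P : JetPoly L} (hP : P ∈ JetPoly.lt L n l) : p P := by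
  refine Algebra.adjoin_induction ?_ hC (fun P Q _ _ => hadd P Q) (fun P Q _ _ => hmul P Q) hP
  rintro _ ⟨j, hj, rfl⟩
  exact hX j hj

theorem JetPoly.X_mem_lt {j : ℕ} (hj : j ∈ jetVars n l) :
    (MvPolynomial.X j : JetPoly L) ∈ JetPoly.lt L n l :=
  Algebra.subset_adjoin ⟨j, hj, rfl⟩

theorem jetVars_succ {j : ℕ} (hj : j ∈ jetVars n (l + 1)) : j = Nat.pair n l ∨ j ∈ jetVars n l := by
  by_contra! h
  obtain ⟨k, hk, rfl⟩ : ∃ k, l ≤ k ∧ j = Nat.pair n k := by simpa [jetVars] using h.2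
  rcases hk.eq_or_lt with rfl | hk
  · exact h.1 rfl
  · exact hj k hk rfl

theorem pair_mem_jetVars {k : ℕ} (h : k < l) : Nat.pair n k ∈ jetVars n l := by
  intro k' hk' he
  rw [Nat.pair_eq_pair] at he
  omega

theorem JetPoly.exists_mem_lt (n : ℕ) (P : JetPoly L) : ∃ l, P ∈ JetPoly.lt L n l := by
  obtain ⟨l, hl⟩ : ∃ l, ∀ j ∈ P.vars, j < l :=
    ⟨P.vars.sup id + 1, fun j hj => Nat.lt_succ_of_le (Finset.le_sup (f := id) hj)⟩
  refine ⟨l, MvPolynomial.mem_supported.2 fun j hj k hk he => ?_⟩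
  have := hl j hj
  have := Nat.right_le_pair n k
  omega

/-- A polynomial in the `l`-th derivative of `xₙ`, over the polynomials of lower order, as a
polynomial. -/
noncomputable def toJet : Polynomial (LowJet L n l) →+* JetPoly L :=
  Polynomial.eval₂RingHom LowJet.incl (MvPolynomial.X (Nat.pair n l))

@[simp] theorem toJet_C (c : LowJet L n l) : toJet (Polynomial.C c) = c.incl := by
  simp [toJet]

@[simp] theorem toJet_X : toJet (Polynomial.X : Polynomial (LowJet L n l)) =
    MvPolynomial.X (Nat.pair n l) := by
  simp [toJet]

theorem toJet_mem (q : Polynomial (LowJet L n l)) : toJet q ∈ JetPoly.lt L n (l + 1) := by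
  induction q using Polynomial.induction_on' with
  | add p q hp hq => rw [map_add]; exact add_mem hp hq
  | monomial i c =>
    rw [← Polynomial.C_mul_X_pow_eq_monomial, map_mul, toJet_C, map_pow, toJet_X]
    exact mul_mem (JetPoly.lt_mono (Nat.le_succ l) c.incl_mem)
      (pow_mem (JetPoly.X_mem_lt (pair_mem_jetVars (Nat.lt_succ_self l))) i)

theorem exists_toJet_eq {P : JetPoly L} (hP : P ∈ JetPoly.lt L n (l + 1)) :
    ∃ q : Polynomial (LowJet L n l), toJet q = P := by
  refine JetPoly.lt_induction (p := fun P => ∃ q : Polynomial (LowJet L n l), toJet q = P)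
    (fun c => ?_) (fun j hj => ?_) ?_ ?_ hP
  · obtain ⟨c', hc⟩ := LowJet.exists_incl_eq (n := n) (l := l) (Subalgebra.algebraMap_mem _ c)
    exact ⟨Polynomial.C c', by rw [toJet_C, hc]; rfl⟩
  · rcases jetVars_succ hj with rfl | hj
    · exact ⟨Polynomial.X, toJet_X⟩
    · obtain ⟨c', hc⟩ := LowJet.exists_incl_eq (JetPoly.X_mem_lt (L := L) hj)
      exact ⟨Polynomial.C c', by rw [toJet_C, hc]⟩
  · rintro _ _ ⟨p, rfl⟩ ⟨q, rfl⟩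
    exact ⟨p + q, map_add toJet p q⟩
  · rintro _ _ ⟨p, rfl⟩ ⟨q, rfl⟩
    exact ⟨p * q, map_mul toJet p q⟩

theorem ev_congr {M : FieldStructure L} {Y Y' : ℕ → M.K} (h : ∀ j ∈ jetVars n l, Y j = Y' j)
    {P : JetPoly L} (hP : P ∈ JetPoly.lt L n l) : M.ev Y P = M.ev Y' P := by
  refine JetPoly.lt_induction (p := fun P => M.ev Y P = M.ev Y' P) (by simp)
    (fun j hj => by simpa using h j hj) ?_ ?_ hP
  · intro P Q hP hQ; rw [map_add, map_add, hP, hQ]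
  · intro P Q hP hQ; rw [map_mul, map_mul, hP, hQ]

/-- `q` vanishes at `Y`, and its leading coefficient does not. -/
def Crit (M : FieldStructure L) (Y : ℕ → M.K) (c : Σ l, Polynomial (LowJet L n l)) : Prop :=
  M.ev Y c.2.leadingCoeff.incl ≠ 0 ∧ M.ev Y (toJet c.2) = 0

/-- `Y'` differs from `Y` only in the jets of the `n`-th variable. -/
def AgreeOff (n : ℕ) {K : Type*} (Y Y' : ℕ → K) : Prop :=
  ∀ j, (Nat.unpair j).1 ≠ n → Y' j = Y j

/-- The conclusion of the vanishing lemmas. -/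
theorem exists_crit_of_lt_of_coeff {l : ℕ}
    (ih : ∀ P ∈ JetPoly.lt L n l, ∃ 𝒬 : List (Σ l, Polynomial (LowJet L n l)),
      (∀ c ∈ 𝒬, 1 ≤ c.2.natDegree ∧ c.1 < l) ∧
      ∀ (M : FieldStructure L) (Y : ℕ → M.K), M.ev Y P = 0 →
        (∃ c ∈ 𝒬, Crit M Y c) ∨ ∀ Y', AgreeOff n Y Y' → M.ev Y' P = 0)
    (q : Polynomial (LowJet L n l)) :
    ∃ 𝒬 : List (Σ l, Polynomial (LowJet L n l)),
      (∀ c ∈ 𝒬, 1 ≤ c.2.natDegree ∧ (c.1 < l ∨ c.1 = l ∧ c.2.natDegree ≤ q.natDegree)) ∧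
      ∀ (M : FieldStructure L) (Y : ℕ → M.K), M.ev Y (toJet q) = 0 →
        (∃ c ∈ 𝒬, Crit M Y c) ∨ ∀ Y', AgreeOff n Y Y' → M.ev Y' (toJet q) = 0 := by
  -- Induction on the number of terms. If the leading coefficient vanishes at `Y`, so does `q`
  -- without its leading term, and both parts vanish identically in the jets unless a critical
  -- polynomial is met.
  induction hk : q.support.card using Nat.strong_induction_on generalizing q with
  | _ k IH =>
  by_cases hq : q = 0
  · exact ⟨[], by simp, fun M Y _ => .inr fun Y' _ => by simp [hq]⟩
  obtain ⟨𝒬₁, h₁, h₁'⟩ := ih _ q.leadingCoeff.incl_mem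
  obtain ⟨𝒬₂, h₂, h₂'⟩ := IH _ (hk ▸ Polynomial.eraseLead_support_card_lt hq) q.eraseLead rfl
  have hsplit : toJet q = toJet q.eraseLead +
      q.leadingCoeff.incl * MvPolynomial.X (Nat.pair n l) ^ q.natDegree := by
    have := congrArg toJet q.eraseLead_add_C_mul_X_pow
    rw [map_add, map_mul, map_pow, toJet_C, toJet_X] at this
    exact this.symm
  have hel : q.eraseLead.natDegree ≤ q.natDegree :=
    q.eraseLead_natDegree_le.trans (Nat.sub_le _ _)
  have fin : ∀ (M : FieldStructure L) (Y : ℕ → M.K), M.ev Y (toJet q) = 0 →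
      M.ev Y q.leadingCoeff.incl = 0 → (∃ c ∈ 𝒬₁ ++ 𝒬₂, Crit M Y c) ∨
        ∀ Y', AgreeOff n Y Y' → M.ev Y' (toJet q) = 0 := by
    intro M Y hY h0
    have he : M.ev Y (toJet q.eraseLead) = 0 := by
      have := hY
      rw [hsplit, map_add, map_mul, h0, zero_mul, add_zero] at this
      exact this
    rcases h₁' M Y h0 with ⟨c, hc, h⟩ | ha
    · exact .inl ⟨c, by simp [hc], h⟩
    rcases h₂' M Y he with ⟨c, hc, h⟩ | hb
    · exact .inl ⟨c, by simp [hc], h⟩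
    refine .inr fun Y' hY' => ?_
    rw [hsplit, map_add, map_mul, ha Y' hY', hb Y' hY', zero_mul, add_zero]
  -- Only a `q` of positive degree may join the list. A constant `q` is its own leading coefficient,
  -- which therefore vanishes at `Y`.
  rcases Nat.eq_zero_or_pos q.natDegree with hd | hd
  · refine ⟨𝒬₁ ++ 𝒬₂, ?_, fun M Y hY => fin M Y hY ?_⟩
    · intro c hc
      rcases List.mem_append.1 hc with hc | hc
      · exact ⟨(h₁ c hc).1, .inl (h₁ c hc).2⟩
      · exact ⟨(h₂ c hc).1, (h₂ c hc).2.imp id (And.imp id fun h => h.trans hel)⟩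
    · rw [Polynomial.eq_C_of_natDegree_eq_zero hd] at hY ⊢
      simpa using hY
  · refine ⟨⟨l, q⟩ :: (𝒬₁ ++ 𝒬₂), ?_, fun M Y hY => ?_⟩
    · intro c hc
      rcases List.mem_cons.1 hc with rfl | hc
      · exact ⟨hd, .inr ⟨rfl, le_rfl⟩⟩
      rcases List.mem_append.1 hc with hc | hc
      · exact ⟨(h₁ c hc).1, .inl (h₁ c hc).2⟩
      · exact ⟨(h₂ c hc).1, (h₂ c hc).2.imp id (And.imp id fun h => h.trans hel)⟩
    · by_cases h0 : M.ev Y q.leadingCoeff.incl = 0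
      · refine (fin M Y hY h0).imp ?_ id
        rintro ⟨c, hc, h⟩
        exact ⟨c, List.mem_cons_of_mem _ hc, h⟩
      · exact .inl ⟨_, List.mem_cons_self, h0, hY⟩

/-- If a polynomial `P` of order less than `l` vanishes at `Y`, then either it vanishes
identically in the jets of `xₙ`, or one of finitely many polynomials in the jets of `xₙ` of lower
order vanishes at `Y` without its leading coefficient vanishing. -/
theorem exists_crit_of_lt (l : ℕ) : ∀ P ∈ JetPoly.lt L n l,
    ∃ 𝒬 : List (Σ l, Polynomial (LowJet L n l)),
      (∀ c ∈ 𝒬, 1 ≤ c.2.natDegree ∧ c.1 < l) ∧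
      ∀ (M : FieldStructure L) (Y : ℕ → M.K), M.ev Y P = 0 →
        (∃ c ∈ 𝒬, Crit M Y c) ∨ ∀ Y', AgreeOff n Y Y' → M.ev Y' P = 0 := by
  induction l with
  | zero =>
    refine fun P hP => ⟨[], by simp, fun M Y hY => .inr fun Y' hY' => ?_⟩
    rw [← hY]
    refine ev_congr (fun j hj => hY' j fun h => ?_) hP
    exact hj (Nat.unpair j).2 (Nat.zero_le _) (by rw [← h, Nat.pair_unpair])
  | succ l ih =>
    intro P hP
    obtain ⟨q, rfl⟩ := exists_toJet_eq hP
    obtain ⟨𝒬, h, h'⟩ := exists_crit_of_lt_of_coeff ih q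
    exact ⟨𝒬, fun c hc => ⟨(h c hc).1, by have := (h c hc).2; omega⟩, h'⟩

/-- The total derivative. -/
noncomputable def jetDeriv (L : FieldLanguage.{u}) :
    Derivation (MvPolynomial L.Const ℤ) (JetPoly L) (JetPoly L) :=
  MvPolynomial.mkDerivation _ fun j =>
    MvPolynomial.X (Nat.pair (Nat.unpair j).1 ((Nat.unpair j).2 + 1))

theorem jetDeriv_X (n k : ℕ) : jetDeriv L (MvPolynomial.X (Nat.pair n k)) =
    MvPolynomial.X (Nat.pair n (k + 1)) := by
  simp [jetDeriv, MvPolynomial.mkDerivation_X]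

theorem jetDeriv_mem {P : JetPoly L} (hP : P ∈ JetPoly.lt L n l) :
    jetDeriv L P ∈ JetPoly.lt L n (l + 1) := by
  refine (JetPoly.lt_induction (n := n) (l := l) (p := fun P => P ∈ JetPoly.lt L n (l + 1) ∧
    jetDeriv L P ∈ JetPoly.lt L n (l + 1)) (fun c => ⟨?_, ?_⟩) (fun j hj => ⟨?_, ?_⟩) ?_ ?_ hP).2
  · exact Subalgebra.algebraMap_mem _ c
  · rw [MvPolynomial.derivation_C]; exact zero_mem _
  · exact JetPoly.X_mem_lt fun k hk => hj k (by omega)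
  · rw [jetDeriv, MvPolynomial.mkDerivation_X]
    refine JetPoly.X_mem_lt fun k hk he => ?_
    rw [Nat.pair_eq_pair] at he
    refine hj (Nat.unpair j).2 (by omega) ?_
    rw [← he.1, Nat.pair_unpair]
  · rintro P Q ⟨h1, h2⟩ ⟨h3, h4⟩
    exact ⟨add_mem h1 h3, by rw [map_add]; exact add_mem h2 h4⟩
  · rintro P Q ⟨h1, h2⟩ ⟨h3, h4⟩
    refine ⟨mul_mem h1 h3, ?_⟩
    rw [Derivation.leibniz]
    exact add_mem (mul_mem h1 h4) (mul_mem h3 h2)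

/-- Only the differentiation of the `l`-th jet itself produces a jet of order `l + 1`; by the chain
rule its coefficient is the separant. -/
theorem jetDeriv_toJet (q : Polynomial (LowJet L n l)) : ∃ T ∈ JetPoly.lt L n (l + 1),
    jetDeriv L (toJet q) =
      toJet (Polynomial.derivative q) * MvPolynomial.X (Nat.pair n (l + 1)) + T := by
  induction q using Polynomial.induction_on' with
  | add p q hp hq =>
    obtain ⟨T, hT, h⟩ := hp
    obtain ⟨T', hT', h'⟩ := hq
    refine ⟨T + T', add_mem hT hT', ?_⟩
    simp only [map_add, map_add, h, h']
    ring
  | monomial i c =>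
    refine ⟨jetDeriv L c.incl * MvPolynomial.X (Nat.pair n l) ^ i,
      mul_mem (jetDeriv_mem c.incl_mem)
        (pow_mem (JetPoly.X_mem_lt (pair_mem_jetVars (Nat.lt_succ_self l))) i), ?_⟩
    rw [← Polynomial.C_mul_X_pow_eq_monomial]
    simp only [map_mul, toJet_C, map_pow, toJet_X, Derivation.leibniz, Derivation.leibniz_pow,
      jetDeriv_X, smul_eq_mul, nsmul_eq_mul, Polynomial.derivative_C_mul,
      Polynomial.derivative_X_pow]
    rw [map_natCast]
    ring

/-- Further derivatives of the separant stay below the top order, so the coefficient of the top jet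
remains the separant. Hence at a regular zero the higher jets are determined one after the other by
those of order at most `l`. -/
theorem iterate_jetDeriv_toJet (q : Polynomial (LowJet L n l)) (k : ℕ) :
    ∃ T ∈ JetPoly.lt L n (l + k + 1), (jetDeriv L)^[k + 1] (toJet q) =
      toJet (Polynomial.derivative q) * MvPolynomial.X (Nat.pair n (l + k + 1)) + T := by
  induction k with
  | zero => simpa using jetDeriv_toJet q
  | succ k ih =>
    obtain ⟨T, hT, h⟩ := ih
    refine ⟨jetDeriv L (toJet (Polynomial.derivative q)) *
      MvPolynomial.X (Nat.pair n (l + k + 1)) + jetDeriv L T, ?_, ?_⟩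
    · refine add_mem (mul_mem ?_ ?_) (jetDeriv_mem hT)
      · exact JetPoly.lt_mono (by omega) (jetDeriv_mem (toJet_mem _))
      · exact JetPoly.X_mem_lt (pair_mem_jetVars (by omega))
    · rw [Function.iterate_succ_apply', h, map_add, Derivation.leibniz, jetDeriv_X]
      simp only [smul_eq_mul]
      rw [show l + (k + 1) + 1 = l + k + 1 + 1 by ring]
      ring

/-- `Y` is a regular zero of `q` and a zero of its first `K` total derivatives. -/
def RegularZero (M : FieldStructure L) (Y : ℕ → M.K) (q : Polynomial (LowJet L n l))
    (K : ℕ) : Prop :=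
  (∀ k ∈ Finset.range (K + 1), M.ev Y ((jetDeriv L)^[k] (toJet q)) = 0) ∧
    M.ev Y q.leadingCoeff.incl ≠ 0 ∧ M.ev Y (toJet (Polynomial.derivative q)) ≠ 0

theorem RegularZero.mono {M : FieldStructure L} {Y : ℕ → M.K}
    {q : Polynomial (LowJet L n l)} {K K' : ℕ} (h : RegularZero M Y q K') (hK : K ≤ K') :
    RegularZero M Y q K :=
  ⟨fun k hk => h.1 k (by simp at hk ⊢; omega), h.2⟩

/-- At a regular zero the jets of order `l + 1, …, l + K` are eliminated by linear equations whose
coefficient is the separant, and the jet of order `l` is reduced modulo `q`. These are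
pseudo-divisions by polynomials with nonvanishing top coefficient, so `P` vanishes exactly where a
remainder of smaller degree than `q` does. The remainder vanishes at `Y` only if a smaller critical
polynomial occurs or it vanishes identically in the jets; in the latter case it vanishes at `Y'`
too. -/
theorem exists_crit_of_regularZero (q : Polynomial (LowJet L n l)) (hq : 1 ≤ q.natDegree)
    (K : ℕ) : ∀ P ∈ JetPoly.lt L n (l + K + 1),
    ∃ 𝒬 : List (Σ l, Polynomial (LowJet L n l)),
      (∀ c ∈ 𝒬, 1 ≤ c.2.natDegree ∧ (c.1 < l ∨ c.1 = l ∧ c.2.natDegree < q.natDegree)) ∧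
      ∀ (M : FieldStructure L) (Y Y' : ℕ → M.K), AgreeOff n Y Y' → RegularZero M Y q K →
        RegularZero M Y' q K → M.ev Y P = 0 → (∃ c ∈ 𝒬, Crit M Y c) ∨ M.ev Y' P = 0 := by
  induction K with
  | zero =>
    intro P hP
    obtain ⟨p, rfl⟩ := exists_toJet_eq hP
    obtain ⟨N, c, r, h, hr⟩ := exists_pseudo_division q le_rfl p
    obtain ⟨𝒬, h1, h2⟩ := exists_crit_of_lt_of_coeff (exists_crit_of_lt l) r
    have hrd : r.natDegree < q.natDegree := by
      by_cases hr0 : r = 0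
      · simp [hr0]; omega
      · exact (Polynomial.natDegree_lt_iff_degree_lt hr0).2 hr
    have key : ∀ (M : FieldStructure L) (Y : ℕ → M.K), RegularZero M Y q 0 →
        (M.ev Y (toJet p) = 0 ↔ M.ev Y (toJet r) = 0) := by
      intro M Y hY
      have h3 := congrArg (fun p => M.ev Y (toJet p)) h
      have h4 : M.ev Y (toJet q) = 0 := hY.1 0 (by simp)
      simp only [map_mul, map_add, map_mul, map_add, toJet_C, h4, zero_mul, zero_add,
        map_pow] at h3
      rw [← h3]
      simp [hY.2.1]
    refine ⟨𝒬, fun c hc => ⟨(h1 c hc).1, by have := (h1 c hc).2; omega⟩, ?_⟩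
    intro M Y Y' hYY' hY hY' hP
    exact (h2 M Y ((key M Y hY).1 hP)).imp id fun h => (key M Y' hY').2 (h Y' hYY')
  | succ K ih =>
    intro P hP
    obtain ⟨T, hT, h⟩ := iterate_jetDeriv_toJet q K
    have hS : toJet (Polynomial.derivative q) ∈ JetPoly.lt L n (l + K + 1) :=
      JetPoly.lt_mono (by omega) (toJet_mem _)
    obtain ⟨S', hS'⟩ := LowJet.exists_incl_eq hS
    obtain ⟨T', hT'⟩ := LowJet.exists_incl_eq hT
    obtain ⟨p, rfl⟩ := exists_toJet_eq (l := l + K + 1) hP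
    -- The derivative of `q` of order `K + 1`, written as a linear polynomial in the jet of order `l
    -- + K + 1`. Dividing by it leaves a remainder without this jet.
    set e : Polynomial (LowJet L n (l + K + 1)) :=
      Polynomial.C S' * Polynomial.X + Polynomial.C T' with he
    have hed : e.natDegree ≤ 1 := Polynomial.natDegree_linear_le
    have he1 : e.coeff 1 = S' := by simp [he, Polynomial.coeff_C]
    have heJ : toJet e = (jetDeriv L)^[K + 1] (toJet q) := by rw [h, he]; simp [hS', hT']
    obtain ⟨N, c, r, h1, hr⟩ := exists_pseudo_division e hed p
    have hr0 : r = Polynomial.C (r.coeff 0) := Polynomial.eq_C_of_degree_le_zero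
      (by exact Order.le_of_lt_succ hr)
    obtain ⟨𝒬, h2, h3⟩ := ih _ (r.coeff 0).incl_mem
    have key : ∀ (M : FieldStructure L) (Y : ℕ → M.K), RegularZero M Y q (K + 1) →
        (M.ev Y (toJet p) = 0 ↔ M.ev Y (r.coeff 0).incl = 0) := by
      intro M Y hY
      have h3 := congrArg (fun p => M.ev Y (toJet p)) h1
      have h4 : M.ev Y (toJet e) = 0 := by rw [heJ]; exact hY.1 (K + 1) (by simp)
      rw [hr0] at h3
      simp only [map_mul, map_add, map_mul, map_add, toJet_C, h4, zero_mul, zero_add,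
        map_pow, he1, hS'] at h3
      rw [← h3]
      simp [hY.2.2]
    refine ⟨𝒬, h2, ?_⟩
    intro M Y Y' hYY' hY hY' hP
    exact (h3 M Y Y' hYY' (hY.mono (Nat.le_succ K)) (hY'.mono (Nat.le_succ K))
      ((key M Y hY).1 hP)).imp id (key M Y' hY').2

end Jets

end TopFieldDer

namespace TopFieldDer

/-! Regular zeros of differential polynomials in models with a generic derivation. -/

section Generic

variable {L : FieldLanguage.{u}}

/-- `(M, δ)` is a model of `T_δ^*`. -/
structure IsGenericDerivation (K₀ : FieldStructure L) (χ : Formula L.lang) (M : FieldStructure L)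
    (δ : Derivation ℤ M.K M.K) : Prop where
  model : M.IsModelOf K₀
  const : ∀ c : L.Const, δ (M.const c) = 0
  scheme : SchemeDL M χ δ

/-- Replace the jets of the `n`-th variable by `u`. -/
def setJet {K : Type*} (n : ℕ) (u y : ℕ → K) : ℕ → K :=
  fun j => if (Nat.unpair j).1 = n then u (Nat.unpair j).2 else y j

@[simp] theorem setJet_pair {K : Type*} (n : ℕ) (u y : ℕ → K) (k : ℕ) :
    setJet n u y (Nat.pair n k) = u k := by simp [setJet]

theorem setJet_of_ne {K : Type*} {n : ℕ} (u y : ℕ → K) {j : ℕ} (h : (Nat.unpair j).1 ≠ n) :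
    setJet n u y j = y j := by simp [setJet, h]

variable {M : FieldStructure L} {δ : Derivation ℤ M.K M.K} {n l : ℕ}

/-- The values `y` of the jets are compatible with the derivation. -/
def IsJet (δ : Derivation ℤ M.K M.K) (y : ℕ → M.K) : Prop :=
  ∀ n k, δ (y (Nat.pair n k)) = y (Nat.pair n (k + 1))

theorem IsJet.setJet {y : ℕ → M.K} (hy : IsJet δ y) (n : ℕ) (a : M.K) :
    IsJet δ (setJet n (fun k => δ^[k] a) y) := by
  intro n' k
  by_cases h : n' = n
  · subst h
    simp only [setJet_pair, Function.iterate_succ_apply']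
  · rw [setJet_of_ne _ _ (by simpa using h), setJet_of_ne _ _ (by simpa using h), hy]

/-- Both sides obey the Leibniz rule and agree on the coefficients, which `δ` kills, and on the jet
variables. -/
theorem IsJet.deriv_ev (hδ : ∀ c : L.Const, δ (M.const c) = 0) {y : ℕ → M.K} (hy : IsJet δ y)
    (P : JetPoly L) : δ (M.ev y P) = M.ev y (jetDeriv L P) := by
  have hc : ∀ c : MvPolynomial L.Const ℤ, δ (MvPolynomial.aeval M.const c) = 0 := by
    intro c
    induction c using MvPolynomial.induction_on with
    | C z => simp
    | add p q hp hq => rw [map_add, map_add, hp, hq, add_zero]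
    | mul_X p i hp => rw [map_mul, Derivation.leibniz, hp, MvPolynomial.aeval_X, hδ]; simp
  induction P using MvPolynomial.induction_on with
  | C c => rw [FieldStructure.ev_C, hc, MvPolynomial.derivation_C, map_zero]
  | add p q hp hq => simp only [map_add, hp, hq]
  | mul_X p j hp =>
    obtain ⟨m, k, rfl⟩ : ∃ m k, j = Nat.pair m k := ⟨_, _, (Nat.pair_unpair j).symm⟩
    have := hy m k
    simp only [map_mul, Derivation.leibniz, hp, FieldStructure.ev_X, this, smul_eq_mul, map_add,
      jetDeriv_X]

theorem IsJet.ev_iterate (hδ : ∀ c : L.Const, δ (M.const c) = 0) {y : ℕ → M.K} (hy : IsJet δ y)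
    {P : JetPoly L} (hP : M.ev y P = 0) (k : ℕ) : M.ev y ((jetDeriv L)^[k] P) = 0 := by
  induction k with
  | zero => exact hP
  | succ k ih => rw [Function.iterate_succ_apply', ← hy.deriv_ev hδ, ih, map_zero]

/-- Substitution of polynomials over the field. -/
noncomputable def substPoly (M : FieldStructure L) {σ : Type*} (g : ℕ → MvPolynomial σ M.K) :
    JetPoly L →+* MvPolynomial σ M.K :=
  MvPolynomial.eval₂Hom (MvPolynomial.C.comp (MvPolynomial.aeval M.const).toRingHom) g

theorem substPoly_C {σ : Type*} (g : ℕ → MvPolynomial σ M.K) (c : MvPolynomial L.Const ℤ) :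
    substPoly M g (MvPolynomial.C c) = MvPolynomial.C (MvPolynomial.aeval M.const c) := by
  simp only [substPoly, MvPolynomial.coe_eval₂Hom, MvPolynomial.eval₂_C]; rfl

theorem eval_substPoly {σ : Type*} (g : ℕ → MvPolynomial σ M.K) (t : σ → M.K) (P : JetPoly L) :
    MvPolynomial.eval t (substPoly M g P) = M.ev (fun j => MvPolynomial.eval t (g j)) P := by
  induction P using MvPolynomial.induction_on with
  | C c => rw [substPoly_C, MvPolynomial.eval_C, FieldStructure.ev_C]
  | add p q hp hq => simp only [map_add, hp, hq]
  | mul_X p j hp => rw [map_mul, map_mul, map_mul, hp]; simp [substPoly]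

/-- The chain rule. It turns the partial derivative occurring in (DL) into the separant of `q`. -/
theorem pderiv_substPoly {σ : Type*} (s : σ) (g : ℕ → MvPolynomial σ M.K)
    (hg : ∀ j ∈ jetVars n l, MvPolynomial.pderiv s (g j) = 0)
    (hg' : MvPolynomial.pderiv s (g (Nat.pair n l)) = 1) (q : Polynomial (LowJet L n l)) :
    MvPolynomial.pderiv s (substPoly M g (toJet q)) =
      substPoly M g (toJet (Polynomial.derivative q)) := by
  have hX : ∀ j, substPoly M g (MvPolynomial.X j) = g j := fun j => by simp [substPoly]
  have hlow : ∀ P ∈ JetPoly.lt L n l, MvPolynomial.pderiv s (substPoly M g P) = 0 := by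
    intro P hP
    refine JetPoly.lt_induction (p := fun P => MvPolynomial.pderiv s (substPoly M g P) = 0)
      (fun c => ?_) (fun j hj => ?_) (fun P Q hP hQ => ?_) (fun P Q hP hQ => ?_) hP
    · rw [substPoly_C, MvPolynomial.pderiv_C]
    · rw [hX, hg j hj]
    · simp only [map_add, hP, hQ, add_zero]
    · simp only [map_mul, Derivation.leibniz, hP, hQ, smul_zero, add_zero]
  induction q using Polynomial.induction_on' with
  | add p q hp hq => simp only [map_add, hp, hq]
  | monomial i c =>
    rw [← Polynomial.C_mul_X_pow_eq_monomial]
    simp only [map_mul, toJet_C, map_pow, toJet_X, Derivation.leibniz, Derivation.leibniz_pow,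
      smul_eq_mul, nsmul_eq_mul, Polynomial.derivative_C_mul, hX, hg',
      Polynomial.derivative_X_pow, hlow _ c.incl_mem, map_natCast]
    ring

variable {K₀ : FieldStructure L} {χ : Formula L.lang}

/-- A finite set is closed in a Hausdorff topology, so `F` without `0` has a neighbourhood of `0` as
complement. -/
theorem NhdAxioms.exists_avoid (h : NhdAxioms χ M) (z : M.str.Assignment) {F : Set M.K}
    (hF : F.Finite) : ∃ z', M.nhd χ z' ⊆ M.nhd χ z ∧ ∀ f ∈ F, f ≠ 0 → f ∉ M.nhd χ z' := by
  let := M.topology χ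
  obtain ⟨-, h2, -, h4⟩ := h.definesFieldTopology
  have hc : (F \ {0})ᶜ ∈ 𝓝 (0 : M.K) :=
    (hF.subset Set.sdiff_subset).isClosed.isOpen_compl.mem_nhds (by simp)
  obtain ⟨z', hz'⟩ := h.exists_subset (inter_mem hc (h4.mem_of_mem (i := z) trivial))
  exact ⟨z', fun x hx => (hz' hx).2, fun f hf hf0 hfz => (hz' hfz).1 ⟨hf, hf0⟩⟩

/-- (DL) for the polynomial which arises from `q` by the substitution `g`. The order `m` is kept
apart from `l`: `m = l` gives the approximation of regular zeros, and `m = 1`, with most jets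
frozen, gives their perturbation. -/
theorem SchemeDL.exists_zero (hD : SchemeDL M χ δ) {m : ℕ} (hm : 1 ≤ m)
    (g : ℕ → MvPolynomial (Fin (m + 1)) M.K)
    (hg : ∀ j ∈ jetVars n l, MvPolynomial.pderiv (Fin.last m) (g j) = 0)
    (hg' : MvPolynomial.pderiv (Fin.last m) (g (Nat.pair n l)) = 1)
    (q : Polynomial (LowJet L n l)) (t : Fin (m + 1) → M.K)
    (h0 : M.ev (fun j => MvPolynomial.eval t (g j)) (toJet q) = 0)
    (h1 : M.ev (fun j => MvPolynomial.eval t (g j)) (toJet (Polynomial.derivative q)) ≠ 0)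
    (z : M.str.Assignment) : ∃ x : M.K,
      M.ev (fun j => MvPolynomial.eval (fun i : Fin (m + 1) => δ^[i] x) (g j)) (toJet q) = 0 ∧
      M.ev (fun j => MvPolynomial.eval (fun i : Fin (m + 1) => δ^[i] x) (g j))
        (toJet (Polynomial.derivative q)) ≠ 0 ∧
      ∀ i : Fin (m + 1), δ^[i] x - t i ∈ M.nhd χ z := by
  have hp := pderiv_substPoly (M := M) (Fin.last m) g hg hg' q
  have h1' := h1
  rw [← eval_substPoly, ← hp] at h1'
  -- The last variable occurs, since the partial derivative with respect to it is nonzero at `t`.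
  have hdeg : 0 < (substPoly M g (toJet q)).degreeOf (Fin.last m) := by
    by_contra h
    have h0 : (substPoly M g (toJet q)).degreeOf (Fin.last m) = 0 := by omega
    refine h1' ?_
    rw [MvPolynomial.pderiv_eq_zero_of_notMem_vars, map_zero]
    intro hv
    rw [MvPolynomial.degreeOf_eq_sup] at h0
    obtain ⟨d, hd, hdv⟩ := (MvPolynomial.mem_vars_iff_mem_support _).1 hv
    have := Finset.le_sup (f := fun d : Fin (m + 1) →₀ ℕ => d (Fin.last m)) hd
    exact Finsupp.mem_support_iff.1 hdv (Nat.le_zero.1 (h0 ▸ this))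
  obtain ⟨x, hx, hx', hxz⟩ := hD m hm _ hdeg t (by rw [eval_substPoly]; exact h0) h1' z
  rw [eval_substPoly] at hx
  rw [hp, eval_substPoly] at hx'
  exact ⟨x, hx, hx', hxz⟩

/-- The case `m = l`: the jets of `xₙ` up to order `l` stay variable, and everything else is frozen
at `y`. -/
theorem SchemeDL.exists_near (hD : SchemeDL M χ δ) (hl : 1 ≤ l) (q : Polynomial (LowJet L n l))
    (y u : ℕ → M.K) (h0 : M.ev (setJet n u y) (toJet q) = 0)
    (h1 : M.ev (setJet n u y) (toJet (Polynomial.derivative q)) ≠ 0) (z : M.str.Assignment) :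
    ∃ a : M.K, M.ev (setJet n (fun k => δ^[k] a) y) (toJet q) = 0 ∧
      M.ev (setJet n (fun k => δ^[k] a) y) (toJet (Polynomial.derivative q)) ≠ 0 ∧
      ∀ k ≤ l, δ^[k] a - u k ∈ M.nhd χ z := by
  let g : ℕ → MvPolynomial (Fin (l + 1)) M.K := fun j =>
    if h : (Nat.unpair j).1 = n ∧ (Nat.unpair j).2 ≤ l then
      MvPolynomial.X ⟨(Nat.unpair j).2, Nat.lt_succ_of_le h.2⟩ else MvPolynomial.C (y j)
  have hgk : ∀ k, (h : k < l + 1) → g (Nat.pair n k) = MvPolynomial.X ⟨k, h⟩ := by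
    intro k h; simp [g, Nat.le_of_lt_succ h]
  have hev : ∀ (u : ℕ → M.K), ∀ P ∈ JetPoly.lt L n (l + 1),
      M.ev (fun j => MvPolynomial.eval (fun i : Fin (l + 1) => u i) (g j)) P =
        M.ev (setJet n u y) P := by
    intro u P hP
    refine ev_congr (fun j hj => ?_) hP
    by_cases hjn : (Nat.unpair j).1 = n
    · have hlt : (Nat.unpair j).2 ≤ l := by
        by_contra h
        exact hj _ (not_le.1 h) (by rw [← hjn, Nat.pair_unpair])
      simp [g, setJet, hjn, hlt]
    · simp [g, setJet, hjn]
  obtain ⟨a, ha, ha', haz⟩ := hD.exists_zero hl g (n := n) (l := l) (fun j hj => by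
      by_cases h : (Nat.unpair j).1 = n ∧ (Nat.unpair j).2 ≤ l
      · have hne : (Fin.last l) ≠ ⟨(Nat.unpair j).2, Nat.lt_succ_of_le h.2⟩ := by
          intro he
          refine hj l le_rfl ?_
          have := congrArg Fin.val he
          simp only [Fin.val_last] at this
          rw [← h.1, this, Nat.pair_unpair]
        simp only [g, dif_pos h]
        exact MvPolynomial.pderiv_X_of_ne hne.symm
      · simp only [g, dif_neg h, MvPolynomial.pderiv_C]) (by
      rw [hgk l (Nat.lt_succ_self l)]
      exact MvPolynomial.pderiv_X_self _) q (fun i => u i)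
    (by rw [hev u _ (toJet_mem q)]; exact h0) (by rw [hev u _ (toJet_mem _)]; exact h1) z
  rw [hev (fun k => δ^[k] a) _ (toJet_mem _)] at ha ha'
  exact ⟨a, ha, ha', fun k hk => haz ⟨k, by omega⟩⟩

/-- The coordinate of order `0` of a regular zero can be varied. -/
theorem SchemeDL.exists_perturbation (hD : SchemeDL M χ δ) (hN : NhdAxioms χ M) (hl : 1 ≤ l)
    (q : Polynomial (LowJet L n l))
    (y u : ℕ → M.K) (h0 : M.ev (setJet n u y) (toJet q) = 0)
    (h1 : M.ev (setJet n u y) (toJet (Polynomial.derivative q)) ≠ 0) (z : M.str.Assignment) :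
    ∃ u' : ℕ → M.K, u' 0 ≠ u 0 ∧ M.ev (setJet n u' y) (toJet q) = 0 ∧
      M.ev (setJet n u' y) (toJet (Polynomial.derivative q)) ≠ 0 ∧
      ∀ k, u' k - u k ∈ M.nhd χ z := by
  obtain ⟨z', hz', hz1⟩ := hN.exists_avoid z (F := {-1}) (Set.finite_singleton _)
  -- Replace `u 0` by `x` and `u l` by `δ x + e`, and freeze the rest; this is an equation of order
  -- `1`. By the choice of `e` the base point is `(u 0, δ (u 0) + 1)`, so `x = u 0` would make the
  -- second difference equal to `-1`, which `z'` excludes.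
  set e : M.K := u l - δ (u 0) - 1 with he
  let g : ℕ → MvPolynomial (Fin 2) M.K := fun j =>
    if j = Nat.pair n l then MvPolynomial.X 1 + MvPolynomial.C e else
      if j = Nat.pair n 0 then MvPolynomial.X 0 else MvPolynomial.C (setJet n u y j)
  have hne : Nat.pair n 0 ≠ Nat.pair n l := by
    rw [Ne, Nat.pair_eq_pair]; omega
  have hev : ∀ t : Fin 2 → M.K, (fun j => MvPolynomial.eval t (g j)) =
      setJet n (Function.update (Function.update u 0 (t 0)) l (t 1 + e)) y := by
    intro t
    funext j
    by_cases hjn : (Nat.unpair j).1 = n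
    · obtain ⟨k, rfl⟩ : ∃ k, j = Nat.pair n k := ⟨_, by rw [← hjn, Nat.pair_unpair]⟩
      rw [setJet_pair]
      by_cases hkl : k = l
      · subst hkl; simp [g]
      · by_cases hk0 : k = 0
        · subst hk0; simp [g, hne, Function.update_of_ne hkl]
        · simp [g, Nat.pair_eq_pair, hkl, hk0]
    · rw [setJet_of_ne _ _ hjn]
      have h1 : j ≠ Nat.pair n l := by rintro rfl; simp at hjn
      have h2 : j ≠ Nat.pair n 0 := by rintro rfl; simp at hjn
      simp [g, h1, h2, setJet_of_ne _ _ hjn]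
  have hu : Function.update (Function.update u 0 (u 0)) l ((u l - e) + e) = u := by simp
  obtain ⟨x, hx, hx', hxz⟩ := hD.exists_zero le_rfl g (n := n) (l := l) (fun j hj => by
      have h1 : j ≠ Nat.pair n l := hj l le_rfl
      by_cases h2 : j = Nat.pair n 0
      · simp only [g, if_neg h1, if_pos h2]
        exact MvPolynomial.pderiv_X_of_ne (by decide)
      · simp [g, h1, h2]) (by
      simp only [g, if_true, map_add, MvPolynomial.pderiv_C, add_zero]
      exact MvPolynomial.pderiv_X_self _) q ![u 0, u l - e]
    (by rw [hev]; simpa [hu] using h0) (by rw [hev]; simpa [hu] using h1) z'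
  rw [hev] at hx hx'
  have hz0 : x - u 0 ∈ M.nhd χ z' := by simpa using hxz 0
  have hz2 : δ x - (u l - e) ∈ M.nhd χ z' := by simpa using hxz 1
  refine ⟨_, ?_, hx, hx', fun k => ?_⟩
  · rw [Function.update_of_ne (by omega), Function.update_self]
    change x ≠ u 0
    rintro rfl
    refine hz1 (-1) rfl (by simp) ?_
    convert hz2 using 1
    rw [he]; ring
  · by_cases hkl : k = l
    · subst hkl
      rw [Function.update_self]
      refine hz' ?_
      convert hz2 using 1
      change δ x + e - u k = _
      ring
    · rw [Function.update_of_ne hkl]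
      by_cases hk0 : k = 0
      · subst hk0
        rw [Function.update_self]
        exact hz' hz0
      · rw [Function.update_of_ne hk0, sub_self]
        exact hN.zero z

/-- A point outside `F` has a neighbourhood missing `F`. If `u 0` lies in `F`, it is first moved, by
so little that it cannot hit another point of `F`, and the new zero is then approximated. -/
theorem SchemeDL.exists_near_notMem (hD : SchemeDL M χ δ) (hN : NhdAxioms χ M) (hl : 1 ≤ l)
    (q : Polynomial (LowJet L n l)) (y u : ℕ → M.K) (h0 : M.ev (setJet n u y) (toJet q) = 0)
    (h1 : M.ev (setJet n u y) (toJet (Polynomial.derivative q)) ≠ 0) {F : Set M.K} (hF : F.Finite)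
    (z : M.str.Assignment) :
    ∃ a : M.K, a ∉ F ∧ M.ev (setJet n (fun k => δ^[k] a) y) (toJet q) = 0 ∧
      M.ev (setJet n (fun k => δ^[k] a) y) (toJet (Polynomial.derivative q)) ≠ 0 ∧
      ∀ k ≤ l, δ^[k] a - u k ∈ M.nhd χ z := by
  have base : ∀ (u : ℕ → M.K), M.ev (setJet n u y) (toJet q) = 0 →
      M.ev (setJet n u y) (toJet (Polynomial.derivative q)) ≠ 0 → u 0 ∉ F → ∀ z,
      ∃ a : M.K, a ∉ F ∧ M.ev (setJet n (fun k => δ^[k] a) y) (toJet q) = 0 ∧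
        M.ev (setJet n (fun k => δ^[k] a) y) (toJet (Polynomial.derivative q)) ≠ 0 ∧
        ∀ k ≤ l, δ^[k] a - u k ∈ M.nhd χ z := by
    intro u h0 h1 hu z
    obtain ⟨z', hz', hz1⟩ := hN.exists_avoid z (hF.image fun f => f - u 0)
    obtain ⟨a, ha, ha', haz⟩ := hD.exists_near hl q y u h0 h1 z'
    refine ⟨a, fun haF => hz1 (a - u 0) ⟨a, haF, rfl⟩ ?_ (haz 0 (Nat.zero_le _)), ha, ha',
      fun k hk => hz' (haz k hk)⟩
    rw [sub_ne_zero]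
    rintro rfl
    exact hu haF
  by_cases hu : u 0 ∈ F
  · obtain ⟨z1, hz1⟩ := hN.add z
    obtain ⟨z2, hz2, hz2'⟩ := hN.exists_avoid z1 (hF.image fun f => f - u 0)
    obtain ⟨u', hu', hq, hq', hn⟩ := hD.exists_perturbation hN hl q y u h0 h1 z2
    have hu'F : u' 0 ∉ F := fun h =>
      hz2' (u' 0 - u 0) ⟨_, h, rfl⟩ (sub_ne_zero.2 hu') (hn 0)
    obtain ⟨a, haF, ha, ha', haz⟩ := base u' hq hq' hu'F z1
    refine ⟨a, haF, ha, ha', fun k hk => ?_⟩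
    have := hz1 _ (haz k hk) _ (hz2 (hn k))
    rwa [sub_add_sub_cancel] at this
  · exact base u h0 h1 hu z

theorem NhdAxioms.nhds_hasBasis (hN : NhdAxioms χ M) (a : M.K) :
    (@nhds _ (M.topology χ) a).HasBasis (fun _ : M.str.Assignment => True)
      fun z => {b | b - a ∈ M.nhd χ z} := by
  let := M.topology χ
  obtain ⟨h1, -, -, h4⟩ := hN.definesFieldTopology
  have := h4.comap (fun b => b - a)
  rwa [nhds_translation_sub] at this

theorem tendsto_ev (hN : NhdAxioms χ M) {y u : ℕ → M.K} {𝓕 : Filter M.K}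
    (h : ∀ k < l, Tendsto (fun a => δ^[k] a) 𝓕 (@nhds _ (M.topology χ) (u k)))
    {P : JetPoly L} (hP : P ∈ JetPoly.lt L n l) :
    Tendsto (fun a => M.ev (setJet n (fun k => δ^[k] a) y) P) 𝓕
      (@nhds _ (M.topology χ) (M.ev (setJet n u y) P)) := by
  let := M.topology χ
  obtain ⟨h1, -, -, -⟩ := hN.definesFieldTopology
  refine JetPoly.lt_induction (p := fun P =>
    Tendsto (fun a => M.ev (setJet n (fun k => δ^[k] a) y) P) 𝓕 (𝓝 (M.ev (setJet n u y) P)))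
    (fun c => ?_) (fun j hj => ?_) (fun P Q hP hQ => ?_) (fun P Q hP hQ => ?_) hP
  · simpa using tendsto_const_nhds
  · simp only [FieldStructure.ev_X]
    by_cases hjn : (Nat.unpair j).1 = n
    · obtain ⟨k, rfl⟩ : ∃ k, j = Nat.pair n k := ⟨_, by rw [← hjn, Nat.pair_unpair]⟩
      simp only [setJet_pair]
      exact h k (by by_contra hk; exact hj k (not_lt.1 hk) rfl)
    · simp only [setJet_of_ne _ _ hjn]
      exact tendsto_const_nhds
  · simpa only [map_add] using hP.add hQ
  · simpa only [map_mul] using hP.mul hQ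

/-- Near a regular zero of order at least `1` there are infinitely many points whose jets are
regular zeros. -/
theorem IsGenericDerivation.exists_regularZero (hG : IsGenericDerivation K₀ χ M δ)
    (hN : NhdAxioms χ M) (hl : 1 ≤ l) (q : Polynomial (LowJet L n l)) {y u : ℕ → M.K}
    (hy : IsJet δ y) {K : ℕ} (hu : RegularZero M (setJet n u y) q K) {F : Set M.K} (hF : F.Finite)
    (z : M.str.Assignment) :
    ∃ a : M.K, a ∉ F ∧ RegularZero M (setJet n (fun k => δ^[k] a) y) q K ∧
      ∀ k ≤ l + K, δ^[k] a - u k ∈ M.nhd χ z := by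
  let := M.topology χ
  obtain ⟨ht, ht2, -, -⟩ := hN.definesFieldTopology
  have hu0 : M.ev (setJet n u y) (toJet q) = 0 := hu.1 0 (by simp)
  -- These sets generate a filter along which the jets up to order `l` tend to `u`; the claim about
  -- the jets up to order `l + K` becomes a statement about limits.
  let G : M.str.Assignment → Set M.K := fun z => {a | (a ∉ F ∧
    M.ev (setJet n (fun k => δ^[k] a) y) (toJet q) = 0 ∧
    M.ev (setJet n (fun k => δ^[k] a) y) (toJet (Polynomial.derivative q)) ≠ 0) ∧
    ∀ k ≤ l, δ^[k] a - u k ∈ M.nhd χ z}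
  let 𝓕 : Filter M.K := ⨅ z, 𝓟 (G z)
  have := M.str.assignment_nonempty
  have hdir : Directed (· ≥ ·) fun z => 𝓟 (G z) := by
    intro z z'
    obtain ⟨z'', hz⟩ := hN.inter z z'
    exact ⟨z'', principal_mono.2 fun a ha => ⟨ha.1, fun k hk => (hz (ha.2 k hk)).1⟩,
      principal_mono.2 fun a ha => ⟨ha.1, fun k hk => (hz (ha.2 k hk)).2⟩⟩
  have hne : 𝓕.NeBot := iInf_neBot_of_directed hdir fun z => principal_neBot_iff.2 (by
    obtain ⟨a, ha, ha1, ha2, ha3⟩ := hG.scheme.exists_near_notMem hN hl q y u hu0 hu.2.2 hF z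
    exact ⟨a, ⟨ha, ha1, ha2⟩, ha3⟩)
  have hGz : ∀ z, G z ∈ 𝓕 := fun z => mem_iInf_of_mem z (mem_principal_self _)
  have hz0 := M.str.assignment_nonempty.some
  have hev : ∀ᶠ a in 𝓕, a ∉ F ∧ M.ev (setJet n (fun k => δ^[k] a) y) (toJet q) = 0 ∧
      M.ev (setJet n (fun k => δ^[k] a) y) (toJet (Polynomial.derivative q)) ≠ 0 :=
    mem_of_superset (hGz hz0) fun a ha => ha.1
  -- Up to order `l` this is built into the filter. Beyond it, `δ^[k] a` and `u k` are the values of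
  -- one rational function `-T / S` of lower jets, where the separant `S` has a nonzero limit.
  have hlim : ∀ k, k ≤ l + K → Tendsto (fun a => δ^[k] a) 𝓕 (𝓝 (u k)) := by
    intro k
    induction k using Nat.strong_induction_on with
    | _ k ih =>
    intro hk
    by_cases hkl : k ≤ l
    · exact (hN.nhds_hasBasis (u k)).tendsto_right_iff.2 fun z _ =>
        mem_of_superset (hGz z) fun a ha => ha.2 k hkl
    · obtain ⟨i, rfl⟩ : ∃ i, k = l + i + 1 := ⟨k - l - 1, by omega⟩
      obtain ⟨T, hT, hD⟩ := iterate_jetDeriv_toJet q i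
      have hTl := tendsto_ev (n := n) (y := y) hN (fun k' hk' => ih k' hk' (by omega)) hT
      have hSl := tendsto_ev (n := n) (y := y) hN (fun k' hk' => ih k' hk' (by omega))
        (JetPoly.lt_mono (show l + 1 ≤ l + i + 1 by omega) (toJet_mem (Polynomial.derivative q)))
      have hsol : ∀ Y : ℕ → M.K, M.ev Y ((jetDeriv L)^[i + 1] (toJet q)) = 0 →
          M.ev Y (toJet (Polynomial.derivative q)) ≠ 0 → Y (Nat.pair n (l + i + 1)) =
            -M.ev Y T / M.ev Y (toJet (Polynomial.derivative q)) := by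
        intro Y h h'
        rw [hD] at h
        simp only [map_add, map_mul, FieldStructure.ev_X] at h
        rw [eq_div_iff h']
        linear_combination h
      have hlim := hTl.neg.div hSl hu.2.2
      have huk := hsol _ (hu.1 (i + 1) (by simp; omega)) hu.2.2
      rw [setJet_pair] at huk
      rw [← huk] at hlim
      refine hlim.congr' ?_
      filter_upwards [hev] with a ha
      have := hsol _ ((hy.setJet n a).ev_iterate hG.const ha.2.1 (i + 1)) ha.2.2
      rw [setJet_pair] at this
      exact this.symm
  have hlc : ∀ᶠ a in 𝓕, M.ev (setJet n (fun k => δ^[k] a) y) q.leadingCoeff.incl ≠ 0 :=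
    (tendsto_ev (n := n) (y := y) hN (fun k hk => hlim k (by omega))
      q.leadingCoeff.incl_mem).eventually_ne hu.2.1
  have hnear : ∀ᶠ a in 𝓕, ∀ k ∈ Finset.range (l + K + 1), δ^[k] a - u k ∈ M.nhd χ z := by
    refine (eventually_all_finset _).2 fun k hk => ?_
    exact (hN.nhds_hasBasis (u k)).tendsto_right_iff.1 (hlim k (by simp at hk; omega)) z trivial
  obtain ⟨a, h1, h2, h3⟩ := (hev.and (hlc.and hnear)).exists
  exact ⟨a, h1.1, ⟨fun k _ => (hy.setJet n a).ev_iterate hG.const h1.2.1 k, h2, h1.2.2⟩,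
    fun k hk => h3 k (by simp; omega)⟩

/-- A regular zero of order `0` consists of the derivatives of its first entry. -/
theorem RegularZero.eq_iterate (hδ : ∀ c : L.Const, δ (M.const c) = 0)
    (q : Polynomial (LowJet L n 0)) {y u : ℕ → M.K} (hy : IsJet δ y) {K : ℕ}
    (hu : RegularZero M (setJet n u y) q K) : ∀ k ≤ K, δ^[k] (u 0) = u k := by
  have hcon : ∀ P ∈ JetPoly.lt L n (0 + 1), M.ev (setJet n (fun k => δ^[k] (u 0)) y) P =
      M.ev (setJet n u y) P := by
    intro P hP
    refine ev_congr (fun j hj => ?_) hP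
    by_cases hjn : (Nat.unpair j).1 = n
    · obtain ⟨k, rfl⟩ : ∃ k, j = Nat.pair n k := ⟨_, by rw [← hjn, Nat.pair_unpair]⟩
      obtain rfl : k = 0 := by
        by_contra hk
        exact hj k (by omega) rfl
      simp
    · rw [setJet_of_ne _ _ hjn, setJet_of_ne _ _ hjn]
  have h0 : M.ev (setJet n (fun k => δ^[k] (u 0)) y) (toJet q) = 0 := by
    rw [hcon _ (toJet_mem q)]; exact hu.1 0 (by simp)
  intro k
  induction k using Nat.strong_induction_on with
  | _ k ih =>
  intro hk
  rcases k with _ | i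
  · rfl
  -- By induction both sequences agree below order `i + 1`; their next entries solve the same linear
  -- equation, whose coefficient, the separant, is nonzero.
  obtain ⟨T, hT, hD⟩ := iterate_jetDeriv_toJet q i
  have h1 := (hy.setJet n (u 0)).ev_iterate hδ h0 (i + 1)
  have h2 := hu.1 (i + 1) (by simp; omega)
  have hT' : M.ev (setJet n (fun k => δ^[k] (u 0)) y) T = M.ev (setJet n u y) T := by
    refine ev_congr (fun j hj => ?_) hT
    by_cases hjn : (Nat.unpair j).1 = n
    · obtain ⟨k, rfl⟩ : ∃ k, j = Nat.pair n k := ⟨_, by rw [← hjn, Nat.pair_unpair]⟩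
      have hki : k < i + 1 := by
        by_contra hk
        exact hj k (by omega) rfl
      simpa using ih k hki (by omega)
    · rw [setJet_of_ne _ _ hjn, setJet_of_ne _ _ hjn]
  rw [hD] at h1 h2
  simp only [map_add, map_mul, FieldStructure.ev_X, setJet_pair, hT',
    hcon _ (toJet_mem (Polynomial.derivative q)), zero_add] at h1 h2
  exact mul_left_cancel₀ hu.2.2 (by linear_combination h1 - h2)

end Generic

end TopFieldDer

namespace TopFieldDer

/-! Elimination of one field quantifier, and of `∃^∞`, in models with a generic derivation. -/

section Eliminate

variable {L : FieldLanguage.{u}} {K₀ : FieldStructure L} {χ : Formula L.lang}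

/-- The assignment of the derivatives of all values. -/
def jetAsg {M : FieldStructure L} (δ : Derivation ℤ M.K M.K) (v : M.str.Assignment) :
    M.str.Assignment :=
  M.withField v fun j => δ^[(Nat.unpair j).2] (v (none, (Nat.unpair j).1))

/-- Replace the jets of the `n`-th variable by `u`. -/
def FieldStructure.withJet (M : FieldStructure L) (n : ℕ) (u : ℕ → M.K) (w : M.str.Assignment) :
    M.str.Assignment :=
  M.withField w (setJet n u (M.coord w))

@[simp] theorem FieldStructure.coord_withJet (M : FieldStructure L) (n : ℕ) (u : ℕ → M.K)
    (w : M.str.Assignment) : M.coord (M.withJet n u w) = setJet n u (M.coord w) := rfl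

theorem FieldStructure.withJet_none (M : FieldStructure L) (n : ℕ) (u : ℕ → M.K)
    (w : M.str.Assignment) (j : ℕ) : M.withJet n u w (none, j) = setJet n u (M.coord w) j := rfl

theorem jetAsg_none {M : FieldStructure L} (δ : Derivation ℤ M.K M.K) (v : M.str.Assignment)
    (j : ℕ) : jetAsg δ v (none, j) = δ^[(Nat.unpair j).2] (M.coord v (Nat.unpair j).1) := rfl

theorem FieldStructure.withJet_withJet (M : FieldStructure L) (n : ℕ) (u u' : ℕ → M.K)
    (w : M.str.Assignment) : M.withJet n u (M.withJet n u' w) = M.withJet n u w := by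
  funext x
  rcases x with ⟨_ | a, j⟩
  · refine (M.withJet_none n _ _ j).trans ((?_ : _ = setJet n u (M.coord w) j).trans
      (M.withJet_none n _ w j).symm)
    by_cases hjn : (Nat.unpair j).1 = n <;> simp [setJet, hjn]
  · rfl

theorem jetAsg_assign {M : FieldStructure L} (δ : Derivation ℤ M.K M.K) (v : M.str.Assignment)
    (n : ℕ) (a : M.K) :
    jetAsg δ (M.str.assign v none n a) = M.withJet n (fun k => δ^[k] a) (jetAsg δ v) := by
  funext x
  rcases x with ⟨_ | b, j⟩
  · refine (jetAsg_none δ _ j).trans (Eq.trans ?_ (M.withJet_none n _ _ j).symm)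
    by_cases hjn : (Nat.unpair j).1 = n
    · rw [hjn, show M.coord (M.str.assign v none n a) n = a from
        Structure.assign_self (M := M.str) v none n a]
      simp [setJet, hjn]
    · rw [setJet_of_ne _ _ hjn, show M.coord (M.str.assign v none n a) (Nat.unpair j).1 =
        M.coord v (Nat.unpair j).1 from
        Structure.assign_of_ne (M := M.str) _ _ (by simpa using hjn)]
      rfl
  · exact Structure.assign_of_ne (M := M.str) _ _ (by simp)

theorem isJet_jetAsg {M : FieldStructure L} (δ : Derivation ℤ M.K M.K) (v : M.str.Assignment) :
    IsJet δ (M.coord (jetAsg δ v)) := by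
  intro n k
  have h : ∀ k, M.coord (jetAsg δ v) (Nat.pair n k) = δ^[k] (M.coord v n) := by
    intro k
    refine (jetAsg_none δ v _).trans ?_
    rw [Nat.unpair_pair]
  rw [h, h, Function.iterate_succ_apply']

/-- The set of the elements whose jets satisfy `R`. -/
def jetSolutions {M : FieldStructure L} (R : M.str.Assignment → Prop)
    (δ : Derivation ℤ M.K M.K) (v : M.str.Assignment) (n : ℕ) : Set M.K :=
  {a | R (M.withJet n (fun k => δ^[k] a) (jetAsg δ v))}

/-- The quantifiers `∃` and `∃^∞` over the `n`-th variable applied to a relation between jets can be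
eliminated. -/
def Good (K₀ : FieldStructure L) (χ : Formula L.lang) (n : ℕ)
    (R : ∀ M : FieldStructure L, M.str.Assignment → Prop) : Prop :=
  ∃ (ψ : Formula L.lang) (N : ℕ), ∀ (M : FieldStructure L) (δ : Derivation ℤ M.K M.K),
    IsGenericDerivation K₀ χ M δ → ∀ v : M.str.Assignment,
      ((jetSolutions (R M) δ v n).Nonempty ↔ ψ.Sat M.str (jetAsg δ v)) ∧
      ((jetSolutions (R M) δ v n).Finite → (jetSolutions (R M) δ v n).ncard ≤ N)

variable {n : ℕ}

theorem Good.congr {R R' : ∀ M : FieldStructure L, M.str.Assignment → Prop}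
    (h : Good K₀ χ n R) (hR : ∀ M w, R M w ↔ R' M w) : Good K₀ χ n R' := by
  obtain rfl : R = R' := by funext M w; exact propext (hR M w)
  exact h

theorem Good.or {R R' : ∀ M : FieldStructure L, M.str.Assignment → Prop}
    (h : Good K₀ χ n R) (h' : Good K₀ χ n R') : Good K₀ χ n fun M w => R M w ∨ R' M w := by
  obtain ⟨ψ, N, h⟩ := h
  obtain ⟨ψ', N', h'⟩ := h'
  refine ⟨ψ.neg.imp ψ', N + N', fun M δ hG v => ?_⟩
  have hU : jetSolutions (fun w => R M w ∨ R' M w) δ v n =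
    jetSolutions (R M) δ v n ∪ jetSolutions (R' M) δ v n := rfl
  rw [hU, Set.union_nonempty, (h M δ hG v).1, (h' M δ hG v).1, Set.finite_union]
  refine ⟨by simp [or_iff_not_imp_left], fun hf => (Set.ncard_union_le _ _).trans ?_⟩
  exact add_le_add ((h M δ hG v).2 hf.1) ((h' M δ hG v).2 hf.2)

theorem Good.list {α : Type*} (R : ∀ M : FieldStructure L, M.str.Assignment → Prop)
    (S : α → ∀ M : FieldStructure L, M.str.Assignment → Prop) (l : List α)
    (h : ∀ c ∈ l, Good K₀ χ n fun M w => R M w ∧ S c M w) :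
    Good K₀ χ n fun M w => R M w ∧ ∃ c ∈ l, S c M w := by
  induction l with
  | nil =>
    refine ⟨.falsum, 0, fun M δ hG v => ?_⟩
    simp [jetSolutions]
  | cons c l ih =>
    refine ((h c (by simp)).or (ih fun c' hc' => h c' (by simp [hc']))).congr fun M w => ?_
    simp only [List.mem_cons, exists_eq_or_imp]
    tauto

/-- The relation `R` does not depend on the jets of order greater than `m` of the `n`-th
variable. -/
def JetBound (n m : ℕ) (φ : Formula L.lang) : Prop :=
  ∀ (M : FieldStructure L) (w w' : M.str.Assignment),
    (∀ x, (∀ k, m < k → x ≠ (none, Nat.pair n k)) → w x = w' x) →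
      (φ.Sat M.str w ↔ φ.Sat M.str w')

theorem exists_jetBound (n : ℕ) (φ : Formula L.lang) : ∃ m, ∀ m', m ≤ m' → JetBound n m' φ := by
  obtain ⟨S, hS⟩ := φ.exists_support
  refine ⟨S.sup Prod.snd, fun m' hm' M w w' h => hS M.str w w' fun x hx => h x fun k hk he => ?_⟩
  have h1 := Finset.le_sup (f := Prod.snd) hx
  rw [he] at h1
  have h2 := Nat.right_le_pair n k
  simp only at h1
  omega

theorem exists_jetBound_list (n : ℕ) {α : Type*} (l : List α) (f : α → Formula L.lang) :
    ∃ m, ∀ m', m ≤ m' → ∀ c ∈ l, JetBound n m' (f c) := by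
  choose m hm using fun c => exists_jetBound n (f c)
  refine ⟨(l.map m).sum, fun m' hm' c hc => hm c m' (le_trans ?_ hm')⟩
  exact List.le_sum_of_mem (List.mem_map_of_mem hc)

/-- A relation in disjunctive open form holds locally, subject to a condition `H` under which its
equations persist. -/
theorem exists_near_sat {M : FieldStructure L} (hN : NhdAxioms χ M) {φ : Formula L.lang}
    {D : List (List (JetPoly L) × Formula L.lang)}
    (hD : ∀ c ∈ D, M.DefinesOpen χ c.2)
    (hφ : ∀ v : M.str.Assignment, φ.Sat M.str v ↔
          ∃ c ∈ D, (∀ P ∈ c.1, M.ev (M.coord v) P = 0) ∧ c.2.Sat M.str v)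
    {H : (ℕ → M.K) → Prop} {m : ℕ} (hm : ∀ c ∈ D, JetBound n m c.2) {w : M.str.Assignment}
    (hw : φ.Sat M.str w)
    (hP : ∀ c ∈ D, ∀ P ∈ c.1, M.ev (M.coord w) P = 0 →
      ∀ u', H (setJet n u' (M.coord w)) → M.ev (setJet n u' (M.coord w)) P = 0) :
    ∃ z, ∀ u' : ℕ → M.K, (∀ k ≤ m, u' k - M.coord w (Nat.pair n k) ∈ M.nhd χ z) →
      H (setJet n u' (M.coord w)) → φ.Sat M.str (M.withJet n u' w) := by
  classical
  obtain ⟨c, hc, hcP, hcs⟩ := (hφ w).1 hw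
  obtain ⟨z, hz⟩ := hN.exists_box (hD c hc) hcs ((Finset.range (m + 1)).image (Nat.pair n))
  refine ⟨z, fun u' hu' hH => (hφ _).2 ⟨c, hc, fun P hPc => hP c hc P hPc (hcP P hPc) u' hH, ?_⟩⟩
  -- Jets of order above `m` keep their values from `w`, so that only finitely many coordinates move
  -- inside the box. The open condition does not see the difference.
  have := hz (M.withJet n (fun k => if k ≤ m then u' k else M.coord w (Nat.pair n k)) w) ?_ ?_
  · refine (hm c hc M _ _ ?_).1 this
    rintro ⟨_ | a, j⟩ hx
    · refine (M.withJet_none n _ w j).trans (Eq.trans ?_ (M.withJet_none n _ w j).symm)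
      by_cases hjn : (Nat.unpair j).1 = n
      · obtain ⟨k, rfl⟩ : ∃ k, j = Nat.pair n k := ⟨_, by rw [← hjn, Nat.pair_unpair]⟩
        have hk : k ≤ m := by
          by_contra hk
          exact hx k (not_le.1 hk) rfl
        simp [hk]
      · simp [setJet_of_ne _ _ hjn]
    · rfl
  · rintro ⟨_ | a, j⟩ hx
    · refine (M.withJet_none n _ w j).trans ?_
      by_cases hjn : (Nat.unpair j).1 = n
      · obtain ⟨k, rfl⟩ : ∃ k, j = Nat.pair n k := ⟨_, by rw [← hjn, Nat.pair_unpair]⟩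
        have hk : ¬ k ≤ m := fun hk => hx (Nat.pair n k)
          (Finset.mem_image_of_mem _ (Finset.mem_range.2 (by omega))) rfl
        simp [hk]
        rfl
      · rw [setJet_of_ne _ _ hjn]; rfl
    · rfl
  · intro j hj
    obtain ⟨k, hk, rfl⟩ := Finset.mem_image.1 hj
    have hk : k ≤ m := by simp at hk; omega
    rw [FieldStructure.withJet_none, setJet_pair, if_pos hk]
    exact hu' k hk

/-- The relation which says that `φ` holds, locally on `H`, at some jet satisfying `H`. -/
theorem exists_localFormula (χ φ : Formula L.lang) (n m : ℕ)
    {H : ∀ M : FieldStructure L, (ℕ → M.K) → Prop}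
    (hH : Def (fieldStr L) fun M w => H M (M.coord w)) :
    ∃ ψ : Formula L.lang, ∀ (M : FieldStructure L) (w : M.str.Assignment),
      ψ.Sat M.str w ↔ ∃ u : M.str.Assignment, H M (setJet n (M.coord u) (M.coord w)) ∧
        φ.Sat M.str (M.withJet n (M.coord u) w) ∧
        ∃ z : M.str.Assignment, ∀ u' : M.str.Assignment,
          (∀ k ∈ Finset.range (m + 1), M.coord u' k - M.coord u k ∈ M.nhd χ z) →
            H M (setJet n (M.coord u') (M.coord w)) →
              φ.Sat M.str (M.withJet n (M.coord u') w) := by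
  -- Slots `0`, `1`, `2`, `3` hold `w`, `u`, `z`, `u'`.
  have hmap : ∀ i, TermMap (fieldStr L) fun M vs => M.withJet n (M.coord (vs i)) (vs 0) := by
    intro i
    refine TermMap.withField (fun j => ?_) 0
    by_cases hjn : (Nat.unpair j).1 = n
    · simp only [setJet, hjn, if_true]
      exact TermFun.coord i (Nat.unpair j).2
    · simp only [setJet, hjn, if_false]
      exact TermFun.coord 0 j
  have hφ : Def (fieldStr L) fun M w => φ.Sat M.str w := ⟨φ, fun _ _ => Iff.rfl⟩
  have hnear : DefS (fieldStr L) fun M vs => ∀ k ∈ Finset.range (m + 1),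
      M.coord (vs 3) k - M.coord (vs 1) k ∈ M.nhd χ (vs 2) :=
    DefS.forall_mem _ fun k _ => ((TermFun.coord 3 k).sub (TermFun.coord 1 k)).mem_nhd χ 2
  have h1 := ((hH.comp (hmap 1)).and ((hφ.comp (hmap 1)).and
    (((hnear.imp ((hH.comp (hmap 3)).imp (hφ.comp (hmap 3)))).all 3).ex 2))).ex 1
  obtain ⟨ψ, hψ⟩ := h1.toDef
  exact ⟨ψ, hψ⟩

/-- One step of the elimination. `H` is the system of equations in force, and `C` collects the
smaller cases, already settled by `hC`. A solution outside `C` satisfies `H`, and `φ` persists near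
it on `H`, so the local formula `ψ₂` holds. Conversely, if `ψ₂` holds then by `hreal` genuine jets
on `H` come close enough to satisfy `φ`. Hence either `ψ₂` holds and there are solutions, or all
solutions lie in `C`. -/
theorem Good.of_step {φ : Formula L.lang} {H : ∀ M : FieldStructure L, (ℕ → M.K) → Prop}
    (hH : Def (fieldStr L) fun M w => H M (M.coord w)) (m : ℕ)
    (C : ∀ M : FieldStructure L, M.str.Assignment → Prop)
    (hC : Good K₀ χ n fun M w => φ.Sat M.str w ∧ C M w)
    (hloc : ∀ M : FieldStructure L, M.IsModelOf K₀ → ∀ w : M.str.Assignment, φ.Sat M.str w →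
      ¬ C M w → H M (M.coord w) →
      ∃ z, ∀ u' : ℕ → M.K, (∀ k ≤ m, u' k - M.coord w (Nat.pair n k) ∈ M.nhd χ z) →
      H M (setJet n u' (M.coord w)) → φ.Sat M.str (M.withJet n u' w))
    (hjet : ∀ (M : FieldStructure L) (δ : Derivation ℤ M.K M.K), IsGenericDerivation K₀ χ M δ →
      ∀ v, φ.Sat M.str (jetAsg δ v) → ¬ C M (jetAsg δ v) → H M (M.coord (jetAsg δ v)))
    (hreal : ∀ (M : FieldStructure L) (δ : Derivation ℤ M.K M.K), IsGenericDerivation K₀ χ M δ →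
      ∀ v (u : ℕ → M.K), H M (setJet n u (M.coord (jetAsg δ v))) → ∀ z,
        {a : M.K | H M (setJet n (fun k => δ^[k] a) (M.coord (jetAsg δ v))) ∧
          ∀ k ≤ m, δ^[k] a - u k ∈ M.nhd χ z}.Nonempty)
    (hinf : (∀ (M : FieldStructure L) (δ : Derivation ℤ M.K M.K), IsGenericDerivation K₀ χ M δ →
      ∀ v (u : ℕ → M.K), H M (setJet n u (M.coord (jetAsg δ v))) → ∀ z,
        {a : M.K | H M (setJet n (fun k => δ^[k] a) (M.coord (jetAsg δ v))) ∧
          ∀ k ≤ m, δ^[k] a - u k ∈ M.nhd χ z}.Infinite) ∨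
      ∃ d, ∀ (M : FieldStructure L) (δ : Derivation ℤ M.K M.K), IsGenericDerivation K₀ χ M δ →
        ∀ v, (jetSolutions (fun w => φ.Sat M.str w) δ v n).ncard ≤ d) :
    Good K₀ χ n fun M w => φ.Sat M.str w := by
  obtain ⟨ψ₁, N₁, h₁⟩ := hC
  obtain ⟨ψ₂, h₂⟩ := exists_localFormula χ φ n m hH
  have hwj : ∀ (M : FieldStructure L) (δ : Derivation ℤ M.K M.K) (v : M.str.Assignment) (a : M.K),
      M.withJet n (fun k => δ^[k] a) (jetAsg δ v) = jetAsg δ (M.str.assign v none n a) :=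
    fun M δ v a => (jetAsg_assign δ v n a).symm
  have fwd : ∀ (M : FieldStructure L) (δ : Derivation ℤ M.K M.K), IsGenericDerivation K₀ χ M δ →
      ∀ v, ∀ a ∈ jetSolutions (fun w => φ.Sat M.str w) δ v n,
      ¬ C M (M.withJet n (fun k => δ^[k] a) (jetAsg δ v)) → ψ₂.Sat M.str (jetAsg δ v) := by
    intro M δ hG v a ha hCa
    have ha' : φ.Sat M.str (M.withJet n (fun k => δ^[k] a) (jetAsg δ v)) := ha
    have hHa := hjet M δ hG (M.str.assign v none n a) (by rw [← hwj]; exact ha')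
      (by rw [← hwj]; exact hCa)
    rw [← hwj] at hHa
    obtain ⟨z, hz⟩ := hloc M hG.model _ ha' hCa hHa
    refine (h₂ M _).2 ⟨M.withField (jetAsg δ v) fun k => δ^[k] a, hHa, ha', z, fun u' hu' hH' => ?_⟩
    have hs : ∀ u'', setJet n u'' (M.coord (M.withJet n (fun k => δ^[k] a) (jetAsg δ v))) =
        setJet n u'' (M.coord (jetAsg δ v)) := fun u'' =>
      congrArg M.coord (M.withJet_withJet n u'' (fun k => δ^[k] a) (jetAsg δ v))
    have := hz (M.coord u') (fun k hk => by
      rw [FieldStructure.coord_withJet, setJet_pair]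
      exact hu' k (by simp; omega)) (by rw [hs]; exact hH')
    rwa [M.withJet_withJet] at this
  have bwd : ∀ (M : FieldStructure L) (δ : Derivation ℤ M.K M.K), IsGenericDerivation K₀ χ M δ →
      ∀ v, ψ₂.Sat M.str (jetAsg δ v) → ∃ u, H M (setJet n u (M.coord (jetAsg δ v))) ∧
      ∃ z, {a : M.K | H M (setJet n (fun k => δ^[k] a) (M.coord (jetAsg δ v))) ∧
          ∀ k ≤ m, δ^[k] a - u k ∈ M.nhd χ z} ⊆ jetSolutions (fun w => φ.Sat M.str w) δ v n := by
    intro M δ hG v hψ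
    obtain ⟨u, hHu, -, z, hz⟩ := (h₂ M _).1 hψ
    refine ⟨M.coord u, hHu, z, ?_⟩
    rintro a ⟨ha, haz⟩
    exact hz (M.withField (jetAsg δ v) fun k => δ^[k] a)
      (fun k hk => haz k (by simp at hk; omega)) ha
  have hsplit : ∀ (M : FieldStructure L) (δ : Derivation ℤ M.K M.K), IsGenericDerivation K₀ χ M δ →
      ∀ v, ¬ ψ₂.Sat M.str (jetAsg δ v) → jetSolutions (fun w => φ.Sat M.str w) δ v n =
        jetSolutions (fun w => φ.Sat M.str w ∧ C M w) δ v n := by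
    intro M δ hG v h
    refine Set.Subset.antisymm (fun a ha => ⟨ha, ?_⟩) fun a ha => ha.1
    by_contra hCa
    exact h (fwd M δ hG v a ha hCa)
  have hne : ∀ (M : FieldStructure L) (δ : Derivation ℤ M.K M.K), IsGenericDerivation K₀ χ M δ →
      ∀ v, ((jetSolutions (fun w => φ.Sat M.str w) δ v n).Nonempty ↔
        (ψ₂.neg.imp ψ₁).Sat M.str (jetAsg δ v)) := by
    intro M δ hG v
    rw [Formula.sat_imp, Formula.sat_neg]
    constructor
    · intro h hψ
      rw [hsplit M δ hG v hψ] at h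
      exact (h₁ M δ hG v).1.1 h
    · intro h
      by_cases hψ : ψ₂.Sat M.str (jetAsg δ v)
      · obtain ⟨u, hu, z, hz⟩ := bwd M δ hG v hψ
        exact (hreal M δ hG v u hu z).mono hz
      · exact ((h₁ M δ hG v).1.2 (h hψ)).mono fun a ha => ha.1
  -- In the first alternative `ψ₂` forces infinitely many solutions, so a finite solution set lies
  -- in `C` and `N₁` bounds it. In the second, `d` is a bound outright.
  rcases hinf with hinf | ⟨d, hd⟩
  · refine ⟨_, N₁, fun M δ hG v => ⟨hne M δ hG v, fun hf => ?_⟩⟩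
    have hψ : ¬ ψ₂.Sat M.str (jetAsg δ v) := by
      intro hψ
      obtain ⟨u, hu, z, hz⟩ := bwd M δ hG v hψ
      exact (hinf M δ hG v u hu z).mono hz hf
    rw [hsplit M δ hG v hψ] at hf ⊢
    exact (h₁ M δ hG v).2 hf
  · exact ⟨_, d, fun M δ hG v => ⟨hne M δ hG v, fun _ => hd M δ hG v⟩⟩

theorem exists_list_of_forall {α β : Type*} (l : List α) {p : α → List β → Prop} {q : β → Prop}
    (h : ∀ a ∈ l, ∃ s : List β, (∀ b ∈ s, q b) ∧ p a s)
    (hmono : ∀ a s s', s ⊆ s' → p a s → p a s') :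
    ∃ s : List β, (∀ b ∈ s, q b) ∧ ∀ a ∈ l, p a s := by
  induction l with
  | nil => exact ⟨[], by simp, by simp⟩
  | cons a l ih =>
    obtain ⟨s, hs, hsa⟩ := h a (by simp)
    obtain ⟨s', hs', hsl⟩ := ih fun b hb => h b (by simp [hb])
    refine ⟨s ++ s', fun b hb => ?_, fun b hb => ?_⟩
    · exact (List.mem_append.1 hb).elim (hs b) (hs' b)
    · rcases List.mem_cons.1 hb with rfl | hb
      · exact hmono _ _ _ (List.subset_append_left _ _) hsa
      · exact hmono _ _ _ (List.subset_append_right _ _) (hsl b hb)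

theorem Def.crit (c : Σ l, Polynomial (LowJet L n l)) :
    Def (fieldStr L) fun M w => Crit M (M.coord w) c :=
  (Def.ev_eq_zero _).not.and (Def.ev_eq_zero _)

theorem Def.regularZero {l : ℕ} (q : Polynomial (LowJet L n l)) (K : ℕ) :
    Def (fieldStr L) fun M w => RegularZero M (M.coord w) q K :=
  (Def.forall_mem _ fun _ _ => Def.ev_eq_zero _).and
    ((Def.ev_eq_zero _).not.and (Def.ev_eq_zero _).not)

theorem ev_toJet {M : FieldStructure L} (Y : ℕ → M.K) {l : ℕ} (q : Polynomial (LowJet L n l)) :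
    M.ev Y (toJet q) = (q.map ((M.ev Y).comp LowJet.incl)).eval (Y (Nat.pair n l)) := by
  rw [Polynomial.eval_map, toJet, Polynomial.coe_eval₂RingHom, Polynomial.hom_eval₂]
  simp

/-- Here `H` says that the jet is a regular zero of `q` and of enough of its derivatives, and `C`
lists the smaller critical polynomials that can obstruct the reduction of the equations of `φ` or
the nonvanishing of the separant. -/
theorem Good.of_crit (hT : IsOpenTheory K₀ χ) {l : ℕ} (q : Polynomial (LowJet L n l))
    (hq : 1 ≤ q.natDegree)
    (ih : ∀ c : Σ l, Polynomial (LowJet L n l), 1 ≤ c.2.natDegree →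
      (c.1 < l ∨ c.1 = l ∧ c.2.natDegree < q.natDegree) → ∀ φ : Formula L.lang,
        Good K₀ χ n fun M w => φ.Sat M.str w ∧ Crit M (M.coord w) c)
    (ρ : Formula L.lang) :
    Good K₀ χ n fun M w => ρ.Sat M.str w ∧ Crit M (M.coord w) ⟨l, q⟩ := by
  obtain ⟨φ, hφ⟩ := (show Def (fieldStr L) fun M w => ρ.Sat M.str w from
    ⟨ρ, fun _ _ => Iff.rfl⟩).and (Def.crit ⟨l, q⟩)
  refine Good.congr (R := fun M w => φ.Sat M.str w) ?_ hφ
  obtain ⟨D, hD⟩ := hT.exists_form φ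
  obtain ⟨m₁, hm₁⟩ := exists_jetBound_list n D Prod.snd
  obtain ⟨l', hl'⟩ : ∃ l', ∀ c ∈ D, ∀ P ∈ c.1, P ∈ JetPoly.lt L n l' := by
    choose f hf using fun P : JetPoly L => JetPoly.exists_mem_lt n P
    refine ⟨(D.map fun c => (c.1.map f).sum).sum, fun c hc P hP => JetPoly.lt_mono ?_ (hf P)⟩
    exact (List.le_sum_of_mem (List.mem_map_of_mem hP)).trans
      (List.le_sum_of_mem (List.mem_map_of_mem (f := fun c => (c.1.map f).sum) hc))
  -- Large enough for the prolonged system to cover the orders of all equations, `l' ≤ l + K + 1`,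
  -- and the jets seen by the open conditions, `m₁ ≤ l + K`.
  set K := m₁ + l' with hK
  obtain ⟨𝒬, h𝒬, h𝒬'⟩ := exists_list_of_forall (β := Σ l, Polynomial (LowJet L n l))
    (D.flatMap Prod.fst)
    (p := fun P s => ∀ (M : FieldStructure L) (Y Y' : ℕ → M.K), AgreeOff n Y Y' →
      RegularZero M Y q K → RegularZero M Y' q K → M.ev Y P = 0 →
        (∃ c ∈ s, Crit M Y c) ∨ M.ev Y' P = 0)
    (fun P hP => by
      obtain ⟨c, hc, hP⟩ := List.mem_flatMap.1 hP
      exact exists_crit_of_regularZero q hq K P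
        (JetPoly.lt_mono (by omega) (hl' c hc P hP)))
    (fun P s s' hs h M Y Y' h1 h2 h3 h4 => (h M Y Y' h1 h2 h3 h4).imp
      (fun ⟨c, hc, h⟩ => ⟨c, hs hc, h⟩) id)
  -- The separant counts as a smaller critical polynomial, so that outside the list it does not
  -- vanish. For degree `1` this is unnecessary: it then equals the leading coefficient of `q`.
  let 𝒬' : List (Σ l, Polynomial (LowJet L n l)) :=
    if 2 ≤ q.natDegree then ⟨l, Polynomial.derivative q⟩ :: 𝒬 else 𝒬
  have hsub : 𝒬 ⊆ 𝒬' := by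
    intro c hc
    by_cases h : 2 ≤ q.natDegree
    · simp [𝒬', h, hc]
    · simp [𝒬', h, hc]
  have hdd : (Polynomial.derivative q).natDegree = q.natDegree - 1 :=
    Polynomial.natDegree_derivative _
  refine Good.of_step (H := fun M Y => RegularZero M Y q K) (Def.regularZero q K) (l + K)
    (fun M w => ∃ c ∈ 𝒬', Crit M (M.coord w) c)
    (Good.list _ (fun c M w => Crit M (M.coord w) c) _ fun c hc => ?_) ?_ ?_ ?_ ?_
  · by_cases h : 2 ≤ q.natDegree
    · simp only [𝒬', if_pos h, List.mem_cons] at hc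
      rcases hc with rfl | hc
      · exact ih _ (by simp only [hdd]; omega) (.inr ⟨rfl, by simp only [hdd]; omega⟩) φ
      · exact ih c (h𝒬 c hc).1 (h𝒬 c hc).2 φ
    · simp only [𝒬', if_neg h] at hc
      exact ih c (h𝒬 c hc).1 (h𝒬 c hc).2 φ
  · intro M hM w hw hCw hH
    refine exists_near_sat (H := fun Y => RegularZero M Y q K) (hT.nhdAxioms hM) (hD M hM).1
      (hD M hM).2 (hm₁ _ (by omega)) hw fun c hc P hP hPw u' hu' => ?_
    refine (h𝒬' P (List.mem_flatMap.2 ⟨c, hc, hP⟩) M (M.coord w) _ ?_ hH hu' hPw).resolve_left ?_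
    · intro j hj
      rw [setJet_of_ne _ _ hj]
    · rintro ⟨c, hc, h⟩
      exact hCw ⟨c, hsub hc, h⟩
  · intro M δ hG v hv hCv
    have := hT.charZero_of_model hG.model
    obtain ⟨-, h1, h2⟩ := (hφ M _).1 hv
    refine ⟨fun k _ => (isJet_jetAsg δ v).ev_iterate hG.const h2 k, h1, fun h0 => ?_⟩
    have hlc : (Polynomial.derivative q).leadingCoeff =
        q.leadingCoeff * (q.natDegree : LowJet L n l) := by
      rw [Polynomial.leadingCoeff, hdd, Polynomial.coeff_derivative, Polynomial.leadingCoeff]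
      have : q.natDegree - 1 + 1 = q.natDegree := by omega
      rw [this, ← Nat.cast_succ, Nat.succ_eq_add_one, this]
    have hlc0 : M.ev (M.coord (jetAsg δ v)) (Polynomial.derivative q).leadingCoeff.incl ≠ 0 := by
      rw [hlc, map_mul, map_mul, map_natCast, map_natCast]
      exact mul_ne_zero h1 (Nat.cast_ne_zero.2 (by omega))
    by_cases h : 2 ≤ q.natDegree
    · exact hCv ⟨⟨l, Polynomial.derivative q⟩, by simp [𝒬', h], hlc0, h0⟩
    · have hd0 : (Polynomial.derivative q).natDegree = 0 := by omega
      rw [Polynomial.eq_C_of_natDegree_eq_zero hd0, toJet_C] at h0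
      rw [Polynomial.leadingCoeff, hd0] at hlc0
      exact hlc0 h0
  · intro M δ hG v u hu z
    rcases Nat.eq_zero_or_pos l with rfl | hl
    -- In order `0` no approximation is needed: `u 0` itself has the required jet.
    · have hc := RegularZero.eq_iterate hG.const q (isJet_jetAsg δ v) hu
      have hN := hT.nhdAxioms hG.model
      refine ⟨u 0, ?_, fun k hk => by rw [hc k (by omega), sub_self]; exact hN.zero z⟩
      have hev : ∀ P ∈ JetPoly.lt L n (0 + 1),
          M.ev (setJet n (fun k => δ^[k] (u 0)) (M.coord (jetAsg δ v))) P =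
            M.ev (setJet n u (M.coord (jetAsg δ v))) P := by
        intro P hP
        refine ev_congr (fun j hj => ?_) hP
        by_cases hjn : (Nat.unpair j).1 = n
        · obtain ⟨k, rfl⟩ : ∃ k, j = Nat.pair n k := ⟨_, by rw [← hjn, Nat.pair_unpair]⟩
          obtain rfl : k = 0 := by
            by_contra hk
            exact hj k (by omega) rfl
          simp
        · rw [setJet_of_ne _ _ hjn, setJet_of_ne _ _ hjn]
      refine ⟨fun k _ => ((isJet_jetAsg δ v).setJet n (u 0)).ev_iterate hG.const ?_ k, ?_, ?_⟩
      · rw [hev _ (toJet_mem q)]; exact hu.1 0 (by simp)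
      · rw [hev _ (JetPoly.lt_mono (Nat.zero_le _) q.leadingCoeff.incl_mem)]; exact hu.2.1
      · rw [hev _ (toJet_mem _)]; exact hu.2.2
    · obtain ⟨a, -, ha, haz⟩ := hG.exists_regularZero (hT.nhdAxioms hG.model) hl q
        (isJet_jetAsg δ v) hu Set.finite_empty z
      exact ⟨a, ha, haz⟩
  · rcases Nat.eq_zero_or_pos l with rfl | hl
    -- In order `0` the coefficients of `q` do not involve the jets of the solution, so all
    -- solutions are roots of one polynomial `p`, nonzero because the leading coefficient of `q`
    -- survives evaluation.
    · refine .inr ⟨q.natDegree, fun M δ hG v => ?_⟩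
      rcases (jetSolutions (fun w => φ.Sat M.str w) δ v n).eq_empty_or_nonempty with he | ⟨a₀, ha₀⟩
      · simp [he]
      set Y := setJet n (fun k => δ^[k] a₀) (M.coord (jetAsg δ v)) with hY
      set p : Polynomial M.K := q.map ((M.ev Y).comp LowJet.incl) with hp
      have hlow : ∀ a : M.K, ∀ c : LowJet L n 0,
          M.ev (setJet n (fun k => δ^[k] a) (M.coord (jetAsg δ v))) c.incl = M.ev Y c.incl := by
        intro a c
        refine ev_congr (fun j hj => ?_) c.incl_mem
        have hjn : (Nat.unpair j).1 ≠ n := fun h =>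
          hj (Nat.unpair j).2 (Nat.zero_le _) (by rw [← h, Nat.pair_unpair])
        rw [hY, setJet_of_ne _ _ hjn, setJet_of_ne _ _ hjn]
      have heval : ∀ a : M.K,
          M.ev (setJet n (fun k => δ^[k] a) (M.coord (jetAsg δ v))) (toJet q) = p.eval a := by
        intro a
        have h : (M.ev (setJet n (fun k => δ^[k] a) (M.coord (jetAsg δ v)))).comp LowJet.incl =
          (M.ev Y).comp LowJet.incl := RingHom.ext (hlow a)
        rw [ev_toJet, hp, h, setJet_pair, Function.iterate_zero_apply]
      have hp0 : p ≠ 0 := by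
        intro h0
        have := congrArg (fun p => p.coeff q.natDegree) h0
        simp only [hp, Polynomial.coeff_map, Polynomial.coeff_zero] at this
        exact ((hφ M _).1 ha₀).2.1 this
      classical
      refine (Set.ncard_le_ncard (t := (p.roots.toFinset : Set M.K)) (fun a ha => ?_)
        (Finset.finite_toSet _)).trans ?_
      · have := ((hφ M _).1 ha).2.2
        rw [FieldStructure.coord_withJet, heval] at this
        simpa [hp0] using this
      · rw [Set.ncard_coe_finset]
        exact (Multiset.toFinset_card_le _).trans
          ((Polynomial.card_roots' p).trans Polynomial.natDegree_map_le)
    · refine .inl fun M δ hG v u hu z hf => ?_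
      obtain ⟨a, haF, ha, haz⟩ := hG.exists_regularZero (hT.nhdAxioms hG.model) hl q
        (isJet_jetAsg δ v) hu hf z
      exact haF ⟨ha, haz⟩

/-- Lexicographic induction on order and degree. -/
theorem good_crit (hT : IsOpenTheory K₀ χ) (c : Σ l, Polynomial (LowJet L n l))
    (hc : 1 ≤ c.2.natDegree) (φ : Formula L.lang) :
    Good K₀ χ n fun M w => φ.Sat M.str w ∧ Crit M (M.coord w) c := by
  obtain ⟨l, q⟩ := c
  induction l using Nat.strong_induction_on generalizing φ with
  | _ l ihl =>
  induction hd : q.natDegree using Nat.strong_induction_on generalizing q φ with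
  | _ d ihd =>
  refine Good.of_crit hT q hc (fun c hc1 hc2 φ' => ?_) φ
  obtain ⟨l', q'⟩ := c
  rcases hc2 with h | ⟨h, h'⟩
  · exact ihl l' h φ' q' hc1
  · obtain rfl : l' = l := h
    exact ihd _ (hd ▸ h') φ' q' hc1 rfl

/-- Away from the critical polynomials the equations of `φ` that hold at a jet hold identically in
the jets of `xₙ`. Only open conditions restrict the jet, so `H` is trivial and density of jets
suffices. -/
theorem good_formula (hT : IsOpenTheory K₀ χ) (φ : Formula L.lang) :
    Good K₀ χ n fun M w => φ.Sat M.str w := by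
  obtain ⟨D, hD⟩ := hT.exists_form φ
  obtain ⟨m₁, hm₁⟩ := exists_jetBound_list n D Prod.snd
  obtain ⟨𝒬, h𝒬, h𝒬'⟩ := exists_list_of_forall (D.flatMap Prod.fst)
    (q := fun c : Σ l, Polynomial (LowJet L n l) => 1 ≤ c.2.natDegree)
    (p := fun P s => ∀ (M : FieldStructure L) (Y : ℕ → M.K), M.ev Y P = 0 →
        (∃ c ∈ s, Crit M Y c) ∨ ∀ Y', AgreeOff n Y Y' → M.ev Y' P = 0)
    (fun P hP => by
      obtain ⟨l, hl⟩ := JetPoly.exists_mem_lt n P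
      obtain ⟨𝒬, h, h'⟩ := exists_crit_of_lt l P hl
      exact ⟨𝒬, fun c hc => (h c hc).1, h'⟩)
    (fun P s s' hs h M Y h1 => (h M Y h1).imp (fun ⟨c, hc, h⟩ => ⟨c, hs hc, h⟩) id)
  refine Good.of_step (H := fun M Y => True) (Def.const True) m₁
    (fun M w => ∃ c ∈ 𝒬, Crit M (M.coord w) c)
    (Good.list _ (fun c M w => Crit M (M.coord w) c) _ fun c hc => good_crit hT c (h𝒬 c hc) φ)
    ?_ (fun _ _ _ _ _ _ => trivial) ?_ (.inl ?_)
  · intro M hM w hw hCw hH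
    refine exists_near_sat (H := fun Y => True) (hT.nhdAxioms hM) (hD M hM).1
      (hD M hM).2 (hm₁ _ (by omega)) hw fun c hc P hP hPw u' hu' => ?_
    refine (h𝒬' P (List.mem_flatMap.2 ⟨c, hc, hP⟩) M (M.coord w) hPw).resolve_left hCw _ ?_
    intro j hj
    rw [setJet_of_ne _ _ hj]
  all_goals
    intro M δ hG v u _ z
    have key : ∀ F : Set M.K, F.Finite → ∃ a, a ∉ F ∧ ∀ k ≤ m₁, δ^[k] a - u k ∈ M.nhd χ z := by
      intro F hF
      -- Density is obtained from solutions of `δ^[m₁ + 1] a = 0`: the jet of order `m₁ + 1` is set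
      -- to `0`, and those up to order `m₁` are arbitrary.
      have hreg : RegularZero M (setJet n (Function.update u (m₁ + 1) 0)
          (M.coord (jetAsg δ v))) (Polynomial.X : Polynomial (LowJet L n (m₁ + 1))) 0 := by
        refine ⟨fun k hk => ?_, ?_, ?_⟩
        · obtain rfl : k = 0 := by simpa using hk
          simp
        · simp
        · simp
      obtain ⟨a, haF, -, haz⟩ := hG.exists_regularZero (hT.nhdAxioms hG.model)
        (Nat.le_add_left 1 _) _ (isJet_jetAsg δ v) hreg hF z
      refine ⟨a, haF, fun k hk => ?_⟩
      have := haz k (by omega)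
      rwa [Function.update_of_ne (by omega)] at this
  · obtain ⟨a, -, ha⟩ := key ∅ Set.finite_empty
    exact ⟨a, trivial, ha⟩
  · intro hf
    obtain ⟨a, haF, ha⟩ := key _ hf
    exact haF ⟨trivial, ha⟩

end Eliminate

end TopFieldDer

namespace TopFieldDer

/-! Quantifier elimination relative to the theory without the derivation. -/

section Delta

variable {L : FieldLanguage.{u}} {K₀ : FieldStructure L} {χ : Formula L.lang}

/-- A term of the field sort has a derivative on jets. -/
def HasJetDeriv : ∀ {s : Option L.Aux}, Term L.lang s → Prop
  | none, t => ∃ t' : Term L.lang none, ∀ (M : FieldStructure L) (δ : Derivation ℤ M.K M.K),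
      (∀ c, δ (M.const c) = 0) → ∀ v : M.str.Assignment, IsJet δ (M.coord v) →
        δ (show M.K from t.eval M.str v) = t'.eval M.str v
  | some _, _ => True

theorem hasJetDeriv {s : L.lang.Sorts} (t : Term L.lang s) : HasJetDeriv t := by
  induction t with
  | var s n =>
    rcases s with _ | a
    · refine ⟨.var (L := L.lang) none (Nat.pair (Nat.unpair n).1 ((Nat.unpair n).2 + 1)),
        fun M δ _ v hv => ?_⟩
      have := hv (Nat.unpair n).1 (Nat.unpair n).2
      rw [Nat.pair_unpair] at this
      exact this
    · trivial
  | app f t ih =>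
    cases f with
    | zero => exact ⟨.zero, fun M δ _ v _ => map_zero δ⟩
    | one => exact ⟨.zero, fun M δ _ v _ => δ.map_one_eq_zero⟩
    | add =>
      obtain ⟨t₀, h₀⟩ := ih (0 : Fin 2)
      obtain ⟨t₁, h₁⟩ := ih (1 : Fin 2)
      refine ⟨t₀.add t₁, fun M δ hc v hv => ?_⟩
      rw [Term.eval_add]
      exact (map_add δ _ _).trans (congrArg₂ (· + ·) (h₀ M δ hc v hv) (h₁ M δ hc v hv))
    | mul =>
      obtain ⟨t₀, h₀⟩ := ih (0 : Fin 2)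
      obtain ⟨t₁, h₁⟩ := ih (1 : Fin 2)
      refine ⟨((t (0 : Fin 2)).mul t₁).add ((t (1 : Fin 2)).mul t₀), fun M δ hc v hv => ?_⟩
      exact (δ.leibniz _ _).trans (congrArg₂ (· + ·)
        (congrArg (_ * ·) (h₁ M δ hc v hv)) (congrArg (_ * ·) (h₀ M δ hc v hv)))
    | neg =>
      obtain ⟨t₀, h₀⟩ := ih (0 : Fin 1)
      refine ⟨t₀.neg, fun M δ hc v hv => ?_⟩
      exact (map_neg δ _).trans (congrArg (- ·) (h₀ M δ hc v hv))
    | inv =>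
      obtain ⟨t₀, h₀⟩ := ih (0 : Fin 1)
      refine ⟨(((t (0 : Fin 1)).inv.mul (t (0 : Fin 1)).inv).mul t₀).neg, fun M δ hc v hv => ?_⟩
      refine (δ.leibniz_inv _).trans ?_
      rw [h₀ M δ hc v hv]
      simp [sq, smul_eq_mul]
    | const c => exact ⟨.zero, fun M δ hc v _ => hc c⟩
    | aux f => trivial

/-- The rules for derivatives of sums, products and inverses push `δ` down to the variables, where
it raises the order of the jet by one. -/
theorem exists_term_jet {s : L.deltaLang.Sorts} (t : Term L.deltaLang s) :
    ∃ t' : Term L.lang (show L.lang.Sorts from s), ∀ (M : FieldStructure L)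
      (δ : Derivation ℤ M.K M.K),
      (∀ c, δ (M.const c) = 0) → ∀ v : M.str.Assignment,
        t.eval (M.deltaStr δ) v = t'.eval M.str (jetAsg δ v) := by
  induction t with
  | var s n =>
    rcases s with _ | a
    · refine ⟨.var (L := L.lang) none (Nat.pair n 0), fun M δ _ v => ?_⟩
      refine Eq.trans ?_ (jetAsg_none δ v _).symm
      rw [Nat.unpair_pair]
      rfl
    · exact ⟨.var (L := L.lang) (some a) n, fun M δ _ v => rfl⟩
  | app f t ih =>
    choose t' ht' using ih
    cases f with
    | base f =>
      exact ⟨.app (L := L.lang) f t', fun M δ hc v =>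
        congrArg (M.interp f) (funext fun i => ht' i M δ hc v)⟩
    | delta =>
      obtain ⟨t'', h⟩ := hasJetDeriv (t' (0 : Fin 1))
      exact ⟨t'', fun M δ hc v => (congrArg δ (ht' (0 : Fin 1) M δ hc v)).trans
        (h M δ hc _ (isJet_jetAsg δ v))⟩

theorem jetAsg_assign_aux {M : FieldStructure L} (δ : Derivation ℤ M.K M.K)
    (v : M.str.Assignment) (a : L.Aux) (n : ℕ) (x : M.aux a) :
    jetAsg δ (M.str.assign v (some a) n x) = M.str.assign (jetAsg δ v) (some a) n x := by
  funext y
  rcases y with ⟨_ | b, j⟩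
  · refine Eq.trans ?_ (Structure.assign_of_ne (M := M.str) _ _ (by simp)).symm
    refine (jetAsg_none δ _ j).trans (Eq.trans ?_ (jetAsg_none δ v j).symm)
    exact congrArg _ (Structure.assign_of_ne (M := M.str) _ _ (by simp))
  · by_cases h : ((some b, j) : Option L.Aux × ℕ) = (some a, n)
    · obtain ⟨h1, rfl⟩ := Prod.mk.inj h
      obtain rfl := Option.some.inj h1
      refine Eq.trans ?_ (Structure.assign_self (M := M.str) _ _ _ _).symm
      exact Structure.assign_self (M := M.str) v _ _ _
    · refine Eq.trans ?_ (Structure.assign_of_ne (M := M.str) _ _ h).symm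
      exact Structure.assign_of_ne (M := M.str) v _ h

theorem jetSolutions_sat {M : FieldStructure L} (δ : Derivation ℤ M.K M.K)
    {φ : Formula L.deltaLang} {ψ : Formula L.lang}
    (h : ∀ v : M.str.Assignment, φ.Sat (M.deltaStr δ) v ↔ ψ.Sat M.str (jetAsg δ v))
    (v : M.str.Assignment) (n : ℕ) :
    (M.deltaStr δ).solutions φ v none n = jetSolutions (fun w => ψ.Sat M.str w) δ v n := by
  ext a
  refine (h (M.str.assign v none n a)).trans ?_
  rw [jetAsg_assign]
  rfl

/-- Quantifiers over auxiliary sorts commute with passing to jets. A universal field quantifier is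
removed by applying `good_formula` to the negation. -/
theorem exists_formula_jet (hT : IsOpenTheory K₀ χ) (φ : Formula L.deltaLang) :
    ∃ ψ : Formula L.lang, ∀ (M : FieldStructure L) (δ : Derivation ℤ M.K M.K),
      IsGenericDerivation K₀ χ M δ → ∀ v : M.str.Assignment,
        φ.Sat (M.deltaStr δ) v ↔ ψ.Sat M.str (jetAsg δ v) := by
  induction φ with
  | falsum => exact ⟨.falsum, fun _ _ _ _ => Iff.rfl⟩
  | eq t t' =>
    obtain ⟨s, hs⟩ := exists_term_jet t
    obtain ⟨s', hs'⟩ := exists_term_jet t'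
    refine ⟨.eq s s', fun M δ hG v => ?_⟩
    exact iff_of_eq (congrArg₂ Eq (hs M δ hG.const v) (hs' M δ hG.const v))
  | rel r t =>
    choose t' ht' using fun i => exists_term_jet (t i)
    refine ⟨.rel (L := L.lang) r t', fun M δ hG v => ?_⟩
    exact iff_of_eq (congrArg (M.rl r) (funext fun i => ht' i M δ hG.const v))
  | imp φ φ' ih ih' =>
    obtain ⟨ψ, h⟩ := ih
    obtain ⟨ψ', h'⟩ := ih'
    exact ⟨ψ.imp ψ', fun M δ hG v => imp_congr (h M δ hG v) (h' M δ hG v)⟩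
  | all s n φ ih =>
    obtain ⟨ψ, h⟩ := ih
    rcases s with _ | a
    · obtain ⟨ψ', N, h'⟩ := good_formula (n := n) hT ψ.neg
      refine ⟨ψ'.neg, fun M δ hG v => ?_⟩
      rw [Formula.sat_neg, ← (h' M δ hG v).1, Set.not_nonempty_iff_eq_empty,
        Set.eq_empty_iff_forall_notMem]
      refine forall_congr' fun x => ?_
      refine (h M δ hG (M.str.assign v none n x)).trans ?_
      rw [jetAsg_assign]
      exact Iff.symm ((not_congr Formula.sat_neg).trans not_not)
    · refine ⟨.all (L := L.lang) (some a) n ψ, fun M δ hG v => forall_congr' fun x => ?_⟩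
      refine (h M δ hG (M.str.assign v (some a) n x)).trans ?_
      rw [jetAsg_assign_aux]

theorem IsOpenTheory.eliminatesExistsInfinity_tDeltaStar (hT : IsOpenTheory K₀ χ) :
    EliminatesExistsInfinity (none : L.deltaLang.Sorts) (TDeltaStar K₀ χ) := by
  intro φ n
  obtain ⟨ψ, hψ⟩ := exists_formula_jet hT φ
  obtain ⟨_, N, hN⟩ := good_formula (n := n) hT ψ
  refine ⟨N, ?_⟩
  rintro _ ⟨M, δ, rfl, hM, hc, hDL⟩ v
  have hG : IsGenericDerivation K₀ χ M δ := ⟨hM, hc, hDL⟩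
  rw [jetSolutions_sat δ (hψ M δ hG) v n]
  exact (hN M δ hG v).2

end Delta

end TopFieldDer

namespace TopFieldDer

/-! Translations between languages with the same sorts. -/

section Translation

variable {S : Type u} {F F' : List S → S → Type u} {R R' : List S → Type u} {ι : Type*}
  {c : ι → S → Type u} {ne : ∀ i s, Nonempty (c i s)}
  {fn : ∀ i, ∀ {d : List S} {s : S}, F d s → (∀ j : Fin d.length, c i (d.get j)) → c i s}
  {fn' : ∀ i, ∀ {d : List S} {s : S}, F' d s → (∀ j : Fin d.length, c i (d.get j)) → c i s}
  {rl : ∀ i, ∀ {d : List S}, R d → (∀ j : Fin d.length, c i (d.get j)) → Prop}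
  {rl' : ∀ i, ∀ {d : List S}, R' d → (∀ j : Fin d.length, c i (d.get j)) → Prop}

theorem Term.exists_translation (g : ∀ {d : List S} {s : S}, F d s → F' d s)
    (hfn : ∀ i (d : List S) (s : S) (f : F d s) t, fn' i (g f) t = fn i f t)
    {s : Language.Sorts ⟨S, F, R⟩} (t : Term ⟨S, F, R⟩ s) :
    ∃ t' : Term ⟨S, F', R'⟩ (show S from s), ∀ i v,
      t'.eval ⟨c i, ne i, fn' i, rl' i⟩ v = t.eval ⟨c i, ne i, fn i, rl i⟩ v := by
  induction t with
  | var s n => exact ⟨.var (L := ⟨S, F', R'⟩) s n, fun _ _ => rfl⟩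
  | app f t ih =>
    choose t' ht' using ih
    exact ⟨.app (L := ⟨S, F', R'⟩) (g f) t', fun i v =>
      (hfn i _ _ f _).trans (congrArg (fn i f) (funext fun j => ht' j i v))⟩

/-- The structures share their carriers, so quantifiers translate verbatim; only atomic relations
may turn into proper formulas. -/
theorem Formula.exists_translation (g : ∀ {d : List S} {s : S}, F d s → F' d s)
    (hfn : ∀ i (d : List S) (s : S) (f : F d s) t, fn' i (g f) t = fn i f t)
    (hrl : ∀ (d : List S) (r : R d) (t : ∀ j : Fin d.length, Term ⟨S, F', R'⟩ (d.get j)),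
      ∃ φ : Formula ⟨S, F', R'⟩, ∀ i v, φ.Sat ⟨c i, ne i, fn' i, rl' i⟩ v ↔
        rl i r fun j => (t j).eval ⟨c i, ne i, fn' i, rl' i⟩ v)
    (φ : Formula ⟨S, F, R⟩) : ∃ φ' : Formula ⟨S, F', R'⟩, ∀ i v,
      φ'.Sat ⟨c i, ne i, fn' i, rl' i⟩ v ↔ φ.Sat ⟨c i, ne i, fn i, rl i⟩ v := by
  induction φ with
  | falsum => exact ⟨.falsum, fun _ _ => Iff.rfl⟩
  | eq t t' =>
    obtain ⟨s, hs⟩ := Term.exists_translation (R' := R') (ne := ne) (rl := rl) (rl' := rl') g hfn t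
    obtain ⟨s', hs'⟩ :=
      Term.exists_translation (R' := R') (ne := ne) (rl := rl) (rl' := rl') g hfn t'
    exact ⟨.eq s s', fun i v => iff_of_eq (congrArg₂ Eq (hs i v) (hs' i v))⟩
  | rel r t =>
    choose t' ht' using fun j =>
      Term.exists_translation (R' := R') (ne := ne) (rl := rl) (rl' := rl') g hfn (t j)
    obtain ⟨φ, hφ⟩ := hrl _ r t'
    exact ⟨φ, fun i v => (hφ i v).trans
      (iff_of_eq (congrArg (rl i r) (funext fun j => ht' j i v)))⟩
  | imp φ ψ ih ih' =>
    obtain ⟨φ', h⟩ := ih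
    obtain ⟨ψ', h'⟩ := ih'
    exact ⟨φ'.imp ψ', fun i v => imp_congr (h i v) (h' i v)⟩
  | all s n φ ih =>
    obtain ⟨φ', h⟩ := ih
    exact ⟨.all (L := ⟨S, F', R'⟩) s n φ', fun i v => forall_congr' fun a => h i _⟩

end Translation

/-! ### Translations between the languages `L`, `L_δ` and `L_P` -/

section Pairs

variable {L : FieldLanguage.{u}}

/-- The family of all pairs. -/
abbrev pairFam (L : FieldLanguage.{u}) :
    (Σ M : FieldStructure L, Set M.K) → Structure L.pairLang := fun p => p.1.pairStr p.2

theorem Formula.exists_lift (φ : Formula L.lang) : ∃ φ' : Formula L.pairLang,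
    ∀ (M : FieldStructure L) (P : Set M.K) (v : M.str.Assignment),
      φ'.Sat (M.pairStr P) v ↔ φ.Sat M.str v := by
  obtain ⟨φ', h⟩ := Formula.exists_translation (ι := Σ M : FieldStructure L, Set M.K)
    (R' := L.PairRel) (c := fun p => p.1.carrier) (ne := fun p => p.1.carrier_nonempty)
    (fn := fun p => p.1.interp) (fn' := fun p => p.1.interp) (rl := fun p => p.1.rl)
    (rl' := fun p => p.1.interpPair p.2) id (fun _ _ _ _ _ => rfl)
    (fun d r t => ⟨.rel (L := L.pairLang) (.base r) t, fun _ _ => Iff.rfl⟩) φ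
  exact ⟨φ', fun M P v => h ⟨M, P⟩ v⟩

/-- The predicate `P` can be replaced by the kernel of the derivation. -/
theorem Formula.exists_delta (φ : Formula L.pairLang) : ∃ φ' : Formula L.deltaLang,
    ∀ (M : FieldStructure L) (δ : M.K → M.K) (v : M.str.Assignment),
      φ'.Sat (M.deltaStr δ) v ↔ φ.Sat (M.pairStr {x | δ x = 0}) v := by
  obtain ⟨φ', h⟩ := Formula.exists_translation (ι := Σ M : FieldStructure L, M.K → M.K)
    (F' := L.DeltaFun) (R' := L.Rel) (c := fun p => p.1.carrier)
    (ne := fun p => p.1.carrier_nonempty)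
    (fn := fun p => p.1.interp) (fn' := fun p => p.1.interpDelta p.2)
    (rl := fun p => p.1.interpPair {x | p.2 x = 0})
    (rl' := fun p => p.1.rl) .base (fun _ _ _ _ _ => rfl)
    (fun d r t => by
      cases r with
      | base r => exact ⟨.rel (L := L.deltaLang) r t, fun _ _ => Iff.rfl⟩
      | pred =>
        exact ⟨.eq (.app (L := L.deltaLang) .delta t)
          (.app (L := L.deltaLang) (.base .zero) fun i => i.elim0), fun _ _ => Iff.rfl⟩) φ
  exact ⟨φ', fun M P v => h ⟨M, P⟩ v⟩

theorem Formula.exists_univ (φ : Formula L.pairLang) : ∃ φ' : Formula L.lang,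
    ∀ (M : FieldStructure L) (v : M.str.Assignment),
      φ'.Sat M.str v ↔ φ.Sat (M.pairStr Set.univ) v := by
  obtain ⟨φ', h⟩ := Formula.exists_translation (ι := FieldStructure L)
    (R' := L.Rel) (c := fun p => p.carrier) (ne := fun p => p.carrier_nonempty)
    (fn := fun p => p.interp) (fn' := fun p => p.interp)
    (rl := fun p => p.interpPair Set.univ) (rl' := fun p => p.rl) id (fun _ _ _ _ _ => rfl)
    (fun d r t => by
      cases r with
      | base r => exact ⟨.rel (L := L.lang) r t, fun _ _ => Iff.rfl⟩
      | pred => exact ⟨.imp .falsum .falsum, fun _ _ => ⟨fun _ => trivial, fun _ => id⟩⟩) φ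
  exact ⟨φ', h⟩

theorem Def.lift {R : ∀ M : FieldStructure L, M.str.Assignment → Prop}
    (hR : Def (fieldStr L) R) : Def (pairFam L) fun p v => R p.1 v := by
  obtain ⟨φ, hφ⟩ := hR
  obtain ⟨φ', h⟩ := φ.exists_lift
  exact ⟨φ', fun p v => (h p.1 p.2 v).trans (hφ p.1 v)⟩

theorem TermMap.select {Λ : Language.{u}} {ι : Type*} {str : ι → Structure Λ} (j n : ℕ → ℕ) :
    TermMap str fun _ vs x => vs (j x.2) (x.1, n x.2) :=
  fun x => ⟨.var x.1 (Nat.pair (j x.2) (n x.2)), fun i vs => by simp⟩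

theorem Def.pred (n : ℕ) :
    Def (pairFam L) fun p v => p.1.coord v n ∈ p.2 :=
  ⟨.rel (L := L.pairLang) (.pred) fun | ⟨0, _⟩ => .var (L := L.pairLang) none n,
    fun _ _ => Iff.rfl⟩

end Pairs

end TopFieldDer

namespace TopFieldDer

/-! Ultrapowers of pairs, for one-sorted languages. -/

section Ultrapower

variable {L : FieldLanguage.{u}} [IsEmpty L.Aux] (M : FieldStructure L) {I : Type u}
  (U : Ultrafilter I)

/-- Representatives of the elements of an ultrapower. -/
noncomputable def FieldStructure.rep : ∀ {s : Option L.Aux},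
    sortCarrier (Germ (U : Filter I) M.K) (fun _ : L.Aux => PUnit) s → I → M.carrier s
  | none, x => Quotient.out (s := germSetoid (U : Filter I) M.K) x
  | some a, _ => isEmptyElim a

/-- The ultrapower. -/
noncomputable def FieldStructure.ultrapower : FieldStructure L where
  K := Germ (U : Filter I) M.K
  field := inferInstance
  const c := ((fun _ => M.const c : I → M.K) : Germ (U : Filter I) M.K)
  aux _ := PUnit
  aux_nonempty _ := inferInstance
  auxFn {_ a} _ _ := isEmptyElim a
  rl r t := ∀ᶠ i in U, M.rl r fun j => M.rep U (t j) i

/-- The predicate of the ultrapower. -/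
def FieldStructure.ultraPred (P : Set M.K) : Set (M.ultrapower U).K :=
  {x | ∀ᶠ i in U, (show M.K from M.rep U (s := none) x i) ∈ P}

/-- The class of a family. -/
def FieldStructure.germ : ∀ {s : Option L.Aux}, (I → M.carrier s) → (M.ultrapower U).carrier s
  | none, f => ((show I → M.K from f : I → M.K) : Germ (U : Filter I) M.K)
  | some a, _ => isEmptyElim a

theorem FieldStructure.rep_germ {s : Option L.Aux} (f : I → M.carrier s) :
    ∀ᶠ i in U, M.rep U (M.germ U f) i = f i := by
  rcases s with _ | a
  · exact Quotient.exact (s := germSetoid (U : Filter I) M.K)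
      (Quotient.out_eq (s := germSetoid (U : Filter I) M.K) _)
  · exact (IsEmpty.false a).elim

theorem FieldStructure.germ_eq_germ {s : Option L.Aux} {f g : I → M.carrier s} :
    M.germ U f = M.germ U g ↔ ∀ᶠ i in U, f i = g i := by
  rcases s with _ | a
  · exact Germ.coe_eq
  · exact (IsEmpty.false a).elim

theorem FieldStructure.exists_germ {s : Option L.Aux} (x : (M.ultrapower U).carrier s) :
    ∃ f, M.germ U f = x := by
  rcases s with _ | a
  · exact ⟨_, Quotient.out_eq (s := germSetoid (U : Filter I) M.K) x⟩
  · exact (IsEmpty.false a).elim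

/-- The assignment given by a family of assignments. -/
def FieldStructure.mkAssign (V : I → M.str.Assignment) : (M.ultrapower U).str.Assignment :=
  fun x => M.germ U fun i => V i x

variable (P : Set M.K)

theorem Term.eval_ultrapower {s : L.pairLang.Sorts} (t : Term L.pairLang s)
    (V : I → M.str.Assignment) :
    t.eval ((M.ultrapower U).pairStr (M.ultraPred U P)) (M.mkAssign U V) =
      M.germ U fun i => t.eval (M.pairStr P) (V i) := by
  induction t with
  | var s n => rfl
  | app f t ih =>
    have h : Term.eval ((M.ultrapower U).pairStr (M.ultraPred U P)) (M.mkAssign U V) (.app f t) =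
      (M.ultrapower U).interp f fun j => M.germ U fun i => (t j).eval (M.pairStr P) (V i) :=
      congrArg ((M.ultrapower U).interp f) (funext ih)
    rw [h]
    cases f with
    | @aux _ a f => exact (IsEmpty.false a).elim
    | _ => rfl

theorem FieldStructure.mkAssign_assign (V : I → M.str.Assignment) (s : Option L.Aux) (n : ℕ)
    (f : I → M.carrier s) :
    (M.ultrapower U).str.assign (M.mkAssign U V) s n (M.germ U f) =
      M.mkAssign U fun i => M.str.assign (V i) s n (f i) := by
  funext x
  by_cases hx : x = (s, n)
  · subst hx
    refine (Structure.assign_self (M := (M.ultrapower U).str) _ _ _ _).trans ?_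
    exact congrArg (M.germ U) (funext fun i =>
      (Structure.assign_self (M := M.str) (V i) s n (f i)).symm)
  · refine (Structure.assign_of_ne (M := (M.ultrapower U).str) _ _ hx).trans ?_
    exact congrArg (M.germ U) (funext fun i =>
      (Structure.assign_of_ne (M := M.str) (V i) (f i) hx).symm)

/-- Łoś's theorem. In the quantifier case counterexamples chosen coordinatewise form a germ which
refutes the universal statement. -/
theorem Formula.sat_ultrapower (φ : Formula L.pairLang) (V : I → M.str.Assignment) :
    φ.Sat ((M.ultrapower U).pairStr (M.ultraPred U P)) (M.mkAssign U V) ↔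
      ∀ᶠ i in U, φ.Sat (M.pairStr P) (V i) := by
  induction φ generalizing V with
  | falsum => exact ⟨False.elim, fun h => h.exists.elim fun _ h => h⟩
  | eq t t' =>
    refine (iff_of_eq (congrArg₂ Eq (t.eval_ultrapower M U P V) (t'.eval_ultrapower M U P V))).trans
      ?_
    exact M.germ_eq_germ U
  | rel r t =>
    have h : (Formula.rel r t).Sat ((M.ultrapower U).pairStr (M.ultraPred U P)) (M.mkAssign U V) ↔
      (M.ultrapower U).interpPair (M.ultraPred U P) r
        fun j => M.germ U fun i => (t j).eval (M.pairStr P) (V i) :=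
      iff_of_eq (congrArg ((M.ultrapower U).interpPair (M.ultraPred U P) r)
        (funext fun j => (t j).eval_ultrapower M U P V))
    rw [h]
    have hall : ∀ᶠ i in U, ∀ j, M.rep U (M.germ U fun i => (t j).eval (M.pairStr P) (V i)) i =
        (t j).eval (M.pairStr P) (V i) := eventually_all.2 fun j => M.rep_germ U _
    cases r with
    | base r =>
      refine eventually_congr (hall.mono fun i hi => ?_)
      exact iff_of_eq (congrArg (M.rl r) (funext hi))
    | pred =>
      refine eventually_congr (hall.mono fun i hi => ?_)
      exact iff_of_eq (congrArg (· ∈ P) (hi (0 : Fin 1)))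
  | imp φ ψ ih ih' =>
    exact (imp_congr (ih V) (ih' V)).trans Ultrafilter.eventually_imp.symm
  | all s n φ ih =>
    have h : (Formula.all s n φ).Sat ((M.ultrapower U).pairStr (M.ultraPred U P)) (M.mkAssign U V) ↔
        ∀ f : I → M.carrier s, ∀ᶠ i in U, φ.Sat (M.pairStr P) (M.str.assign (V i) s n (f i)) := by
      constructor
      · intro h f
        have := h (M.germ U f)
        refine (ih _).1 ?_
        rw [← M.mkAssign_assign U V s n f]
        exact this
      · intro h x
        obtain ⟨f, rfl⟩ := M.exists_germ U x
        have := (ih _).2 (h f)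
        rw [← M.mkAssign_assign U V s n f] at this
        exact this
    rw [h]
    constructor
    · intro h
      by_contra hn
      rw [← Ultrafilter.eventually_not] at hn
      have : ∀ i, ∃ a, ¬ Formula.Sat (M.pairStr P) (V i) (.all s n φ) →
          ¬ φ.Sat (M.pairStr P) (M.str.assign (V i) s n a) := by
        intro i
        by_cases hi : Formula.Sat (M.pairStr P) (V i) (.all s n φ)
        · exact ⟨(M.carrier_nonempty s).some, fun h => absurd hi h⟩
        · obtain ⟨a, ha⟩ := not_forall.1 hi
          exact ⟨a, fun _ => ha⟩
      choose f hf using this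
      obtain ⟨i, h1, h2⟩ := (hn.and (h f)).exists
      exact hf i h1 h2
    · intro h f
      exact h.mono fun i hi => hi (f i)

end Ultrapower

/-! ### Elementary embeddings of pairs and compactness -/

section Elementary

variable {L : FieldLanguage.{u}} [IsEmpty L.Aux]

/-- The assignment given by the values of the field variables. -/
def FieldStructure.asg (M : FieldStructure L) (u : ℕ → M.K) : M.str.Assignment
  | (none, n) => u n
  | (some a, _) => isEmptyElim a

@[simp] theorem FieldStructure.asg_none (M : FieldStructure L) (u : ℕ → M.K) (n : ℕ) :
    M.asg u (none, n) = u n := rfl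

@[simp] theorem FieldStructure.coord_asg (M : FieldStructure L) (u : ℕ → M.K) :
    M.coord (M.asg u) = u := rfl

theorem FieldStructure.assign_asg (M : FieldStructure L) (u : ℕ → M.K) (n : ℕ) (a : M.K) :
    M.str.assign (M.asg u) none n a = M.asg (Function.update u n a) := by
  funext x
  rcases x with ⟨_ | b, k⟩
  · by_cases hk : k = n
    · subst hk
      exact (Structure.assign_self (M := M.str) _ _ _ _).trans (Function.update_self k a u).symm
    · refine (Structure.assign_of_ne (M := M.str) _ _ (by simpa using hk)).trans ?_
      exact (Function.update_of_ne hk a u).symm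
  · exact (IsEmpty.false b).elim

/-- An elementary embedding of pairs. -/
def IsElementary {M M' : FieldStructure L} (P : Set M.K) (P' : Set M'.K) (e : M.K → M'.K) : Prop :=
  ∀ (φ : Formula L.pairLang) (u : ℕ → M.K),
    φ.Sat (M.pairStr P) (M.asg u) ↔ φ.Sat (M'.pairStr P') (M'.asg (e ∘ u))

theorem IsElementary.refl {M : FieldStructure L} (P : Set M.K) : IsElementary P P id :=
  fun _ _ => Iff.rfl

theorem IsElementary.comp {M M' M'' : FieldStructure L} {P : Set M.K} {P' : Set M'.K}
    {P'' : Set M''.K} {e : M.K → M'.K} {e' : M'.K → M''.K} (h' : IsElementary P' P'' e')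
    (h : IsElementary P P' e) : IsElementary P P'' (e' ∘ e) :=
  fun φ u => (h φ u).trans (h' φ (e ∘ u))

theorem IsElementary.def_iff {M M' : FieldStructure L} {P : Set M.K} {P' : Set M'.K}
    {e : M.K → M'.K} (h : IsElementary P P' e)
    {R : ∀ p : Σ M : FieldStructure L, Set M.K, p.1.str.Assignment → Prop}
    (hR : Def (pairFam L) R) (u : ℕ → M.K) :
    R ⟨M, P⟩ (M.asg u) ↔ R ⟨M', P'⟩ (M'.asg (e ∘ u)) := by
  obtain ⟨φ, hφ⟩ := hR
  exact (hφ ⟨M, P⟩ (M.asg u)).symm.trans ((h φ u).trans (hφ ⟨M', P'⟩ (M'.asg (e ∘ u))))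

/-- Every finitely satisfiable set of conditions on one element can be realized in an elementary
extension. -/
theorem exists_realization (M : FieldStructure L) (P : Set M.K)
    (Γ : Set (Formula L.pairLang × (ℕ → M.K)))
    (hΓ : ∀ s : Finset Γ, ∃ a : M.K, ∀ p ∈ s,
      p.1.1.Sat (M.pairStr P) (M.asg (Function.update p.1.2 0 a))) :
    ∃ (M' : FieldStructure L) (P' : Set M'.K) (e : M.K → M'.K) (a : M'.K), IsElementary P P' e ∧
      ∀ p ∈ Γ, p.1.Sat (M'.pairStr P') (M'.asg (Function.update (e ∘ p.2) 0 a)) := by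
  -- For each condition `p` in `Γ`, almost every finite subset contains `p`. So the germ of the
  -- elements realizing the finite subsets realizes all of `Γ`.
  let U : Ultrafilter (Finset Γ) := Ultrafilter.of atTop
  choose f hf using hΓ
  have key : ∀ V : Finset Γ → ℕ → M.K, M.mkAssign U (fun i => M.asg (V i)) =
      (M.ultrapower U).asg fun n => M.germ U (s := none) fun i => V i n := by
    intro V
    funext x
    rcases x with ⟨_ | a, n⟩
    · rfl
    · exact (IsEmpty.false a).elim
  refine ⟨M.ultrapower U, M.ultraPred U P, fun x => M.germ U (s := none) fun _ => x,
    M.germ U (s := none) f, fun φ u => ?_, fun p hp => ?_⟩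
  · refine Iff.trans ?_ (iff_of_eq (congrArg (fun w => φ.Sat _ w) (key fun _ => u)))
    rw [Formula.sat_ultrapower]
    exact eventually_const.symm
  · have h : (fun n => M.germ U (s := none) fun i => Function.update p.2 0 (f i) n) =
        Function.update ((fun x => M.germ U (s := none) fun _ => x) ∘ p.2) 0
          (M.germ U (s := none) f) := by
      funext n
      by_cases hn : n = 0
      · subst hn; simp
      · simp [hn]
    rw [← h, ← key, Formula.sat_ultrapower]
    have : ∀ᶠ s : Finset Γ in U, (⟨p, hp⟩ : Γ) ∈ s :=
      Ultrafilter.of_le atTop ((eventually_ge_atTop {(⟨p, hp⟩ : Γ)}).mono fun s hs =>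
        hs (Finset.mem_singleton_self _))
    exact this.mono fun s hs => hf s _ hs

end Elementary

end TopFieldDer

namespace TopFieldDer

/-! Algebraic closure. -/

section Acl

variable {L : FieldLanguage.{u}} {M : FieldStructure L}

/-- `w 0` is a root of the polynomial `Q` in the `0`-th variable, which is not zero after
substitution of the other values. -/
def AlgWit (M : FieldStructure L) (Q : JetPoly L) (w : ℕ → M.K) : Prop :=
  M.ev w Q = 0 ∧ ∃ y, M.ev (Function.update w 0 y) Q ≠ 0

/-- Collecting the powers of the variable `0` gives a polynomial in one variable over the ring of
the other values. Its degree is bounded in terms of `Q` alone, whence the uniform bounds for numbers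
of roots. -/
theorem exists_slot_poly (Q : JetPoly L) : ∃ N, ∀ (M : FieldStructure L) (A : Subalgebra ℤ M.K)
    (w : ℕ → M.K), (∀ c, M.const c ∈ A) → (∀ k, k ≠ 0 → w k ∈ A) →
      ∃ p : Polynomial A, p.natDegree ≤ N ∧
        ∀ y, Polynomial.aeval y p = M.ev (Function.update w 0 y) Q := by
  induction Q using MvPolynomial.induction_on with
  | C c =>
    refine ⟨0, fun M A w hc _ => ?_⟩
    have h : MvPolynomial.aeval M.const c ∈ A := by
      have h : (MvPolynomial.aeval (R := ℤ) M.const).range ≤ A := by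
        rw [← Algebra.adjoin_range_eq_range_aeval]
        exact Algebra.adjoin_le (by rintro _ ⟨c, rfl⟩; exact hc c)
      exact h ⟨c, rfl⟩
    refine ⟨Polynomial.C ⟨_, h⟩, by simp, fun y => ?_⟩
    simp
  | add Q Q' ih ih' =>
    obtain ⟨N, ih⟩ := ih
    obtain ⟨N', ih'⟩ := ih'
    refine ⟨max N N', fun M A w hc hw => ?_⟩
    obtain ⟨p, hp, h⟩ := ih M A w hc hw
    obtain ⟨p', hp', h'⟩ := ih' M A w hc hw
    exact ⟨p + p', (Polynomial.natDegree_add_le _ _).trans (max_le_max hp hp'), fun y => by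
      rw [map_add, map_add, h, h']⟩
  | mul_X Q k ih =>
    obtain ⟨N, ih⟩ := ih
    refine ⟨N + 1, fun M A w hc hw => ?_⟩
    obtain ⟨p, hp, h⟩ := ih M A w hc hw
    by_cases hk : k = 0
    · subst hk
      refine ⟨p * Polynomial.X, Polynomial.natDegree_mul_le.trans ?_, fun y => ?_⟩
      · exact add_le_add hp Polynomial.natDegree_X_le
      · simp [h]
    · refine ⟨p * Polynomial.C ⟨w k, hw k hk⟩, Polynomial.natDegree_mul_le.trans ?_, fun y => ?_⟩
      · simp; omega
      · simp [h, hk]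

theorem AlgWit.isAlgebraic {Q : JetPoly L} {w : ℕ → M.K} (h : AlgWit M Q w)
    {A : Subalgebra ℤ M.K} (hc : ∀ c, M.const c ∈ A) (hw : ∀ k, k ≠ 0 → w k ∈ A) :
    IsAlgebraic A (w 0) := by
  obtain ⟨N, hN⟩ := exists_slot_poly Q
  obtain ⟨p, -, hp⟩ := hN M A w hc hw
  refine ⟨p, ?_, by rw [hp, Function.update_eq_self]; exact h.1⟩
  rintro rfl
  obtain ⟨y, hy⟩ := h.2
  exact hy (by rw [← hp, map_zero])

theorem exists_finite_roots (Q : JetPoly L) : ∃ N, ∀ (M : FieldStructure L) (w : ℕ → M.K),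
    {y | AlgWit M Q (Function.update w 0 y)}.Finite ∧
      {y | AlgWit M Q (Function.update w 0 y)}.ncard ≤ N := by
  classical
  obtain ⟨N, hN⟩ := exists_slot_poly Q
  refine ⟨N, fun M w => ?_⟩
  obtain ⟨p, hpN, hp⟩ := hN M ⊤ w (fun _ => Algebra.mem_top) fun _ _ => Algebra.mem_top
  have hsub : {y | AlgWit M Q (Function.update w 0 y)} ⊆
      ((p.map (algebraMap _ M.K)).roots.toFinset : Set M.K) := by
    rintro y ⟨h1, z, h2⟩
    rw [Function.update_idem, ← hp] at h2
    rw [← hp] at h1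
    have hp0 : p.map (algebraMap _ M.K) ≠ 0 := by
      intro h0
      rw [← Polynomial.eval_map_algebraMap, h0] at h2
      simp at h2
    simp only [Finset.mem_coe, Multiset.mem_toFinset, Polynomial.mem_roots hp0,
      Polynomial.IsRoot.def, Polynomial.eval_map_algebraMap, h1]
  refine ⟨(Finset.finite_toSet _).subset hsub,
    (Set.ncard_le_ncard hsub (Finset.finite_toSet _)).trans ?_⟩
  rw [Set.ncard_coe_finset]
  exact (Multiset.toFinset_card_le _).trans ((Polynomial.card_roots' _).trans
    (Polynomial.natDegree_map_le.trans hpN))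

/-- The elements algebraic over the ring generated by the constants and by `S`. -/
def FieldStructure.acl (M : FieldStructure L) (S : Set M.K) : Set M.K :=
  {x | IsAlgebraic (Algebra.adjoin ℤ (Set.range M.const ∪ S)) x}

/-- Transitivity and exchange for `acl` are taken over from the matroid of algebraic independence.
-/
theorem FieldStructure.acl_eq_closure [CharZero M.K] (S : Set M.K) :
    M.acl S = (AlgebraicIndependent.matroid ℤ M.K).closure (Set.range M.const ∪ S) := by
  rw [AlgebraicIndependent.matroid_closure_eq]
  rfl

theorem FieldStructure.subset_acl (S : Set M.K) : S ⊆ M.acl S := fun x hx =>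
  isAlgebraic_algebraMap
    (⟨x, Algebra.subset_adjoin (.inr hx)⟩ : Algebra.adjoin ℤ (Set.range M.const ∪ S))

theorem FieldStructure.acl_subset_acl [CharZero M.K] {S T : Set M.K} (h : S ⊆ M.acl T) :
    M.acl S ⊆ M.acl T := by
  rw [M.acl_eq_closure, M.acl_eq_closure]
  refine Matroid.closure_subset_closure_of_subset_closure (Set.union_subset ?_ ?_)
  · exact Set.subset_union_left.trans (Matroid.subset_closure _ _ (by simp))
  · rwa [← M.acl_eq_closure]

theorem FieldStructure.acl_mono [CharZero M.K] {S T : Set M.K} (h : S ⊆ T) : M.acl S ⊆ M.acl T :=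
  M.acl_subset_acl (h.trans (M.subset_acl T))

theorem FieldStructure.acl_exchange [CharZero M.K] {S : Set M.K} {x y : M.K}
    (h : x ∈ M.acl (insert y S)) (hx : x ∉ M.acl S) : y ∈ M.acl (insert x S) := by
  rw [M.acl_eq_closure, Set.union_insert] at h ⊢
  rw [M.acl_eq_closure] at hx
  exact (Matroid.closure_exchange ⟨h, hx⟩).1

/-- `f` is a polynomial function with coefficients from `S`. -/
def IsPolyFun (M : FieldStructure L) (S : Set M.K) (f : M.K → M.K) : Prop :=
  ∃ (Q : JetPoly L) (w : ℕ → M.K), (∀ k, k ≠ 0 → w k ∈ S) ∧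
    ∀ y, M.ev (Function.update w 0 y) Q = f y

theorem FieldStructure.ev_rename (w : ℕ → M.K) (σ : ℕ → ℕ) (Q : JetPoly L) :
    M.ev w (MvPolynomial.rename σ Q) = M.ev (w ∘ σ) Q :=
  MvPolynomial.eval₂Hom_rename _ _ _ _

theorem exists_merge (M : FieldStructure L) (S : Set M.K) (Q Q' : JetPoly L) (w w' : ℕ → M.K)
    (hw : ∀ k, k ≠ 0 → w k ∈ S) (hw' : ∀ k, k ≠ 0 → w' k ∈ S) :
    ∃ (Q₁ Q₁' : JetPoly L) (w₁ : ℕ → M.K), (∀ k, k ≠ 0 → w₁ k ∈ S) ∧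
      ∀ y, M.ev (Function.update w₁ 0 y) Q₁ = M.ev (Function.update w 0 y) Q ∧
        M.ev (Function.update w₁ 0 y) Q₁' = M.ev (Function.update w' 0 y) Q' := by
  -- The values of `w` go to even indices and those of `w'` to odd ones, the variable `0` being
  -- shared. Index `1` is used by neither polynomial; it receives `w 1`, since `w' 0` need not lie
  -- in `S`.
  refine ⟨MvPolynomial.rename (fun k => if k = 0 then 0 else 2 * k) Q,
    MvPolynomial.rename (fun k => if k = 0 then 0 else 2 * k + 1) Q',
    fun k => if k = 1 then w 1 else if k % 2 = 0 then w (k / 2) else w' (k / 2),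
    fun k hk => ?_, fun y => ?_⟩
  · by_cases h1 : k = 1
    · simpa [h1] using hw 1 (by simp)
    by_cases h2 : k % 2 = 0
    · simpa [h1, h2] using hw (k / 2) (by omega)
    · simpa [h1, h2] using hw' (k / 2) (by omega)
  · rw [FieldStructure.ev_rename, FieldStructure.ev_rename]
    constructor
    · congr 2
      funext k
      by_cases hk : k = 0
      · simp [hk]
      · have : 2 * k ≠ 1 := by omega
        simp [hk, this]
    · congr 2
      funext k
      by_cases hk : k = 0
      · simp [hk]
      · have h1 : (2 * k + 1) / 2 = k := by omega
        have h2 : (2 * k + 1) % 2 = 1 := by omega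
        simp [hk, h1, h2]

theorem IsPolyFun.add {S : Set M.K} {f g : M.K → M.K} (hf : IsPolyFun M S f)
    (hg : IsPolyFun M S g) : IsPolyFun M S fun y => f y + g y := by
  obtain ⟨Q, w, hw, h⟩ := hf
  obtain ⟨Q', w', hw', h'⟩ := hg
  obtain ⟨Q₁, Q₁', w₁, hw₁, h₁⟩ := exists_merge M S Q Q' w w' hw hw'
  exact ⟨Q₁ + Q₁', w₁, hw₁, fun y => by rw [map_add, (h₁ y).1, (h₁ y).2, h, h']⟩

theorem IsPolyFun.mul {S : Set M.K} {f g : M.K → M.K} (hf : IsPolyFun M S f)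
    (hg : IsPolyFun M S g) : IsPolyFun M S fun y => f y * g y := by
  obtain ⟨Q, w, hw, h⟩ := hf
  obtain ⟨Q', w', hw', h'⟩ := hg
  obtain ⟨Q₁, Q₁', w₁, hw₁, h₁⟩ := exists_merge M S Q Q' w w' hw hw'
  exact ⟨Q₁ * Q₁', w₁, hw₁, fun y => by rw [map_mul, (h₁ y).1, (h₁ y).2, h, h']⟩

theorem IsPolyFun.const_of_mem {S : Set M.K} (hS : S.Nonempty) {c : M.K}
    (hc : c ∈ Algebra.adjoin ℤ (Set.range M.const ∪ S)) : IsPolyFun M S fun _ => c := by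
  obtain ⟨s, hs⟩ := hS
  induction hc using Algebra.adjoin_induction with
  | mem c hc =>
    rcases hc with ⟨c, rfl⟩ | hc
    · exact ⟨MvPolynomial.C (MvPolynomial.X c), fun _ => s, fun _ _ => hs, fun y => by simp⟩
    · exact ⟨MvPolynomial.X 1, fun _ => c, fun _ _ => hc, fun y => by simp⟩
  | algebraMap z => exact ⟨algebraMap ℤ _ z, fun _ => s, fun _ _ => hs, fun y => by simp⟩
  | add c c' _ _ h h' => exact h.add h'
  | mul c c' _ _ h h' => exact h.mul h'

/-- An algebraic relation over the generated ring lifts to one polynomial over `ℤ[Ω]` with values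
from `S` inserted; its not being zero is witnessed by a point because the field is infinite. This
makes algebraicity expressible by formulas. -/
theorem FieldStructure.mem_acl_iff [CharZero M.K] {S : Set M.K} (hS : S.Nonempty) {x : M.K} :
    x ∈ M.acl S ↔ ∃ (Q : JetPoly L) (w : ℕ → M.K), w 0 = x ∧ (∀ k, k ≠ 0 → w k ∈ S) ∧
      AlgWit M Q w := by
  classical
  constructor
  · rintro ⟨p, hp0, hp⟩
    have : IsPolyFun M S fun y => Polynomial.aeval y p := by
      clear hp hp0
      induction p using Polynomial.induction_on' with
      | add p q hp hq => simpa using hp.add hq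
      | monomial n c =>
        simp only [Polynomial.aeval_monomial]
        refine (IsPolyFun.const_of_mem hS c.2).mul ?_
        obtain ⟨s, hs⟩ := hS
        exact ⟨MvPolynomial.X 0 ^ n, fun _ => s, fun _ _ => hs, fun y => by simp⟩
    obtain ⟨Q, w, hw, h⟩ := this
    refine ⟨Q, Function.update w 0 x, by simp, fun k hk => by simpa [hk] using hw k hk,
      (h x).trans hp, ?_⟩
    have hp1 : p.map (algebraMap _ M.K) ≠ 0 :=
      (Polynomial.map_ne_zero_iff Subtype.val_injective).2 hp0
    obtain ⟨y, hy⟩ := Infinite.exists_notMem_finset (p.map (algebraMap _ M.K)).roots.toFinset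
    refine ⟨y, fun h0 => hy ?_⟩
    rw [Function.update_idem, h] at h0
    simpa [hp1] using h0
  · rintro ⟨Q, w, rfl, hw, h⟩
    exact h.isAlgebraic (fun c => Algebra.subset_adjoin (.inl ⟨c, rfl⟩))
      fun k hk => Algebra.subset_adjoin (.inr (hw k hk))

theorem FieldStructure.exists_finite_of_mem_acl [CharZero M.K] {S : Set M.K} (hS : S.Nonempty)
    {x : M.K} (hx : x ∈ M.acl S) : ∃ Z : Finset M.K, (Z : Set M.K) ⊆ S ∧ x ∈ M.acl Z := by
  classical
  obtain ⟨Q, w, rfl, hw, h⟩ := (M.mem_acl_iff hS).1 hx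
  refine ⟨(Q.vars.erase 0).image w, ?_, ?_⟩
  · intro y hy
    obtain ⟨k, hk, rfl⟩ := Finset.mem_image.1 (Finset.mem_coe.1 hy)
    exact hw k (Finset.mem_erase.1 hk).1
  · set A := Algebra.adjoin ℤ (Set.range M.const ∪ ((Q.vars.erase 0).image w : Finset M.K))
    -- Unused variables get the value `0`, which lies in `A` even if no element of `S` is involved.
    set w' : ℕ → M.K := fun k => if k ∈ Q.vars ∨ k = 0 then w k else 0 with hw'
    have hev : ∀ y, M.ev (Function.update w' 0 y) Q = M.ev (Function.update w 0 y) Q := by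
      intro y
      refine MvPolynomial.eval₂Hom_congr' rfl (fun k hk _ => ?_) rfl
      by_cases h0 : k = 0
      · simp [h0]
      · simp [h0, hw', hk]
    have : AlgWit M Q w' := by
      refine ⟨?_, ?_⟩
      · have h1 := hev (w 0)
        rw [Function.update_eq_self, h.1] at h1
        rwa [show w 0 = w' 0 by simp [hw'], Function.update_eq_self] at h1
      · obtain ⟨y, hy⟩ := h.2
        exact ⟨y, by rwa [hev]⟩
    have h1 := this.isAlgebraic (A := A) (fun c => Algebra.subset_adjoin (.inl ⟨c, rfl⟩)) ?_
    · rwa [show w 0 = w' 0 by simp [hw']]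
    · intro k hk
      by_cases hkv : k ∈ Q.vars
      · have : w k ∈ A := Algebra.subset_adjoin (.inr (Finset.mem_coe.2
          (Finset.mem_image_of_mem w (Finset.mem_erase.2 ⟨hk, hkv⟩))))
        simpa [hw', hkv] using this
      · simp [hw', hkv, hk]

theorem AlgWit.congr {Q : JetPoly L} {w w' : ℕ → M.K} (h : ∀ k ∈ insert 0 Q.vars, w k = w' k) :
    AlgWit M Q w ↔ AlgWit M Q w' := by
  have h1 : M.ev w Q = M.ev w' Q :=
    MvPolynomial.eval₂Hom_congr' rfl (fun k hk _ => h k (by simp [hk])) rfl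
  have h2 : ∀ y, M.ev (Function.update w 0 y) Q = M.ev (Function.update w' 0 y) Q := fun y =>
    MvPolynomial.eval₂Hom_congr' rfl (fun k hk _ => by
      by_cases h0 : k = 0
      · simp [h0]
      · simp [h0, h k (by simp [hk])]) rfl
  simp only [AlgWit, h1, h2]

theorem FieldStructure.coord_assign (v : M.str.Assignment) (n : ℕ) (a : M.K) :
    M.coord (M.str.assign v none n a) = Function.update (M.coord v) n a := by
  funext k
  by_cases hk : k = n
  · subst hk
    exact (Structure.assign_self (M := M.str) _ _ _ _).trans
      (Function.update_self k a (M.coord v)).symm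
  · rw [Function.update_of_ne hk]
    exact Structure.assign_of_ne (M := M.str) _ _ (by simpa using hk)

theorem Def.algWit (Q : JetPoly L) : Def (fieldStr L) fun M v => AlgWit M Q (M.coord v) := by
  refine ((Def.ev_eq_zero Q).and ((Def.ev_eq_zero Q).not.ex none 0)).congr fun M v => ?_
  refine and_congr Iff.rfl (exists_congr fun a => ?_)
  change ¬ M.ev (M.coord (M.str.assign v none 0 a)) Q = 0 ↔ _
  rw [M.coord_assign]

end Acl

/-! ### Interior points of definable sets -/

section Near

variable {L : FieldLanguage.{u}} {K₀ : FieldStructure L} {χ : Formula L.lang}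

/-- A point of a definable set is a root of one of finitely many polynomials or an interior
point. -/
theorem IsOpenTheory.exists_algWit_or_near (hT : IsOpenTheory K₀ χ) (φ : Formula L.lang) :
    ∃ 𝒬 : List (JetPoly L), ∀ M : FieldStructure L, M.IsModelOf K₀ → ∀ v : M.str.Assignment,
      φ.Sat M.str v → (∃ Q ∈ 𝒬, AlgWit M Q (M.coord v)) ∨
        ∃ z, ∀ y, y - M.coord v 0 ∈ M.nhd χ z → φ.Sat M.str (M.str.assign v none 0 y) := by
  obtain ⟨D, hD⟩ := hT.exists_form φ
  refine ⟨D.flatMap Prod.fst, fun M hM v hv => or_iff_not_imp_left.2 fun hno => ?_⟩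
  push Not at hno
  obtain ⟨hopen, hform⟩ := hD M hM
  obtain ⟨c, hc, hP, hθ⟩ := (hform v).1 hv
  obtain ⟨z, hz⟩ := (hT.nhdAxioms hM).exists_box (hopen c hc) hθ {0}
  refine ⟨z, fun y hy => (hform _).2 ⟨c, hc, fun P hPc => ?_, hz _ ?_ ?_⟩⟩
  · by_contra h0
    rw [M.coord_assign] at h0
    exact hno P (List.mem_flatMap.2 ⟨c, hc, hPc⟩) ⟨hP P hPc, y, h0⟩
  · intro x hx
    exact Structure.assign_of_ne (M := M.str) v y (hx 0 (by simp))
  · intro j hj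
    obtain rfl := Finset.mem_singleton.1 hj
    have := Structure.assign_self (M := M.str) v none 0 y
    rw [this]
    exact hy

/-- A finite neighbourhood could be shrunk to a single point, against non-discreteness. -/
theorem NhdAxioms.infinite_near {M : FieldStructure L} (h : NhdAxioms χ M)
    (z : M.str.Assignment) (a : M.K) : {y | y - a ∈ M.nhd χ z}.Infinite := by
  intro hf
  obtain ⟨z', hz', hF⟩ := h.exists_avoid z (hf.image fun y => y - a)
  obtain ⟨x, hx, hx0⟩ := h.nondiscrete z'
  refine hF x ⟨x + a, ?_, by simp⟩ hx0 hx
  simpa using hz' hx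

end Near

end TopFieldDer

namespace TopFieldDer

/-! Elements avoiding the roots of polynomials over a subfield. -/

section Avoid

open Polynomial

variable {F K : Type*} [Field F] [Field K] [Algebra F K] {d : K}

/-- The summands occupy disjoint blocks of `n` coefficients, like digits in base `n`. -/
theorem eq_zero_of_sum_mul_X_pow {n m : ℕ} {q : ℕ → F[X]} (hq : ∀ i, (q i).natDegree < n)
    (h : ∑ i ∈ Finset.range m, q i * X ^ (n * i) = 0) {i : ℕ} (hi : i < m) : q i = 0 := by
  ext j
  by_cases hj : j < n
  · have hc := congrArg (fun p => p.coeff (n * i + j)) h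
    simp only [finsetSum_coeff, coeff_mul_X_pow', coeff_zero] at hc
    rw [Finset.sum_eq_single i] at hc
    · simpa using hc
    · intro i' _ hne
      rcases lt_or_gt_of_ne hne with hlt | hlt
      · obtain ⟨k, rfl⟩ := Nat.exists_eq_add_of_lt hlt
        rw [if_pos (by nlinarith), coeff_eq_zero_of_natDegree_lt]
        refine (hq i').trans_le ?_
        have : n * (i' + k + 1) + j - n * i' = n + n * k + j := by
          rw [Nat.mul_add, Nat.mul_add]; omega
        omega
      · rw [if_neg]
        have : n * (i + 1) ≤ n * i' := Nat.mul_le_mul_left n hlt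
        rw [Nat.mul_add] at this
        omega
    · intro h
      exact absurd (Finset.mem_range.2 hi) h
  · rw [coeff_eq_zero_of_natDegree_lt ((hq i).trans_le (not_lt.1 hj)), coeff_zero]

/-- Elements of `F(d)` are fractions in `d`; `h` is a product of their denominators, and `n` exceeds
the degrees of the resulting numerators. -/
theorem exists_common_denominator (hd : Transcendental F d)
    (T : Finset (IntermediateField.adjoin F {d})) :
    ∃ (h : F[X]) (n : ℕ), h ≠ 0 ∧ 0 < n ∧ ∀ f ∈ T, ∃ q : F[X], q.natDegree < n ∧
      aeval d h * (f : K) = aeval d q := by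
  classical
  induction T using Finset.induction_on with
  | empty => exact ⟨1, 1, one_ne_zero, one_pos, by simp⟩
  | insert f T _ ih =>
    obtain ⟨h, n, hh, hn, ih⟩ := ih
    obtain ⟨r, s, hrs⟩ := (IntermediateField.mem_adjoin_simple_iff F _).1 f.2
    by_cases hs : s = 0
    · refine ⟨h, n, hh, hn, fun g hg => ?_⟩
      rcases Finset.mem_insert.1 hg with rfl | hg
      · exact ⟨0, by simpa using hn, by simp [hrs, hs]⟩
      · exact ih g hg
    · have hs' : aeval d s ≠ 0 := fun h0 => hs (transcendental_iff.1 hd s h0)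
      refine ⟨h * s, n + s.natDegree + (h * r).natDegree, mul_ne_zero hh hs, by omega,
        fun g hg => ?_⟩
      rcases Finset.mem_insert.1 hg with rfl | hg
      · refine ⟨h * r, by omega, ?_⟩
        rw [hrs, map_mul, map_mul]
        field_simp
      · obtain ⟨q, hq, hqg⟩ := ih g hg
        refine ⟨q * s, natDegree_mul_le.trans_lt (by omega), ?_⟩
        rw [map_mul, map_mul, ← hqg]
        ring

/-- Powers of a transcendental element are not roots of polynomials over a given space of finite
dimension. -/
theorem exists_forall_eval_ne_zero (hd : Transcendental F d) (s : Finset K) :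
    ∃ t : K, t ≠ 0 ∧ ∀ p : K[X], p ≠ 0 → (∀ i, p.coeff i ∈ Submodule.span F (s : Set K)) →
      p.eval t ≠ 0 := by
  classical
  let E := IntermediateField.adjoin F {d}
  -- Coordinates over `E = F(d)`. The coordinates of every element of the span, multiplied by the
  -- fixed denominator `h(d)`, become polynomials in `d` of degree less than `n`.
  let b := Module.Basis.ofVectorSpace E K
  obtain ⟨h, n, hh, hn, hden⟩ := exists_common_denominator hd
    (insert 0 (s.biUnion fun w => (b.repr w).support.image (b.repr w)))
  have hh' : aeval d h ≠ 0 := fun h0 => hh (transcendental_iff.1 hd h h0)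
  have hspan : ∀ ω ∈ Submodule.span F (s : Set K), ∀ c, ∃ q : F[X], q.natDegree < n ∧
      aeval d h * (b.repr ω c : K) = aeval d q := by
    intro ω hω c
    induction hω using Submodule.span_induction with
    | mem w hw =>
      refine hden _ ?_
      by_cases h0 : b.repr w c = 0
      · simp [h0]
      · refine Finset.mem_insert_of_mem (Finset.mem_biUnion.2 ⟨w, hw, Finset.mem_image.2
          ⟨c, Finsupp.mem_support_iff.2 h0, rfl⟩⟩)
    | zero => exact ⟨0, by simpa using hn, by simp⟩
    | add x y _ _ hx hy =>
      obtain ⟨q, hq, h1⟩ := hx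
      obtain ⟨q', hq', h2⟩ := hy
      refine ⟨q + q', (natDegree_add_le _ _).trans_lt (max_lt hq hq'), ?_⟩
      rw [map_add, map_add, ← h1, ← h2, Finsupp.add_apply]
      push_cast
      ring
    | smul a x _ hx =>
      obtain ⟨q, hq, h1⟩ := hx
      refine ⟨C a * q, (natDegree_C_mul_le _ _).trans_lt hq, ?_⟩
      have : b.repr (a • x) = algebraMap F E a • b.repr x := by
        rw [← map_smul, algebraMap_smul]
      rw [this, Finsupp.smul_apply, map_mul, ← h1, aeval_C]
      simp only [smul_eq_mul, MulMemClass.coe_mul]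
      rw [show ((algebraMap F E a : E) : K) = algebraMap F K a from rfl]
      ring
  have hd0 : d ≠ 0 := by
    rintro rfl
    exact hd (isAlgebraic_zero)
  -- If `p` vanishes at `d ^ n`, each coordinate gives a relation `∑ qᵢ(d) d^(n i) = 0`. As `d` is
  -- transcendental and the degrees of the `qᵢ` are below `n`, all `qᵢ` vanish, hence so does `p`.
  refine ⟨d ^ n, pow_ne_zero _ hd0, fun p hp hpW h0 => hp ?_⟩
  let dE : E := ⟨d, IntermediateField.mem_adjoin_simple_self F d⟩
  choose q hq hqe using fun i => hspan _ (hpW i)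
  have hpi : ∀ i ∈ Finset.range (p.natDegree + 1), p.coeff i = 0 := by
    intro i hi
    refine b.repr.map_eq_zero_iff.1 (Finsupp.ext fun c => ?_)
    have hsum : ∑ i ∈ Finset.range (p.natDegree + 1), q i c * X ^ (n * i) = 0 := by
      refine transcendental_iff.1 hd _ ?_
      have h1 : ∑ i ∈ Finset.range (p.natDegree + 1), dE ^ (n * i) • p.coeff i = 0 := by
        rw [eval_eq_sum_range] at h0
        rw [← h0]
        refine Finset.sum_congr rfl fun i _ => ?_
        rw [← pow_mul, mul_comm (p.coeff i)]
        rfl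
      have h2 := congrArg (fun x => aeval d h * ((b.repr x c : E) : K)) h1
      simp only [map_sum, map_smul, Finsupp.finsetSum_apply, Finsupp.smul_apply, map_zero,
        Finsupp.zero_apply, ZeroMemClass.coe_zero, mul_zero, smul_eq_mul,
        AddSubmonoidClass.coe_finsetSum, MulMemClass.coe_mul, Finset.mul_sum] at h2
      rw [map_sum, ← h2]
      refine Finset.sum_congr rfl fun i _ => ?_
      rw [map_mul, ← hqe, map_pow, aeval_X]
      simp only [SubmonoidClass.coe_pow, dE]
      ring
    have h3 := eq_zero_of_sum_mul_X_pow (fun i => hq i c) hsum (Finset.mem_range.1 hi)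
    have h4 := hqe i c
    rw [h3, map_zero, mul_eq_zero] at h4
    simpa using h4.resolve_left hh'
  ext i
  by_cases hi : i < p.natDegree + 1
  · rw [hpi i (Finset.mem_range.2 hi), coeff_zero]
  · rw [coeff_eq_zero_of_natDegree_lt (by omega), coeff_zero]

theorem coeff_comp_linear_mem {W : Submodule F K} {p : K[X]} (hp : ∀ i, p.coeff i ∈ W) (a v : F)
    (i : ℕ) : (p.comp (C (algebraMap F K a) + C (algebraMap F K v) * X)).coeff i ∈ W := by
  rw [comp, eval₂_eq_sum_range, finsetSum_coeff]
  refine Submodule.sum_mem _ fun j _ => ?_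
  have : (C (algebraMap F K a) + C (algebraMap F K v) * X) ^ j =
      ((C a + C v * X) ^ j : F[X]).map (algebraMap F K) := by simp
  rw [this, coeff_C_mul, coeff_map, mul_comm, ← Algebra.smul_def]
  exact W.smul_mem _ (hp j)

end Avoid

end TopFieldDer

namespace TopFieldDer

/-! Dense pairs. -/

section Bound

theorem Structure.assign_assign {Λ : Language.{u}} (M : Structure Λ) (v : M.Assignment)
    (s : Λ.Sorts) (n : ℕ) (a b : M.carrier s) :
    M.assign (M.assign v s n a) s n b = M.assign v s n b := by
  simp [Structure.assign]

/-- A transposition of variables, which allows the distinguished variable to be number `0`. -/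
theorem Formula.exists_swap {Λ : Language.{u}} (φ : Formula Λ) (s : Λ.Sorts) (n : ℕ) :
    ∃ φ' : Formula Λ, ∀ (M : Structure Λ) (v : M.Assignment),
      M.solutions φ' (fun x => v (x.1, Equiv.swap 0 n x.2)) s 0 = M.solutions φ v s n := by
  obtain ⟨φ', h⟩ := φ.exists_subst fun x => .var x.1 (Equiv.swap 0 n x.2)
  refine ⟨φ', fun M v => Set.ext fun a => (h M _).trans (iff_of_eq (congrArg (φ.Sat M · ) ?_))⟩
  funext x
  obtain ⟨s', k⟩ := x
  have h0 : ((s', Equiv.swap 0 n k) = (s, 0)) ↔ ((s', k) = (s, n)) := by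
    simp [Equiv.swap_apply_eq_iff]
  by_cases hx : ((s', k) : Λ.Sorts × ℕ) = (s, n)
  · obtain ⟨rfl, rfl⟩ := Prod.mk.inj hx
    have hk : ∀ j, j = 0 →
        (M.assign (fun x => v (x.1, Equiv.swap 0 k x.2)) s' 0 a) (s', j) = a := by
      rintro _ rfl
      simp
    rw [Structure.assign_self]
    exact hk _ (Equiv.swap_apply_right 0 k)
  · rw [Structure.assign_of_ne _ _ hx]
    refine (Structure.assign_of_ne (M := M) (fun x => v (x.1, Equiv.swap 0 n x.2)) a
      (mt h0.1 hx)).trans ?_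
    have hk : ∀ j, j = k → v (s', j) = v (s', k) := by rintro _ rfl; rfl
    exact hk _ (Equiv.swap_apply_self 0 n k)

variable {L : FieldLanguage.{u}} {K₀ : FieldStructure L} {χ : Formula L.lang}

theorem exists_finite_roots_list (𝒬 : List (JetPoly L)) : ∃ N, ∀ (M : FieldStructure L)
    (w : ℕ → M.K), {y | ∃ Q ∈ 𝒬, AlgWit M Q (Function.update w 0 y)}.Finite ∧
      {y | ∃ Q ∈ 𝒬, AlgWit M Q (Function.update w 0 y)}.ncard ≤ N := by
  induction 𝒬 with
  | nil => exact ⟨0, fun M w => by simp⟩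
  | cons Q 𝒬 ih =>
    obtain ⟨N, ih⟩ := ih
    obtain ⟨N', h⟩ := exists_finite_roots Q
    refine ⟨N' + N, fun M w => ?_⟩
    have : {y | ∃ Q' ∈ Q :: 𝒬, AlgWit M Q' (Function.update w 0 y)} =
        {y | AlgWit M Q (Function.update w 0 y)} ∪
          {y | ∃ Q ∈ 𝒬, AlgWit M Q (Function.update w 0 y)} := by
      ext y; simp
    rw [this]
    exact ⟨(h M w).1.union (ih M w).1,
      (Set.ncard_union_le _ _).trans (add_le_add (h M w).2 (ih M w).2)⟩

/-- The theory `T` eliminates `∃^∞`, and the infinite definable sets are, up to finitely many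
points, open. -/
theorem IsOpenTheory.exists_bound_zero (hT : IsOpenTheory K₀ χ) (φ : Formula L.lang) :
    ∃ N, ∀ M : FieldStructure L, M.IsModelOf K₀ → ∀ v : M.str.Assignment,
      {x : M.K | x ∈ M.str.solutions φ v none 0 ∧ ¬ ∃ z, ∀ y, y - x ∈ M.nhd χ z →
        y ∈ M.str.solutions φ v none 0}.Finite ∧
      ((M.str.solutions φ v none 0).Finite → (M.str.solutions φ v none 0).ncard ≤ N) := by
  obtain ⟨𝒬, h𝒬⟩ := hT.exists_algWit_or_near φ
  obtain ⟨N, hN⟩ := exists_finite_roots_list 𝒬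
  refine ⟨N, fun M hM v => ?_⟩
  have key : ∀ x ∈ M.str.solutions φ v none 0,
      (∃ Q ∈ 𝒬, AlgWit M Q (Function.update (M.coord v) 0 x)) ∨
      ∃ z, ∀ y, y - x ∈ M.nhd χ z → y ∈ M.str.solutions φ v none 0 := by
    intro x hx
    have := h𝒬 M hM (M.str.assign v none 0 x) hx
    rw [M.coord_assign] at this
    refine this.imp_right fun ⟨z, hz⟩ => ⟨z, fun y hy => ?_⟩
    have := hz y (by rwa [Function.update_self])
    rwa [M.str.assign_assign] at this
  refine ⟨(hN M (M.coord v)).1.subset fun x hx => (key x hx.1).resolve_right hx.2, fun hf => ?_⟩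
  -- A finite set has no interior point, so all its points are among the boundedly many roots.
  refine (Set.ncard_le_ncard (fun x hx => ?_) (hN M (M.coord v)).1).trans (hN M (M.coord v)).2
  refine (key x hx).resolve_right ?_
  rintro ⟨z, hz⟩
  exact (hT.nhdAxioms hM).infinite_near z x (hf.subset hz)

theorem IsOpenTheory.exists_bound (hT : IsOpenTheory K₀ χ) (φ : Formula L.lang) (n : ℕ) :
    ∃ N, ∀ M : FieldStructure L, M.IsModelOf K₀ → ∀ v : M.str.Assignment,
      (M.str.solutions φ v none n).Finite → (M.str.solutions φ v none n).ncard ≤ N := by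
  obtain ⟨φ', h⟩ := φ.exists_swap (Λ := L.lang) none n
  obtain ⟨N, hN⟩ := hT.exists_bound_zero φ'
  refine ⟨N, fun M hM v => ?_⟩
  rw [← h M.str v]
  exact (hN M hM _).2

end Bound

/-! ### Dense pairs and points algebraically generic over the small field -/

section DensePair

variable {L : FieldLanguage.{u}} {K₀ : FieldStructure L} {χ : Formula L.lang}

/-- Dense pairs of distinct fields. -/
structure IsDensePair (K₀ M : FieldStructure L) (P : Set M.K) : Prop where
  model : M.IsModelOf K₀
  nonempty : P.Nonempty
  acl_subset : M.acl P ⊆ P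
  dense : IsDensePredicate M P
  proper : ∃ x, x ∉ P

variable {M : FieldStructure L} {P : Set M.K}

/-- The roots of a nonzero polynomial with values from `P` form a finite set definable over `P`. The
value `p` at the variable `0` is a placeholder that keeps all parameters in `P`. -/
theorem IsAclClosed.acl_subset [IsEmpty L.Aux] [CharZero M.K] (hP : IsAclClosed M P) :
    M.acl P ⊆ P := by
  intro x hx
  obtain ⟨Q, w, rfl, hw, hQ⟩ := (M.mem_acl_iff hP.1).1 hx
  obtain ⟨φ, hφ⟩ := Def.algWit Q
  obtain ⟨N, hN⟩ := exists_finite_roots Q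
  obtain ⟨p, hp⟩ := hP.1
  have hsol : M.str.solutions φ (M.asg (Function.update w 0 p)) none 0 =
      {y | AlgWit M Q (Function.update w 0 y)} := by
    ext y
    refine (hφ M _).trans ?_
    rw [M.assign_asg, Function.update_idem]
    rfl
  refine hP.2 φ (M.asg (Function.update w 0 p)) 0 (fun k => ?_) ?_ ?_
  · by_cases hk : k = 0
    · rw [M.asg_none, hk, Function.update_self]
      exact hp
    · rw [M.asg_none, Function.update_of_ne hk]
      exact hw k hk
  · rw [hsol]; exact (hN M w).1
  · rw [hsol]
    simpa using hQ

namespace IsDensePair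

theorem adjoin_eq (h : IsDensePair K₀ M P) :
    (Algebra.adjoin ℤ (Set.range M.const ∪ P) : Set M.K) = P := by
  refine Set.Subset.antisymm (fun x hx => h.acl_subset ?_)
    (Set.subset_union_right.trans Algebra.subset_adjoin)
  exact isAlgebraic_algebraMap (⟨x, hx⟩ : Algebra.adjoin ℤ (Set.range M.const ∪ P))

/-- The small field of a dense pair. -/
def subfield (h : IsDensePair K₀ M P) : Subfield M.K where
  __ := (Algebra.adjoin ℤ (Set.range M.const ∪ P)).toSubring
  inv_mem' x hx := by
    refine Algebra.subset_adjoin (.inr (h.acl_subset ?_))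
    exact (isAlgebraic_algebraMap
      (⟨x, hx⟩ : Algebra.adjoin ℤ (Set.range M.const ∪ P))).inv

theorem mem_subfield (h : IsDensePair K₀ M P) {x : M.K} : x ∈ h.subfield ↔ x ∈ P :=
  Set.ext_iff.1 h.adjoin_eq x

theorem transcendental (h : IsDensePair K₀ M P) {d : M.K} (hd : d ∉ P) :
    Transcendental h.subfield d := fun hd' => hd (h.acl_subset hd')

/-- Density in a definable set given up to definability in the language of relations. -/
theorem exists_mem (h : IsDensePair K₀ M P)
    {R : ∀ M : FieldStructure L, M.str.Assignment → Prop} (hR : Def (fieldStr L) R)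
    (v : M.str.Assignment) (hinf : {x : M.K | R M (M.str.assign v none 0 x)}.Infinite) :
    ∃ x ∈ P, R M (M.str.assign v none 0 x) := by
  obtain ⟨φ, hφ⟩ := hR
  have hsol : M.str.solutions φ v none 0 = {x : M.K | R M (M.str.assign v none 0 x)} :=
    Set.ext fun x => hφ M _
  obtain ⟨x, hx, hs⟩ := h.dense φ v 0 (by rwa [hsol])
  exact ⟨x, hx, (hφ M _).1 hs⟩

end IsDensePair

open Classical in
/-- `w 0` is a root of a polynomial in which the variables from `V` are replaced by elements of `P`,
and the others by the elements given by `w`. -/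
def AlgOver (M : FieldStructure L) (P : Set M.K) (Q : JetPoly L) (V : Set ℕ) (w : ℕ → M.K) :
    Prop :=
  ∃ z : ℕ → M.K, (∀ k ∈ Q.vars, z k ∈ P) ∧ AlgWit M Q fun k => if k ∈ V then z k else w k

-- Apart from powers of the variable `0`, every monomial splits into values `z k` from `F` and a
-- product of a constant with values `w k`. The finitely many products of the second kind span a
-- space containing all coefficients, whatever `z` is.
open Classical in
theorem exists_poly_mem_span (F : Subfield M.K) (Q : JetPoly L) (V : Set ℕ)
    (w : ℕ → M.K) : ∃ s : Finset M.K, ∀ z : ℕ → M.K, (∀ k, z k ∈ F) →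
      ∃ p : Polynomial M.K, (∀ i, p.coeff i ∈ Submodule.span F (s : Set M.K)) ∧
        ∀ y, p.eval y =
          M.ev (Function.update (fun k => if k ∈ V then z k else w k) 0 y) Q := by
  induction Q using MvPolynomial.induction_on with
  | C c =>
    refine ⟨{MvPolynomial.aeval M.const c}, fun z _ =>
      ⟨Polynomial.C (MvPolynomial.aeval M.const c), fun i => ?_, fun y => by
        rw [Polynomial.eval_C, FieldStructure.ev_C]⟩⟩
    rw [Polynomial.coeff_C]
    split_ifs
    · exact Submodule.subset_span (by simp)
    · exact Submodule.zero_mem _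
  | add Q Q' ih ih' =>
    obtain ⟨s, hs⟩ := ih
    obtain ⟨s', hs'⟩ := ih'
    refine ⟨s ∪ s', fun z hz => ?_⟩
    obtain ⟨p, hp, h⟩ := hs z hz
    obtain ⟨p', hp', h'⟩ := hs' z hz
    refine ⟨p + p', fun i => ?_, fun y => by rw [Polynomial.eval_add, map_add, h, h']⟩
    rw [Polynomial.coeff_add]
    exact Submodule.add_mem _ (Submodule.span_mono (by simp) (hp i))
      (Submodule.span_mono (by simp) (hp' i))
  | mul_X Q k ih =>
    obtain ⟨s, hs⟩ := ih
    by_cases hk : k = 0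
    · subst hk
      refine ⟨s, fun z hz => ?_⟩
      obtain ⟨p, hp, h⟩ := hs z hz
      refine ⟨p * Polynomial.X, fun i => ?_, fun y => by simp [h]⟩
      rcases i with _ | i
      · simp
      · simpa using hp i
    by_cases hkV : k ∈ V
    · refine ⟨s, fun z hz => ?_⟩
      obtain ⟨p, hp, h⟩ := hs z hz
      refine ⟨p * Polynomial.C (z k), fun i => ?_, fun y => by simp [h, hk, hkV]⟩
      rw [Polynomial.coeff_mul_C, mul_comm]
      exact Submodule.smul_mem _ (⟨z k, hz k⟩ : F) (hp i)
    · refine ⟨s.image (· * w k), fun z hz => ?_⟩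
      obtain ⟨p, hp, h⟩ := hs z hz
      refine ⟨p * Polynomial.C (w k), fun i => ?_, fun y => by simp [h, hk, hkV]⟩
      rw [Polynomial.coeff_mul_C, Finset.coe_image]
      have := Submodule.mem_map_of_mem (f := LinearMap.mulRight F (w k)) (hp i)
      rw [Submodule.map_span] at this
      exact this

/-- In every infinite definable set there is an element which avoids given relations of
algebraicity over the small field. -/
theorem IsDensePair.exists_not_algOver (hT : IsOpenTheory K₀ χ) (h : IsDensePair K₀ M P)
    (φ : Formula L.lang) (v : M.str.Assignment) (hinf : (M.str.solutions φ v none 0).Infinite)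
    (B : Finset (JetPoly L × Set ℕ × (ℕ → M.K))) (hB : ∀ b ∈ B, 0 ∉ b.2.1) :
    ∃ x : M.K, x ∈ (M.str.solutions φ v none 0 : Set M.K) ∧
      ∀ b ∈ B, ¬ AlgOver M P b.1 b.2.1 (Function.update b.2.2 0 x) := by
  classical
  have hN := hT.nhdAxioms h.model
  obtain ⟨d, hd⟩ := h.proper
  have hpoly : ∀ b : JetPoly L × Set ℕ × (ℕ → M.K), ∃ s : Finset M.K,
      ∀ z : ℕ → M.K, (∀ k, z k ∈ h.subfield) →
      ∃ p : Polynomial M.K, (∀ i, p.coeff i ∈ Submodule.span h.subfield (s : Set M.K)) ∧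
        ∀ y, p.eval y =
          M.ev (Function.update (fun k => if k ∈ b.2.1 then z k else b.2.2 k) 0 y) b.1 :=
    fun b => exists_poly_mem_span h.subfield b.1 b.2.1 b.2.2
  choose s hs using hpoly
  -- This `t` is a root of no nonzero polynomial with coefficients in the joint span. The point
  -- sought is `a + t * c` with `a`, `c` in `P` and `c ≠ 0`: if it were a root of a bad `p`, then
  -- `t` would be a root of `p(a + c X)`, whose coefficients stay in the span.
  obtain ⟨t, ht0, ht⟩ := exists_forall_eval_ne_zero (h.transcendental hd) (B.biUnion s)
  -- an interior point in the small field
  have hint : Def (fieldStr L) fun M v => ∃ z : M.str.Assignment, ∀ y : M.str.Assignment,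
      M.coord y 0 - M.coord v 0 ∈ M.nhd χ z → φ.Sat M.str (M.str.assign v none 0 (M.coord y 0)) :=
    (((((TermFun.coord 2 0).sub (TermFun.coord 0 0)).mem_nhd χ 1).imp
      (Def.comp (str := fieldStr L) (R := fun M v => φ.Sat M.str v) ⟨φ, fun _ _ => Iff.rfl⟩
        (TermMap.assign (TermFun.coord 2 0) 0 0))).all 2).ex 1 |>.toDef
  obtain ⟨a, haP, z, hz⟩ := h.exists_mem hint v (by
    obtain ⟨N, hN⟩ := hT.exists_bound_zero φ
    refine ((hinf.sdiff (hN M h.model v).1)).mono fun x hx => ?_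
    by_contra hno
    refine hx.2 ⟨hx.1, fun ⟨z, hz⟩ => hno ⟨z, fun y hy => ?_⟩⟩
    rw [M.coord_assign, Function.update_self] at hy
    rw [M.str.assign_assign]
    exact hz _ hy)
  rw [M.coord_assign, Function.update_self] at hz
  -- Density yields a nonzero `c` in `P` so small that `a + t * c` stays in the definable set.
  obtain ⟨z', hz'⟩ := hN.mul_left t z
  have hnz : Def (fieldStr L) fun M v => χ.Sat M.str v ∧ ¬ M.coord v 0 = 0 :=
    Def.and ⟨χ, fun _ _ => Iff.rfl⟩
      (((TermFun.coord 0 0).eq TermFun.zero).not.toDef)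
  obtain ⟨c, hcP, hcχ, hc0⟩ := h.exists_mem hnz z' (by
    refine ((hN.infinite_near z' 0).sdiff (Set.finite_singleton (0 : M.K))).mono fun x hx => ?_
    refine ⟨?_, ?_⟩
    · have := hx.1
      rwa [Set.mem_ofPred_eq, sub_zero] at this
    rw [M.coord_assign, Function.update_self]
    exact hx.2)
  rw [M.coord_assign, Function.update_self] at hc0
  have hcz : t * c ∈ M.nhd χ z := hz' c hcχ
  refine ⟨a + t * c, ?_, fun b hb hbad => ?_⟩
  · have := hz (M.str.assign v none 0 (a + t * c)) (by
      rw [M.coord_assign, Function.update_self]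
      simpa using hcz)
    rw [M.coord_assign, Function.update_self, M.str.assign_assign] at this
    exact this
  · obtain ⟨z₁, hz₁, hw⟩ := hbad
    obtain ⟨p, hp, hpe⟩ := hs b (fun k => if k ∈ b.1.vars then z₁ k else 0) (by
      intro k
      by_cases hk : k ∈ b.1.vars
      · simpa [hk] using h.mem_subfield.2 (hz₁ k hk)
      · simp [hk])
    have hw' : AlgWit M b.1 (Function.update (fun k => if k ∈ b.2.1 then
        (fun k => if k ∈ b.1.vars then z₁ k else 0) k else b.2.2 k) 0 (a + t * c)) := by
      refine (AlgWit.congr fun k hk => ?_).1 hw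
      by_cases h0 : k = 0
      · subst h0
        simp [hB b hb]
      · have hk : k ∈ b.1.vars := by simpa [h0] using hk
        simp [h0, hk]
    obtain ⟨h1, y, h2⟩ := hw'
    rw [Function.update_idem, ← hpe] at h2
    rw [← hpe] at h1
    have hp0 : p ≠ 0 := by
      rintro rfl
      simp at h2
    refine ht (p.comp (Polynomial.C (algebraMap h.subfield M.K ⟨a, h.mem_subfield.2 haP⟩) +
      Polynomial.C (algebraMap h.subfield M.K ⟨c, h.mem_subfield.2 hcP⟩) * Polynomial.X)) ?_ ?_ ?_
    · intro h0
      rw [Polynomial.comp_eq_zero_iff] at h0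
      rcases h0 with h0 | ⟨-, h0⟩
      · exact hp0 h0
      · have := congrArg (fun q => q.coeff 1) h0
        simp at this
        exact hc0 (congrArg Subtype.val this)
    · refine coeff_comp_linear_mem (fun i => ?_) _ _
      exact Submodule.span_mono (by
        exact_mod_cast Finset.subset_biUnion_of_mem s hb) (hp i)
    · rw [Polynomial.eval_comp]
      simp only [Polynomial.eval_add, Polynomial.eval_C, Polynomial.eval_mul, Polynomial.eval_X]
      rw [mul_comm t c] at h1
      exact h1

end DensePair

end TopFieldDer

namespace TopFieldDer

/-! ### The kernel of a generic derivation is a proper dense subfield -/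

section Constants

variable {L : FieldLanguage.{u}} {K₀ : FieldStructure L} {χ : Formula L.lang}
  {M : FieldStructure L} {δ : Derivation ℤ M.K M.K}

theorem regularZero_X (n l : ℕ) (Y : ℕ → M.K) (hY : Y (Nat.pair n l) = 0) :
    RegularZero M Y (Polynomial.X : Polynomial (LowJet L n l)) 0 := by
  refine ⟨fun k hk => ?_, ?_, ?_⟩
  · obtain rfl : k = 0 := by simpa using hk
    simpa using hY
  · simp
  · simp

/-- The jet of order `l - 1` of a zero of `δ^l x` can be prescribed approximately. -/
theorem IsGenericDerivation.exists_near (hG : IsGenericDerivation K₀ χ M δ) (hN : NhdAxioms χ M)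
    {l : ℕ} (hl : 1 ≤ l) (u : ℕ → M.K) (z : M.str.Assignment) :
    ∃ a : M.K, δ^[l] a = 0 ∧ ∀ k < l, δ^[k] a - u k ∈ M.nhd χ z := by
  have hy : IsJet δ (fun _ => (0 : M.K)) := fun n k => map_zero δ
  obtain ⟨a, -, ha, h⟩ := hG.exists_regularZero hN hl Polynomial.X (n := 0)
    (u := Function.update u l 0) hy
    (regularZero_X 0 l _ (by simp)) Set.finite_empty z
  refine ⟨a, by simpa using ha.1 0 (by simp), fun k hk => ?_⟩
  simpa [hk.ne] using h k (by omega)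

/-- Applying `δ` to `p(x) = 0` gives `p'(x) * δ x = 0`. If `p'(x) = 0`, the derivative is a nonzero
relation of smaller degree, by characteristic zero. -/
theorem Derivation.eq_zero_of_isAlgebraic {K : Type*} [Field K] [CharZero K]
    (δ : Derivation ℤ K K) {A : Subalgebra ℤ K} (hA : ∀ a ∈ A, δ a = 0) {x : K}
    (hx : IsAlgebraic A x) : δ x = 0 := by
  obtain ⟨p, hp0, hp⟩ := hx
  have hδ : ∀ p : Polynomial A,
      δ (Polynomial.aeval x p) = Polynomial.aeval x (Polynomial.derivative p) * δ x := by
    intro p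
    induction p using Polynomial.induction_on' with
    | add p q hp hq => simp [hp, hq, add_mul]
    | monomial n a =>
      rw [Polynomial.aeval_monomial, Polynomial.derivative_monomial, Polynomial.aeval_monomial,
        Derivation.leibniz, Derivation.leibniz_pow]
      have : δ (algebraMap A K a) = 0 := hA a a.2
      rw [this]
      simp
      ring
  induction hd : p.natDegree generalizing p with
  | zero =>
    rw [Polynomial.eq_C_of_natDegree_eq_zero hd] at hp hp0
    rw [Polynomial.aeval_C] at hp
    refine absurd ?_ hp0
    rw [Subtype.val_injective (show ((p.coeff 0 : A) : K) = (0 : A) from hp), map_zero]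
  | succ n ih =>
    have h := hδ p
    rw [hp, map_zero, eq_comm, mul_eq_zero] at h
    refine h.elim (fun h => ih _ (fun h0 => ?_) h ?_) id
    · have := Polynomial.derivative_eq_zero.1 h0
      omega
    · rw [Polynomial.natDegree_derivative, hd]
      rfl

/-- An infinite definable set has an interior point, which is approximated by solutions of `δ a =
0`. The kernel is proper since some solution of `δ² a = 0` has `δ a` close to `1`. -/
theorem IsGenericDerivation.isDensePair (hT : IsOpenTheory K₀ χ)
    (hG : IsGenericDerivation K₀ χ M δ) : IsDensePair K₀ M {x | δ x = 0} := by
  have hN := hT.nhdAxioms hG.model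
  have := hT.charZero_of_model hG.model
  refine ⟨hG.model, ⟨0, map_zero δ⟩, fun x hx => ?_, ?_, ?_⟩
  · refine Derivation.eq_zero_of_isAlgebraic δ (fun a ha => ?_) hx
    induction ha using Algebra.adjoin_induction with
    | mem a ha =>
      rcases ha with ⟨c, rfl⟩ | ha
      · exact hG.const c
      · exact ha
    | algebraMap z => simp
    | add a b _ _ ha hb => rw [map_add, ha, hb, add_zero]
    | mul a b _ _ ha hb => rw [δ.leibniz, ha, hb]; simp
  · intro φ v n hinf
    obtain ⟨φ', hφ'⟩ := φ.exists_swap (Λ := L.lang) none n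
    rw [← hφ' M.str v] at hinf ⊢
    obtain ⟨N, hN'⟩ := hT.exists_bound_zero φ'
    obtain ⟨x, hx, hx'⟩ := (hinf.sdiff (hN' M hG.model _).1).nonempty
    obtain ⟨z, hz⟩ : ∃ z, ∀ y, y - x ∈ M.nhd χ z → y ∈ M.str.solutions φ' _ none 0 := by
      by_contra hno
      exact hx' ⟨hx, hno⟩
    obtain ⟨a, ha, haz⟩ := hG.exists_near hN le_rfl (fun _ => x) z
    exact ⟨a, ha, hz a (haz 0 one_pos)⟩
  · obtain ⟨z, hz⟩ := hN.hausdorff (-1) (by simp)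
    obtain ⟨a, -, ha⟩ := hG.exists_near hN (l := 2) (by norm_num) (fun _ => 1) z
    refine ⟨a, fun h0 => hz ?_⟩
    have := ha 1 (by norm_num)
    rwa [Function.iterate_one, show δ a = 0 from h0, zero_sub] at this

end Constants

/-! ### Dense pairs are preserved by elementary embeddings -/

section Elementary

variable {L : FieldLanguage.{u}} {K₀ : FieldStructure L} {χ : Formula L.lang}

theorem Def.forallAll {Λ : Language.{u}} {ι : Type*} {str : ι → Structure Λ}
    {R : ∀ i, (str i).Assignment → Prop} (hR : Def str R) :
    Def str fun i _ => ∀ w, R i w :=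
  hR.not.exAll.not.congr fun _ _ => by simp

theorem Def.cardLe (φ : Formula L.lang) (n k : ℕ) :
    Def (fieldStr L) fun M v => (k : ℕ∞) ≤ (M.str.solutions φ v none n).encard := by
  obtain ⟨φ', h⟩ := φ.exists_card_le (Λ := L.lang) none n k
  exact ⟨φ', fun M v => h M.str v⟩

variable [IsEmpty L.Aux] {M M' : FieldStructure L} {P : Set M.K} {P' : Set M'.K} {e : M.K → M'.K}

theorem IsElementary.of_def (he : IsElementary P P' e)
    {Q : (Σ M : FieldStructure L, Set M.K) → Prop} (hQ : Def (pairFam L) fun p _ => Q p)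
    (h : Q ⟨M, P⟩) : Q ⟨M', P'⟩ :=
  (he.def_iff hQ fun _ => 0).1 h

/-- Density becomes first-order because `T` eliminates `∃^∞`: infinitude of a definable set amounts
to having `N + 1` elements for a suitable `N`. Algebraic closedness is expressed separately for each
polynomial. -/
theorem IsDensePair.of_isElementary (hT : IsOpenTheory K₀ χ) (h : IsDensePair K₀ M P)
    (he : IsElementary P P' e) : IsDensePair K₀ M' P' := by
  have hmod : M'.IsModelOf K₀ := fun φ hφ =>
    he.of_def (Q := fun p => ∀ w : p.1.str.Assignment, φ.Sat p.1.str w)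
      (Def.lift (R := fun M w => φ.Sat M.str w) ⟨φ, fun _ _ => Iff.rfl⟩).forallAll (h.model φ hφ)
  have hc := hT.charZero_of_model h.model
  have hc' := hT.charZero_of_model hmod
  have hne : P'.Nonempty := by
    obtain ⟨x, hx⟩ := h.nonempty
    obtain ⟨w, hw⟩ := he.of_def (Q := fun p => ∃ w : p.1.str.Assignment, p.1.coord w 0 ∈ p.2)
      (Def.pred 0).exAll ⟨M.asg fun _ => x, hx⟩
    exact ⟨_, hw⟩
  refine ⟨hmod, hne, fun x hx => ?_, fun φ v n hinf => ?_, ?_⟩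
  · obtain ⟨Q, w, rfl, hw, hQ⟩ := (M'.mem_acl_iff hne).1 hx
    refine he.of_def (Q := fun p => ∀ w : p.1.str.Assignment, (∀ k ∈ Q.vars.erase 0,
      p.1.coord w k ∈ p.2) → AlgWit p.1 Q (p.1.coord w) → p.1.coord w 0 ∈ p.2)
      ((Def.forall_mem _ fun k _ => Def.pred k).imp
        ((Def.algWit Q).lift.imp (Def.pred 0))).forallAll (fun w hw hQ => ?_) (M'.asg w)
        (fun k hk => hw k (Finset.mem_erase.1 hk).1) hQ
    classical
    obtain ⟨p, hp⟩ := h.nonempty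
    refine h.acl_subset ((M.mem_acl_iff h.nonempty).2
      ⟨Q, fun k => if k ∈ insert 0 Q.vars then M.coord w k else p, by simp, fun k hk => ?_,
        (AlgWit.congr fun k hk => ?_).1 hQ⟩)
    · by_cases hkv : k ∈ Q.vars
      · simpa [hk, hkv] using hw k (Finset.mem_erase.2 ⟨hk, hkv⟩)
      · simpa [hk, hkv] using hp
    · rw [if_pos hk]
  · obtain ⟨N, hN⟩ := hT.exists_bound φ n
    obtain ⟨a, ha, haP⟩ := he.of_def (Q := fun p => ∀ v : p.1.str.Assignment,
      ((N + 1 : ℕ) : ℕ∞) ≤ (p.1.str.solutions φ v none n).encard →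
        ∃ a : p.1.K, φ.Sat p.1.str (p.1.str.assign v none n a) ∧
          p.1.coord (p.1.str.assign v none n a) n ∈ p.2)
      ((Def.cardLe φ n (N + 1)).lift.imp (((Def.lift (R := fun M w => φ.Sat M.str w)
        ⟨φ, fun _ _ => Iff.rfl⟩).and (Def.pred n)).ex none n)).forallAll (fun v hv => by
          obtain ⟨a, haP, ha⟩ := h.dense φ v n (fun hf => by
            have h1 := hN M h.model v hf
            rw [← hf.cast_ncard_eq] at hv
            have h2 : N + 1 ≤ (M.str.solutions φ v none n).ncard := by exact_mod_cast hv
            omega)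
          exact ⟨a, ha, by rwa [M.coord_assign, Function.update_self]⟩) v
        (by rw [hinf.encard_eq]; exact le_top)
    rw [M'.coord_assign, Function.update_self] at haP
    exact ⟨a, haP, ha⟩
  · obtain ⟨x, hx⟩ := h.proper
    obtain ⟨w, hw⟩ := he.of_def (Q := fun p => ∃ w : p.1.str.Assignment, ¬ p.1.coord w 0 ∈ p.2)
      (Def.pred 0).not.exAll ⟨M.asg fun _ => x, hx⟩
    exact ⟨_, hw⟩

end Elementary

end TopFieldDer

namespace TopFieldDer

/-! Partial isomorphisms between dense pairs. -/

section BackAndForth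

variable {L : FieldLanguage.{u}} {K₀ : FieldStructure L} {χ : Formula L.lang}
  {M M' M'' : FieldStructure L} {P : Set M.K} {P' : Set M'.K} {P'' : Set M''.K} {ι κ : Type}

theorem AlgOver.congr {Q : JetPoly L} {V : Set ℕ} {w w' : ℕ → M.K} (h : ∀ k, k ∉ V → w k = w' k)
    (hw : AlgOver M P Q V w) : AlgOver M P Q V w' := by
  obtain ⟨z, hz, hQ⟩ := hw
  refine ⟨z, hz, (AlgWit.congr fun k _ => ?_).1 hQ⟩
  by_cases hk : k ∈ V
  · simp [hk]
  · simp [hk, h k hk]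

/-- Separates the parameters from `P`, which `AlgOver` quantifies away, from those in `S`. So
independence over `P` is described by formulas of `L_P` with parameters from `S`. -/
theorem mem_acl_union_iff [CharZero M.K] (hP : P.Nonempty) {S : Set M.K} {x : M.K} :
    x ∈ M.acl (P ∪ S) ↔ ∃ (Q : JetPoly L) (V : Set ℕ) (w : ℕ → M.K), 0 ∉ V ∧ w 0 = x ∧
      (∀ k, k ≠ 0 → k ∉ V → w k ∈ S) ∧ AlgOver M P Q V w := by
  classical
  obtain ⟨p, hp⟩ := hP
  have hne : (P ∪ S).Nonempty := ⟨p, .inl hp⟩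
  rw [M.mem_acl_iff hne]
  constructor
  · rintro ⟨Q, w, rfl, hw, hQ⟩
    refine ⟨Q, {k | k ≠ 0 ∧ w k ∈ P}, w, by simp, rfl, fun k hk hkV => ?_,
      fun k => if w k ∈ P then w k else p, fun k _ => ?_, (AlgWit.congr fun k _ => ?_).1 hQ⟩
    · exact (hw k hk).resolve_left fun h => hkV ⟨hk, h⟩
    · by_cases h : w k ∈ P <;> simp [h, hp]
    · by_cases h : w k ∈ P <;> simp [h]
  · rintro ⟨Q, V, w, h0, rfl, hw, z, hz, hQ⟩
    refine ⟨Q, fun k => if k ∈ V then (if k ∈ Q.vars then z k else p) else w k, by simp [h0],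
      fun k hk => ?_, (AlgWit.congr fun k hk => ?_).1 hQ⟩
    · by_cases hkV : k ∈ V
      · by_cases hkQ : k ∈ Q.vars
        · simpa [hkV, hkQ] using .inl (hz k hkQ)
        · simpa [hkV, hkQ] using .inl hp
      · simpa [hkV] using .inr (hw k hk hkV)
    · by_cases hk0 : k = 0
      · subst hk0
        simp [h0]
      · have : k ∈ Q.vars := by simpa [hk0] using hk
        simp [this]

/-- The elements `a i`, for `i` in `C`, are independent over `P`. -/
def IsFree (M : FieldStructure L) (P : Set M.K) (a : ι → M.K) (C : Set ι) : Prop :=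
  ∀ i ∈ C, a i ∉ M.acl (P ∪ a '' (C \ {i}))

theorem IsFree.insert [CharZero M.K] {a : ι → M.K} {C : Set ι} (h : IsFree M P a C) {j : ι}
    (hj : a j ∉ M.acl (P ∪ a '' C)) : IsFree M P a (insert j C) := by
  have hjC : j ∉ C := fun hjC => hj (M.subset_acl _ (.inr ⟨j, hjC, rfl⟩))
  rintro i (rfl | hi) hmem
  · rw [Set.insert_sdiff_self_of_notMem hjC] at hmem
    exact hj hmem
  · have hij : i ≠ j := by
      rintro rfl
      exact hjC hi
    rw [Set.insert_sdiff_of_notMem _ (by simpa using hij.symm), Set.image_insert_eq,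
      Set.union_insert] at hmem
    have h1 := M.acl_exchange hmem (h i hi)
    refine hj (M.acl_mono ?_ h1)
    refine Set.insert_subset (.inr ⟨i, hi, rfl⟩) (Set.union_subset_union_right _ ?_)
    exact Set.image_mono Set.sdiff_subset

/-- The elements of `C₀` are dropped one at a time. One that could not be dropped would, by
exchange, be algebraic over `P` and the others, as `x` lies in `P`. -/
theorem IsFree.mem_acl_of_mem [CharZero M.K] {a : ι → M.K} {C : Set ι} (h : IsFree M P a C)
    {S : Set M.K} (hS : S ⊆ P) {x : M.K} (hx : x ∈ P) {C₀ : Set ι} (hC₀ : C₀.Finite)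
    (hsub : C₀ ⊆ C) (hmem : x ∈ M.acl (S ∪ a '' C₀)) : x ∈ M.acl S := by
  induction C₀, hC₀ using Set.Finite.induction_on with
  | empty => simpa using hmem
  | @insert c C₀ hc _ ih =>
    refine ih ((Set.subset_insert _ _).trans hsub) (by_contra fun hno => ?_)
    rw [Set.image_insert_eq, Set.union_insert] at hmem
    refine h c (hsub (Set.mem_insert _ _)) (M.acl_mono ?_ (M.acl_exchange hmem hno))
    refine Set.insert_subset (.inl hx) (Set.union_subset_union hS (Set.image_mono ?_))
    intro i hi
    refine ⟨hsub (Set.mem_insert_of_mem _ hi), ?_⟩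
    rintro rfl
    exact hc hi

variable [IsEmpty L.Aux]

theorem Formula.exists_rename (φ : Formula L.lang) (σ : ℕ → ℕ) : ∃ φ' : Formula L.lang,
    ∀ (M : FieldStructure L) (w : ℕ → M.K),
      φ'.Sat M.str (M.asg w) ↔ φ.Sat M.str (M.asg (w ∘ σ)) := by
  obtain ⟨φ', h⟩ := φ.exists_subst (Λ := L.lang) fun x => .var x.1 (σ x.2)
  refine ⟨φ', fun M w => (h M.str _).trans (iff_of_eq (congrArg (φ.Sat M.str ·) ?_))⟩
  funext x
  rcases x with ⟨_ | a, n⟩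
  · rfl
  · exact (IsEmpty.false a).elim

/-- The tuples `a` and `a'` have the same type in the language without the predicate. -/
def SameType (M M' : FieldStructure L) (a : ι → M.K) (a' : ι → M'.K) : Prop :=
  ∀ (φ : Formula L.lang) (ρ : ℕ → ι),
    φ.Sat M.str (M.asg (a ∘ ρ)) ↔ φ.Sat M'.str (M'.asg (a' ∘ ρ))

theorem SameType.def_iff {a : ι → M.K} {a' : ι → M'.K} (h : SameType M M' a a')
    {R : ∀ M : FieldStructure L, M.str.Assignment → Prop} (hR : Def (fieldStr L) R) (ρ : ℕ → ι) :
    R M (M.asg (a ∘ ρ)) ↔ R M' (M'.asg (a' ∘ ρ)) := by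
  obtain ⟨φ, hφ⟩ := hR
  exact (hφ M _).symm.trans ((h φ ρ).trans (hφ M' _))

theorem SameType.symm {a : ι → M.K} {a' : ι → M'.K} (h : SameType M M' a a') :
    SameType M' M a' a := fun φ ρ => (h φ ρ).symm

theorem SameType.mem_acl {a : ι → M.K} {a' : ι → M'.K} (h : SameType M M' a a') [CharZero M.K]
    [CharZero M'.K] {J : Set ι} (hJ : J.Nonempty) {i : ι} (hi : a i ∈ M.acl (a '' J)) :
    a' i ∈ M'.acl (a' '' J) := by
  obtain ⟨Q, w, h0, hw, hQ⟩ := (M.mem_acl_iff (hJ.image a)).1 hi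
  have : Nonempty ι := ⟨i⟩
  choose! ρ hρJ hρ using hw
  have hwρ : w = a ∘ Function.update ρ 0 i := by
    funext k
    by_cases hk : k = 0
    · simp [hk, h0]
    · simp [hk, hρ k hk]
  rw [hwρ] at hQ
  refine (M'.mem_acl_iff (hJ.image a')).2 ⟨Q, a' ∘ Function.update ρ 0 i, by simp, fun k hk => ?_,
    (h.def_iff (Def.algWit Q) _).1 hQ⟩
  simpa [hk] using ⟨ρ k, hρJ k hk, rfl⟩

theorem Def.algOver (Q : JetPoly L) (V : Set ℕ) :
    Def (pairFam L) fun p v => AlgOver p.1 p.2 Q V (p.1.coord v) := by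
  classical
  have h1 : DefS (pairFam L) fun p vs => ∀ k ∈ Q.vars, p.1.coord (vs 1) k ∈ p.2 :=
    DefS.forall_mem _ fun k _ => (Def.pred k).slot 1
  have h2 := (Def.algWit Q).lift.comp
    (TermMap.select (str := pairFam L) (fun k => if k ∈ V then 1 else 0) id)
  refine ((h1.and h2).ex 1).toDef.congr fun p v => ?_
  constructor
  · rintro ⟨z, hz, hQ⟩
    refine ⟨p.1.coord z, hz, (AlgWit.congr fun k _ => ?_).1 hQ⟩
    by_cases hk : k ∈ V <;> simp [FieldStructure.coord, hk]
  · rintro ⟨z, hz, hQ⟩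
    refine ⟨p.1.asg z, hz, (AlgWit.congr fun k _ => ?_).1 hQ⟩
    by_cases hk : k ∈ V
    · simp only [FieldStructure.coord, hk, if_true]
      rfl
    · simp [FieldStructure.coord, hk]

/-- `AlgOver` is definable in pairs, so elementarity reflects it; hence independence over `P`
survives `e`. -/
theorem IsElementary.mem_acl_of {e : M.K → M'.K} (he : IsElementary P P' e) [CharZero M.K]
    [CharZero M'.K] (hP : P.Nonempty) (hP' : P'.Nonempty) {S : Set M.K} {x : M.K}
    (hx : e x ∈ M'.acl (P' ∪ e '' S)) : x ∈ M.acl (P ∪ S) := by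
  classical
  obtain ⟨Q, V, w, h0, hwx, hw, hQ⟩ := (mem_acl_union_iff hP').1 hx
  choose! f hfS hf using hw
  refine (mem_acl_union_iff hP).2 ⟨Q, V, Function.update f 0 x, h0, by simp,
    fun k hk hkV => by simpa [hk] using hfS k hk hkV, ?_⟩
  have h1 : AlgOver M' P' Q V (e ∘ Function.update f 0 x) := by
    refine hQ.congr fun k hkV => ?_
    by_cases hk : k = 0
    · simp [hk, hwx]
    · simp [hk, hf k hk hkV]
  exact (he.def_iff (Def.algOver Q V) (Function.update f 0 x)).2 h1

theorem IsElementary.isFree {e : M.K → M'.K} (he : IsElementary P P' e) [CharZero M.K]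
    [CharZero M'.K] (hP : P.Nonempty) (hP' : P'.Nonempty) {a : ι → M.K} {C : Set ι}
    (h : IsFree M P a C) : IsFree M' P' (e ∘ a) C := fun i hi hmem =>
  h i hi (he.mem_acl_of hP hP' (by rwa [Set.image_comp] at hmem))

/-- Partial isomorphisms between dense pairs, given by tuples: the tuples have the same type, and
they are algebraic over finitely many corresponding entries which belong to `P` or are independent
over `P`. -/
structure IsPartialIso (M M' : FieldStructure L) (P : Set M.K) (P' : Set M'.K) (a : ι → M.K)
    (a' : ι → M'.K) (B C : Set ι) : Prop where
  sameType : SameType M M' a a'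
  nonempty : B.Nonempty
  left : ∀ i ∈ B, a i ∈ P
  right : ∀ i ∈ B, a' i ∈ P'
  finite : C.Finite
  free_left : IsFree M P a C
  free_right : IsFree M' P' a' C
  gen : ∀ i, a i ∈ M.acl (a '' (B ∪ C))

namespace IsPartialIso

variable {a : ι → M.K} {a' : ι → M'.K} {B C : Set ι}

theorem symm (h : IsPartialIso M M' P P' a a' B C) [CharZero M.K] [CharZero M'.K] :
    IsPartialIso M' M P' P a' a B C :=
  ⟨h.sameType.symm, h.nonempty, h.right, h.left, h.finite, h.free_right, h.free_left,
    fun i => h.sameType.mem_acl (h.nonempty.mono Set.subset_union_left) (h.gen i)⟩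

/-- By freeness of `C`, an entry in `P` is algebraic over the entries from `B` alone. The `L`-type
sees this, so the corresponding entry is algebraic over elements of `P'`. -/
theorem mem_right (h : IsPartialIso M M' P P' a a' B C) [CharZero M.K] [CharZero M'.K]
    (hP' : M'.acl P' ⊆ P') {i : ι} (hi : a i ∈ P) : a' i ∈ P' := by
  have h1 := h.gen i
  rw [Set.image_union] at h1
  have h2 := h.free_left.mem_acl_of_mem (S := a '' B) (by rintro _ ⟨j, hj, rfl⟩; exact h.left j hj)
    hi h.finite subset_rfl h1
  refine hP' (M'.acl_mono ?_ (h.sameType.mem_acl h.nonempty h2))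
  rintro _ ⟨j, hj, rfl⟩
  exact h.right j hj

theorem mem_iff (h : IsPartialIso M M' P P' a a' B C) [CharZero M.K] [CharZero M'.K]
    (hP : M.acl P ⊆ P) (hP' : M'.acl P' ⊆ P') (i : ι) : a i ∈ P ↔ a' i ∈ P' :=
  ⟨h.mem_right hP', h.symm.mem_right hP⟩

end IsPartialIso

end BackAndForth

end TopFieldDer

namespace TopFieldDer

/-! ### Extending partial isomorphisms by one element -/

section Extension

variable {L : FieldLanguage.{u}} {K₀ : FieldStructure L} {χ : Formula L.lang}
  {M M' : FieldStructure L} {P : Set M.K} {P' : Set M'.K} {ι : Type}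

theorem image_elim'_some {α : Type*} (x : α) (a : ι → α) (S : Set ι) :
    Option.elim' x a '' (some '' S) = a '' S := by
  rw [Set.image_image]
  rfl

theorem IsFree.elim' {a : ι → M.K} {C : Set ι} (h : IsFree M P a C) (x : M.K) :
    IsFree M P (Option.elim' x a) (some '' C) := by
  rintro _ ⟨i, hi, rfl⟩
  rw [← Set.image_singleton, ← Set.image_sdiff (Option.some_injective _), image_elim'_some]
  exact h i hi

variable [IsEmpty L.Aux]

/-- The parameters are interleaved on even and odd indices, while the variable `0` is common to both
formulas. -/
theorem Formula.exists_and (θ θ' : Formula L.lang) (ρ ρ' : ℕ → ι) :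
    ∃ (θ'' : Formula L.lang) (ρ'' : ℕ → ι), ∀ (M : FieldStructure L) (a : ι → M.K) (y : M.K),
      θ''.Sat M.str (M.asg (Function.update (a ∘ ρ'') 0 y)) ↔
        θ.Sat M.str (M.asg (Function.update (a ∘ ρ) 0 y)) ∧
        θ'.Sat M.str (M.asg (Function.update (a ∘ ρ') 0 y)) := by
  obtain ⟨φ, hφ⟩ := θ.exists_rename fun k => if k = 0 then 0 else 2 * k
  obtain ⟨φ', hφ'⟩ := θ'.exists_rename fun k => if k = 0 then 0 else 2 * k + 1
  refine ⟨φ.and φ', fun k => if k % 2 = 0 then ρ (k / 2) else ρ' (k / 2), fun M a y => ?_⟩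
  rw [Formula.sat_and, hφ, hφ']
  have h1 : (Function.update (a ∘ fun k => if k % 2 = 0 then ρ (k / 2) else ρ' (k / 2)) 0 y) ∘
      (fun k => if k = 0 then 0 else 2 * k) = Function.update (a ∘ ρ) 0 y := by
    funext k
    by_cases hk : k = 0
    · simp [hk]
    · simp [hk]
  have h2 : (Function.update (a ∘ fun k => if k % 2 = 0 then ρ (k / 2) else ρ' (k / 2)) 0 y) ∘
      (fun k => if k = 0 then 0 else 2 * k + 1) = Function.update (a ∘ ρ') 0 y := by
    funext k
    by_cases hk : k = 0
    · simp [hk]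
    · have h1 : (2 * k + 1) / 2 = k := by omega
      have h2 : (2 * k + 1) % 2 = 1 := by omega
      simp [hk, h1, h2]
  rw [h1, h2]

/-- The type of an element over a tuple, together with further conditions, can be realized over a
corresponding tuple in an elementary extension. -/
theorem exists_extend [Nonempty ι] {a : ι → M.K} {a' : ι → M'.K} (x : M.K)
    (Ψ : Set (Formula L.pairLang × (ℕ → M'.K)))
    (hfin : ∀ (θ : Formula L.lang) (ρ : ℕ → ι),
      θ.Sat M.str (M.asg (Function.update (a ∘ ρ) 0 x)) → ∀ s : Finset Ψ,
        ∃ x' : M'.K, θ.Sat M'.str (M'.asg (Function.update (a' ∘ ρ) 0 x')) ∧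
          ∀ p ∈ s, p.1.1.Sat (M'.pairStr P') (M'.asg (Function.update p.1.2 0 x'))) :
    ∃ (M'' : FieldStructure L) (P'' : Set M''.K) (e : M'.K → M''.K) (x' : M''.K),
      IsElementary P' P'' e ∧ SameType M M'' (Option.elim' x a) (Option.elim' x' (e ∘ a')) ∧
        ∀ p ∈ Ψ, p.1.Sat (M''.pairStr P'') (M''.asg (Function.update (e ∘ p.2) 0 x')) := by
  classical
  choose lift hlift using fun θ : Formula L.lang => θ.exists_lift
  let Γ : Set (Formula L.pairLang × (ℕ → M'.K)) :=
    {p | ∃ (θ : Formula L.lang) (ρ : ℕ → ι), p = (lift θ, a' ∘ ρ) ∧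
      θ.Sat M.str (M.asg (Function.update (a ∘ ρ) 0 x))}
  -- As the type of `x` is closed under conjunction, a finite part of the conditions amounts to one
  -- formula `θ` and finitely many members of `Ψ`.
  have key : ∀ s : Finset (Γ ∪ Ψ : Set (Formula L.pairLang × (ℕ → M'.K))),
      ∃ (θ : Formula L.lang) (ρ : ℕ → ι) (t : Finset Ψ),
        θ.Sat M.str (M.asg (Function.update (a ∘ ρ) 0 x)) ∧ ∀ x' : M'.K,
          θ.Sat M'.str (M'.asg (Function.update (a' ∘ ρ) 0 x')) →
          (∀ p ∈ t, p.1.1.Sat (M'.pairStr P') (M'.asg (Function.update p.1.2 0 x'))) →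
          ∀ p ∈ s, p.1.1.Sat (M'.pairStr P') (M'.asg (Function.update p.1.2 0 x')) := by
    intro s
    induction s using Finset.induction_on with
    | empty =>
      exact ⟨.imp .falsum .falsum, fun _ => Classical.arbitrary ι, ∅, fun h => h, by simp⟩
    | insert p s _ ih =>
      obtain ⟨θ, ρ, t, hθ, h⟩ := ih
      obtain ⟨p, ⟨θ', ρ', rfl, hθ'⟩ | hp⟩ := p
      · obtain ⟨θ'', ρ'', h''⟩ := Formula.exists_and θ θ' ρ ρ'
        refine ⟨θ'', ρ'', t, (h'' M a x).2 ⟨hθ, hθ'⟩, fun x' hx' ht q hq => ?_⟩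
        rcases Finset.mem_insert.1 hq with rfl | hq
        · exact (hlift θ' M' P' _).2 ((h'' M' a' x').1 hx').2
        · exact h x' ((h'' M' a' x').1 hx').1 ht q hq
      · refine ⟨θ, ρ, insert ⟨p, hp⟩ t, hθ, fun x' hx' ht q hq => ?_⟩
        rcases Finset.mem_insert.1 hq with rfl | hq
        · exact ht ⟨p, hp⟩ (Finset.mem_insert_self _ _)
        · exact h x' hx' (fun r hr => ht r (Finset.mem_insert_of_mem hr)) q hq
  obtain ⟨M'', P'', e, x', he, hx'⟩ := exists_realization M' P' (Γ ∪ Ψ) (fun s => by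
    obtain ⟨θ, ρ, t, hθ, h⟩ := key s
    obtain ⟨x', h1, h2⟩ := hfin θ ρ hθ t
    exact ⟨x', h x' h1 h2⟩)
  -- One inclusion of types is enough, by negation. Variables assigned the new element become
  -- variable `0`, and the others are shifted by one to make room.
  have hdir : ∀ (φ : Formula L.lang) (ρ : ℕ → Option ι),
      φ.Sat M.str (M.asg (Option.elim' x a ∘ ρ)) →
        φ.Sat M''.str (M''.asg (Option.elim' x' (e ∘ a') ∘ ρ)) := by
    intro φ ρ hφ
    obtain ⟨θ, hθ⟩ := φ.exists_rename fun k => if ρ k = none then 0 else k + 1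
    have hcomp : ∀ (N : FieldStructure L) (b : ι → N.K) (y : N.K), Function.update
        (b ∘ fun k => (ρ (k - 1)).getD (Classical.arbitrary ι)) 0 y ∘
          (fun k => if ρ k = none then 0 else k + 1) = Option.elim' y b ∘ ρ := by
      intro N b y
      funext k
      rcases hk : ρ k with _ | i
      · simp [hk]
      · simp [hk]
    have h1 := hx' (lift θ, a' ∘ fun k => (ρ (k - 1)).getD (Classical.arbitrary ι))
      (.inl ⟨θ, _, rfl, by rw [hθ, hcomp]; exact hφ⟩)
    have h2 := (hθ M'' _).1 ((hlift θ M'' P'' _).1 h1)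
    rwa [← Function.comp_assoc, hcomp] at h2
  refine ⟨M'', P'', e, x', he, fun φ ρ => ⟨hdir φ ρ, fun h => ?_⟩, fun p hp => hx' p (.inr hp)⟩
  by_contra hno
  have := hdir φ.neg ρ (Formula.sat_neg.2 hno)
  rw [Formula.sat_neg] at this
  exact this h

/-- An element of a finite definable set is algebraic over the parameters. -/
theorem IsOpenTheory.infinite_of_notMem_acl (hT : IsOpenTheory K₀ χ) (hM : M.IsModelOf K₀)
    (hM' : M'.IsModelOf K₀) {a : ι → M.K} {a' : ι → M'.K} (h : SameType M M' a a') {x : M.K}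
    (hx : x ∉ M.acl (Set.range a)) {θ : Formula L.lang} {ρ : ℕ → ι}
    (hθ : θ.Sat M.str (M.asg (Function.update (a ∘ ρ) 0 x))) :
    (M'.str.solutions θ (M'.asg (a' ∘ ρ)) none 0).Infinite := by
  have := hT.charZero_of_model hM
  obtain ⟨N, hN⟩ := hT.exists_bound θ 0
  have hinf : (M.str.solutions θ (M.asg (a ∘ ρ)) none 0).Infinite := by
    obtain ⟨𝒬, h𝒬⟩ := hT.exists_algWit_or_near θ
    rcases h𝒬 M hM _ hθ with ⟨Q, -, hQ⟩ | ⟨z, hz⟩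
    · refine absurd ((M.mem_acl_iff (Set.range_nonempty_iff_nonempty.2 ⟨ρ 0⟩)).2
        ⟨Q, _, ?_, fun k hk => ?_, hQ⟩) hx
      · simp
      · simp [hk]
    · refine ((hT.nhdAxioms hM).infinite_near z x).mono fun y hy => ?_
      have := hz y (by simpa using hy)
      rw [M.assign_asg, Function.update_idem, ← M.assign_asg] at this
      exact this
  -- Having more than `N` elements belongs to the type, and by the choice of `N` it means being
  -- infinite.
  have h1 := (h.def_iff (Def.cardLe θ 0 (N + 1)) ρ).1 (by rw [hinf.encard_eq]; exact le_top)
  intro hf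
  have h2 := hN M' hM' _ hf
  rw [← hf.cast_ncard_eq] at h1
  have h3 : N + 1 ≤ (M'.str.solutions θ (M'.asg (a' ∘ ρ)) none 0).ncard := by exact_mod_cast h1
  omega

variable {a : ι → M.K} {a' : ι → M'.K} {B C : Set ι}

/-- Partial isomorphisms into an elementary extension which extend a given one to the elements
of `X`. -/
def CanExtend (M M' : FieldStructure L) (P : Set M.K) (P' : Set M'.K) (a : ι → M.K)
    (a' : ι → M'.K) (X : Set M.K) : Prop :=
  ∃ (M'' : FieldStructure L) (P'' : Set M''.K) (e : M'.K → M''.K) (κ : Type) (j : ι → κ)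
    (b : κ → M.K) (b' : κ → M''.K) (B C : Set κ), IsElementary P' P'' e ∧
      IsPartialIso M M'' P P'' b b' B C ∧ b ∘ j = a ∧ b' ∘ j = e ∘ a' ∧ X ⊆ Set.range b

theorem range_elim' {α : Type*} (x : α) (a : ι → α) :
    Set.range (Option.elim' x a) = insert x (Set.range a) := by
  ext y
  constructor
  · rintro ⟨_ | i, rfl⟩
    · exact .inl rfl
    · exact .inr ⟨i, rfl⟩
  · rintro (rfl | ⟨i, rfl⟩)
    · exact ⟨none, rfl⟩
    · exact ⟨some i, rfl⟩

/-- Bookkeeping common to the three one-point extensions; the new element has the index `none`. -/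
theorem IsPartialIso.elim' (h : IsPartialIso M M' P P' a a' B C) [CharZero M.K]
    {M'' : FieldStructure L} {P'' : Set M''.K} {e : M'.K → M''.K} {x : M.K} {x' : M''.K}
    (he : IsElementary P' P'' e)
    (hst : SameType M M'' (Option.elim' x a) (Option.elim' x' (e ∘ a')))
    {B' C' : Set (Option ι)} (hB : some '' B ⊆ B') (hC : some '' C ⊆ C')
    (hl : ∀ i ∈ B', Option.elim' x a i ∈ P) (hr : ∀ i ∈ B', Option.elim' x' (e ∘ a') i ∈ P'')
    (hf : C'.Finite) (hfl : IsFree M P (Option.elim' x a) C')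
    (hfr : IsFree M'' P'' (Option.elim' x' (e ∘ a')) C')
    (hx : x ∈ M.acl (Option.elim' x a '' (B' ∪ C'))) : CanExtend M M' P P' a a' {x} := by
  refine ⟨M'', P'', e, Option ι, some, _, _, B', C', he,
    ⟨hst, (h.nonempty.image _).mono hB, hl, hr, hf, hfl, hfr, ?_⟩, rfl, rfl,
    by rw [range_elim']; simp⟩
  rintro (_ | i)
  · exact hx
  · refine M.acl_mono ?_ (h.gen i)
    rw [← image_elim'_some x a, Set.image_union]
    exact Set.image_mono (Set.union_subset_union hB hC)

theorem IsElementary.map_mem {e : M.K → M'.K} (he : IsElementary P P' e) (x : M.K) :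
    x ∈ P ↔ e x ∈ P' :=
  he.def_iff (Def.pred 0) fun _ => x

variable (hT : IsOpenTheory K₀ χ) (hP : IsDensePair K₀ M P) (hP' : IsDensePair K₀ M' P')
  (h : IsPartialIso M M' P P' a a' B C)

include hT hP hP' h

/-- Solvability of each formula satisfied by `x` is part of the type of the tuple, so the type can
be realized; `B` and `C` generate as before. -/
theorem IsPartialIso.canExtend_of_mem_acl {x : M.K} (hx : x ∈ M.acl (Set.range a)) :
    CanExtend M M' P P' a a' {x} := by
  have := hT.charZero_of_model hP.model
  have := hT.charZero_of_model hP'.model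
  have : Nonempty ι := h.nonempty.to_type
  obtain ⟨M'', P'', e, x', he, hst, -⟩ := exists_extend (P' := P') (a := a) (a' := a') x ∅
    (fun θ ρ hθ s => by
      have h1 := (h.sameType.def_iff (Def.ex (str := fieldStr L)
        (R := fun M v => θ.Sat M.str v) ⟨θ, fun _ _ => Iff.rfl⟩ none 0) ρ).1
        ⟨x, by rw [M.assign_asg]; exact hθ⟩
      obtain ⟨x', hx'⟩ := h1
      rw [M'.assign_asg] at hx'
      exact ⟨x', hx', fun p _ => p.2.elim⟩)
  have hP'' := hP'.of_isElementary hT he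
  have := hT.charZero_of_model hP''.model
  refine h.elim' he hst subset_rfl subset_rfl ?_ ?_ (h.finite.image _) (h.free_left.elim' x)
    ((he.isFree hP'.nonempty hP''.nonempty h.free_right).elim' x') ?_
  · rintro _ ⟨i, hi, rfl⟩
    exact h.left i hi
  · rintro _ ⟨i, hi, rfl⟩
    exact (he.map_mem _).1 (h.right i hi)
  · rw [← Set.image_union, image_elim'_some]
    refine M.acl_subset_acl ?_ hx
    rintro _ ⟨i, rfl⟩
    exact h.gen i

/-- If `x` is not algebraic over the tuple, each formula of its type has infinitely many solutions
on the other side, and density puts one of them into `P'`. The new index joins `B`. -/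
theorem IsPartialIso.canExtend_of_mem {x : M.K} (hx : x ∈ P) :
    CanExtend M M' P P' a a' {x} := by
  by_cases hxa : x ∈ M.acl (Set.range a)
  · exact h.canExtend_of_mem_acl hT hP hP' hxa
  have := hT.charZero_of_model hP.model
  have := hT.charZero_of_model hP'.model
  have : Nonempty ι := h.nonempty.to_type
  obtain ⟨ψ, hψ⟩ := Def.pred (L := L) 0
  obtain ⟨M'', P'', e, x', he, hst, hx'⟩ := exists_extend (P' := P') (a := a) (a' := a') x
    {(ψ, fun _ => 0)} (fun θ ρ hθ s => by
      obtain ⟨x', hx', h1⟩ := hP'.dense θ _ 0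
        (hT.infinite_of_notMem_acl hP.model hP'.model h.sameType hxa hθ)
      refine ⟨x', ?_, ?_⟩
      · rw [← M'.assign_asg]
        exact h1
      · rintro ⟨p, rfl⟩ -
        refine (hψ ⟨M', P'⟩ _).2 ?_
        simpa using hx')
  have hx' := (hψ ⟨M'', P''⟩ _).1 (hx' _ rfl)
  simp only [FieldStructure.coord_asg, Function.update_self] at hx'
  have hP'' := hP'.of_isElementary hT he
  have := hT.charZero_of_model hP''.model
  refine h.elim' (B' := insert none (some '' B)) he hst (Set.subset_insert _ _) subset_rfl ?_ ?_
    (h.finite.image _) (h.free_left.elim' x)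
    ((he.isFree hP'.nonempty hP''.nonempty h.free_right).elim' x') ?_
  · rintro _ (rfl | ⟨i, hi, rfl⟩)
    · exact hx
    · exact h.left i hi
  · rintro _ (rfl | ⟨i, hi, rfl⟩)
    · exact hx'
    · exact (he.map_mem _).1 (h.right i hi)
  · exact M.subset_acl _ ⟨none, .inl (.inl rfl), rfl⟩

/-- The partner must be independent over the predicate and the tuple. Finitely many instances of
this are met by `IsDensePair.exists_not_algOver`, and compactness supplies the rest. The new index
joins `C`. -/
theorem IsPartialIso.canExtend_of_notMem_acl {x : M.K} (hx : x ∉ M.acl (P ∪ Set.range a)) :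
    CanExtend M M' P P' a a' {x} := by
  classical
  have := hT.charZero_of_model hP.model
  have := hT.charZero_of_model hP'.model
  have : Nonempty ι := h.nonempty.to_type
  have hxa : x ∉ M.acl (Set.range a) := fun hxa => hx (M.acl_mono Set.subset_union_right hxa)
  choose ψ hψ using fun q : JetPoly L × Set ℕ => Def.algOver q.1 q.2
  obtain ⟨M'', P'', e, x', he, hst, hx'⟩ := exists_extend (P' := P') (a := a) (a' := a') x
    {p | ∃ (Q : JetPoly L) (V : Set ℕ), 0 ∉ V ∧ p.1 = (ψ (Q, V)).neg} (fun θ ρ hθ s => by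
      choose Q V hV hpQ using fun p : {p : Formula L.pairLang × (ℕ → M'.K) |
        ∃ (Q : JetPoly L) (V : Set ℕ), 0 ∉ V ∧ p.1 = (ψ (Q, V)).neg} => p.2
      obtain ⟨x', h1, h2⟩ := hP'.exists_not_algOver hT θ _
        (hT.infinite_of_notMem_acl hP.model hP'.model h.sameType hxa hθ)
        (s.image fun p => (Q p, V p, p.1.2)) (by
          intro b hb
          obtain ⟨p, -, rfl⟩ := Finset.mem_image.1 hb
          exact hV p)
      refine ⟨x', ?_, fun p hp => ?_⟩
      · rw [← M'.assign_asg]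
        exact h1
      · rw [hpQ p, Formula.sat_neg, hψ (Q p, V p) ⟨M', P'⟩]
        exact h2 _ (Finset.mem_image_of_mem _ hp))
  have hP'' := hP'.of_isElementary hT he
  have := hT.charZero_of_model hP''.model
  have hxC' : x' ∉ M''.acl (P'' ∪ (e ∘ a') '' C) := by
    intro hmem
    obtain ⟨Q, V, w, h0, hwx, hw, hQ⟩ := (mem_acl_union_iff hP''.nonempty).1 hmem
    choose! ρ hρC hρ using hw
    have := hx' ((ψ (Q, V)).neg, a' ∘ ρ) ⟨Q, V, h0, rfl⟩
    rw [Formula.sat_neg, hψ (Q, V) ⟨M'', P''⟩] at this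
    refine this (hQ.congr fun k hkV => ?_)
    by_cases hk : k = 0
    · simp [hk, hwx]
    · have := hρ k hk hkV
      simpa [hk] using this.symm
  have hxC : x ∉ M.acl (P ∪ a '' C) := fun hmem =>
    hx (M.acl_mono (Set.union_subset_union_right _ (Set.image_subset_range _ _)) hmem)
  refine h.elim' (C' := insert none (some '' C)) he hst subset_rfl (Set.subset_insert _ _) ?_ ?_
    ((h.finite.image _).insert _)
    ((h.free_left.elim' x).insert (by rwa [image_elim'_some]))
    (((he.isFree hP'.nonempty hP''.nonempty h.free_right).elim' x').insert
      (by rwa [image_elim'_some])) ?_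
  · rintro _ ⟨i, hi, rfl⟩
    exact h.left i hi
  · rintro _ ⟨i, hi, rfl⟩
    exact (he.map_mem _).1 (h.right i hi)
  · exact M.subset_acl _ ⟨none, .inr (.inl rfl), rfl⟩

theorem IsPartialIso.canExtend_finset (Z : Finset M.K)
    (hZ : (Z : Set M.K) ⊆ P ∪ Set.range a) : CanExtend M M' P P' a a' Z := by
  classical
  induction Z using Finset.induction_on with
  | empty =>
    exact ⟨M', P', id, ι, id, a, a', B, C, IsElementary.refl P', h, rfl, rfl, by simp⟩
  | insert z Z _ ih =>
    rw [Finset.coe_insert] at hZ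
    obtain ⟨M₁, P₁, e, κ, j, b, b', B₁, C₁, he, h₁, hb, hb', hsub⟩ :=
      ih ((Set.subset_insert _ _).trans hZ)
    by_cases hz : z ∈ Set.range b
    · exact ⟨M₁, P₁, e, κ, j, b, b', B₁, C₁, he, h₁, hb, hb', by
        rw [Finset.coe_insert]
        exact Set.insert_subset hz hsub⟩
    · have hzP : z ∈ P := (hZ (Set.mem_insert _ _)).resolve_right (by
        rintro ⟨i, rfl⟩
        exact hz ⟨j i, congrFun hb i⟩)
      obtain ⟨M₂, P₂, e', κ', j', c, c', B₂, C₂, he', h₂, hc, hc', hsub'⟩ :=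
        h₁.canExtend_of_mem hT hP (hP'.of_isElementary hT he) hzP
      refine ⟨M₂, P₂, e' ∘ e, κ', j' ∘ j, c, c', B₂, C₂, he'.comp he, h₂, ?_, ?_, ?_⟩
      · rw [← Function.comp_assoc, hc, hb]
      · rw [← Function.comp_assoc, hc', Function.comp_assoc, hb']
        rfl
      · rw [Finset.coe_insert]
        refine Set.insert_subset (hsub' rfl) (hsub.trans ?_)
        rw [← hc]
        exact Set.range_comp_subset_range _ _

/-- If `x` is algebraic over `P` and the tuple, finitely many elements suffice for it; those from
`P` are adjoined first, and then `x` is algebraic over the tuple. -/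
theorem IsPartialIso.canExtend (x : M.K) : CanExtend M M' P P' a a' {x} := by
  by_cases hx : x ∈ M.acl (P ∪ Set.range a)
  · have := hT.charZero_of_model hP.model
    obtain ⟨Z, hZ, hxZ⟩ :=
      M.exists_finite_of_mem_acl (hP.nonempty.mono Set.subset_union_left) hx
    obtain ⟨M₁, P₁, e, κ, j, b, b', B₁, C₁, he, h₁, hb, hb', hsub⟩ :=
      h.canExtend_finset hT hP hP' Z hZ
    obtain ⟨M₂, P₂, e', κ', j', c, c', B₂, C₂, he', h₂, hc, hc', hsub'⟩ :=
      h₁.canExtend_of_mem_acl hT hP (hP'.of_isElementary hT he) (M.acl_mono hsub hxZ)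
    refine ⟨M₂, P₂, e' ∘ e, κ', j' ∘ j, c, c', B₂, C₂, he'.comp he, h₂, ?_, ?_, hsub'⟩
    · rw [← Function.comp_assoc, hc, hb]
    · rw [← Function.comp_assoc, hc', Function.comp_assoc, hb']
      rfl
  · exact h.canExtend_of_notMem_acl hT hP hP' hx

end Extension

end TopFieldDer

namespace TopFieldDer

/-! The theory of dense pairs of distinct fields is complete. -/

section Complete

variable {L : FieldLanguage.{u}}

/-- Equations, and relations other than the predicate, belong to the language `L`. -/
theorem exists_formula_of_terms {s : L.pairLang.Sorts} (t t' : Term L.pairLang s) :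
    ∃ φ : Formula L.lang, ∀ (M : FieldStructure L) (P : Set M.K) (v : M.str.Assignment),
      φ.Sat M.str v ↔ (Formula.eq t t').Sat (M.pairStr P) v := by
  choose tr htr using fun t : Term L.pairLang s => Term.exists_translation
    (ι := Σ M : FieldStructure L, Set M.K) (F := L.Fun) (F' := L.Fun)
    (R := L.PairRel) (R' := L.Rel) (c := fun p => p.1.carrier)
    (ne := fun p => p.1.carrier_nonempty) (fn := fun p => p.1.interp) (fn' := fun p => p.1.interp)
    (rl := fun p => p.1.interpPair p.2) (rl' := fun p => p.1.rl) id (fun _ _ _ _ _ => rfl) t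
  exact ⟨.eq (L := L.lang) (tr t) (tr t'), fun M P v =>
    iff_of_eq (congrArg₂ Eq (htr t ⟨M, P⟩ v) (htr t' ⟨M, P⟩ v))⟩

theorem exists_formula_of_rel {d : List (Option L.Aux)} (r : L.Rel d)
    (t : ∀ j : Fin d.length, Term L.pairLang (d.get j)) :
    ∃ φ : Formula L.lang, ∀ (M : FieldStructure L) (P : Set M.K) (v : M.str.Assignment),
      φ.Sat M.str v ↔ (Formula.rel (L := L.pairLang) (.base r) t).Sat (M.pairStr P) v := by
  choose tr htr using fun j => Term.exists_translation
    (ι := Σ M : FieldStructure L, Set M.K) (F := L.Fun) (F' := L.Fun)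
    (R := L.PairRel) (R' := L.Rel) (c := fun p => p.1.carrier)
    (ne := fun p => p.1.carrier_nonempty) (fn := fun p => p.1.interp) (fn' := fun p => p.1.interp)
    (rl := fun p => p.1.interpPair p.2) (rl' := fun p => p.1.rl) id (fun _ _ _ _ _ => rfl) (t j)
  exact ⟨.rel (L := L.lang) r tr, fun M P v =>
    iff_of_eq (congrArg (M.rl r) (funext fun j => htr j ⟨M, P⟩ v))⟩

variable [IsEmpty L.Aux] {K₀ : FieldStructure L} {χ : Formula L.lang}

theorem FieldStructure.asg_comp_update {M : FieldStructure L} {ι κ : Type} {a : ι → M.K}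
    {b : κ → M.K} {j : ι → κ} (hb : b ∘ j = a) (ρ : ℕ → ι) (n : ℕ) (k : κ) :
    M.asg (b ∘ Function.update (j ∘ ρ) n k) = M.str.assign (M.asg (a ∘ ρ)) none n (b k) := by
  rw [M.assign_asg, ← hb]
  congr 1
  funext i
  by_cases hi : i = n
  · subst hi
    simp
  · simp [hi]

/-- Partial isomorphisms are elementary. -/
theorem IsPartialIso.sat_iff (hT : IsOpenTheory K₀ χ) (φ : Formula L.pairLang)
    {M M' : FieldStructure L} {P : Set M.K} {P' : Set M'.K} (hP : IsDensePair K₀ M P)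
    (hP' : IsDensePair K₀ M' P') {ι : Type} {a : ι → M.K} {a' : ι → M'.K} {B C : Set ι}
    (h : IsPartialIso M M' P P' a a' B C) (ρ : ℕ → ι) :
    φ.Sat (M.pairStr P) (M.asg (a ∘ ρ)) ↔ φ.Sat (M'.pairStr P') (M'.asg (a' ∘ ρ)) := by
  induction φ generalizing M M' ι with
  | falsum => exact Iff.rfl
  | eq t t' =>
    obtain ⟨ψ, hψ⟩ := exists_formula_of_terms t t'
    rw [← hψ, ← hψ]
    exact h.sameType ψ ρ
  | rel r t =>
    cases r with
    | base r =>
      obtain ⟨ψ, hψ⟩ := exists_formula_of_rel r t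
      exact (hψ M P _).symm.trans ((h.sameType ψ ρ).trans (hψ M' P' _))
    | pred =>
      have := hT.charZero_of_model hP.model
      have := hT.charZero_of_model hP'.model
      let x : M.K := (t (0 : Fin 1)).eval (M.pairStr P) (M.asg (a ∘ ρ))
      let y : M'.K := (t (0 : Fin 1)).eval (M'.pairStr P') (M'.asg (a' ∘ ρ))
      change x ∈ P ↔ y ∈ P'
      -- The value of the term need not be an entry of the tuple, so it is adjoined. A fresh
      -- variable `n` names it, and the equation with the term, being part of the `L`-type,
      -- identifies its partner as `e y`.
      obtain ⟨M'', P'', e, κ, j, b, b', B', C', he, h', hb, hb', hx⟩ := h.canExtend hT hP hP' x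
      obtain ⟨k, hk⟩ := hx rfl
      have hP'' := hP'.of_isElementary hT he
      have := hT.charZero_of_model hP''.model
      obtain ⟨S, hS⟩ := (t (0 : Fin 1)).exists_support
      obtain ⟨n, hn⟩ := Infinite.exists_notMem_finset (S.image Prod.snd)
      have hfresh : ∀ (N : FieldStructure L) (Q : Set N.K) (v : N.str.Assignment) (c : N.K),
          (t (0 : Fin 1)).eval (N.pairStr Q) (N.str.assign v none n c) =
            (t (0 : Fin 1)).eval (N.pairStr Q) v := by
        intro N Q v c
        refine hS (N.pairStr Q) _ _ fun z hz => Structure.assign_of_ne (M := N.str) _ _ ?_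
        rintro rfl
        exact hn (Finset.mem_image_of_mem _ hz)
      obtain ⟨ψ, hψ⟩ := exists_formula_of_terms (.var none n) (t (0 : Fin 1))
      have h1 : (Formula.eq (.var none n) (t (0 : Fin 1))).Sat (M.pairStr P)
          (M.asg (b ∘ Function.update (j ∘ ρ) n k)) := by
        rw [M.asg_comp_update hb]
        refine Eq.trans ?_ (hfresh M P _ _).symm
        exact (Structure.assign_self (M := M.str) _ _ _ _).trans hk
      have h2 := (hψ M'' P'' _).1 ((h'.sameType ψ _).1 ((hψ M P _).2 h1))
      rw [M''.asg_comp_update hb'] at h2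
      have h3 : b' k = e y := by
        refine (Structure.assign_self (M := M''.str) (M''.asg ((e ∘ a') ∘ ρ)) none n
          (b' k)).symm.trans (Eq.trans h2 ?_)
        refine (hfresh M'' P'' _ _).trans ?_
        have h4 : (Formula.eq (.var none n) (t (0 : Fin 1))).Sat (M'.pairStr P')
            (M'.asg (Function.update (a' ∘ ρ) n y)) := by
          rw [← M'.assign_asg]
          exact (Structure.assign_self (M := M'.str) _ _ _ _).trans (hfresh M' P' _ _).symm
        have h5 := (he _ _).1 h4
        have h6 : e ∘ Function.update (a' ∘ ρ) n y = Function.update ((e ∘ a') ∘ ρ) n (e y) :=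
          Function.comp_update _ _ _ _
        rw [h6, ← M''.assign_asg] at h5
        exact (hfresh M'' P'' _ _).symm.trans
          (h5.symm.trans (Structure.assign_self (M := M''.str) _ _ _ _))
      rw [← hk, h'.mem_iff hP.acl_subset hP''.acl_subset k, h3, ← he.map_mem]
  | imp φ ψ ih ih' => exact imp_congr (ih hP hP' h ρ) (ih' hP hP' h ρ)
  | all s n φ ih =>
    -- By symmetry one direction is enough. An element of `M` gets a partner in an elementary
    -- extension of `M'`, where the universal statement still holds.
    have key : ∀ {M M' : FieldStructure L} {P : Set M.K} {P' : Set M'.K},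
        IsDensePair K₀ M P → IsDensePair K₀ M' P' → ∀ {a : ι → M.K} {a' : ι → M'.K} {B C : Set ι},
        IsPartialIso M M' P P' a a' B C →
        (Formula.all s n φ).Sat (M'.pairStr P') (M'.asg (a' ∘ ρ)) →
          (Formula.all s n φ).Sat (M.pairStr P) (M.asg (a ∘ ρ)) := by
      intro M M' P P' hP hP' a a' B C h hall
      rcases s with _ | s
      · intro x
        obtain ⟨M'', P'', e, κ, j, b, b', B', C', he, h', hb, hb', hx⟩ := h.canExtend hT hP hP' x
        obtain ⟨k, rfl⟩ := hx rfl
        have h1 := ih hP (hP'.of_isElementary hT he) h' (Function.update (j ∘ ρ) n k)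
        rw [M.asg_comp_update hb, M''.asg_comp_update hb'] at h1
        exact h1.2 ((he _ _).1 hall (b' k))
      · exact (IsEmpty.false s).elim
    have := hT.charZero_of_model hP.model
    have := hT.charZero_of_model hP'.model
    exact ⟨key hP' hP h.symm, key hP hP' h⟩

/-- The back-and-forth starts from the element `0`. Since `0` is a term, its type consists of
sentences, which the complete theory `T` decides. -/
theorem IsDensePair.exists_isPartialIso {M M' : FieldStructure L} {P : Set M.K} {P' : Set M'.K}
    (hT : IsOpenTheory K₀ χ) (hP : IsDensePair K₀ M P) (hP' : IsDensePair K₀ M' P') :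
    IsPartialIso M M' P P' (fun _ : Unit => 0) (fun _ => 0) Set.univ ∅ := by
  have := hT.charZero_of_model hP.model
  refine ⟨fun φ ρ => ?_, Set.univ_nonempty, fun i _ => hP.mem_subfield.1 (zero_mem _),
    fun i _ => hP'.mem_subfield.1 (zero_mem _), Set.finite_empty, by simp [IsFree],
    by simp [IsFree], fun i => M.subset_acl _ ⟨i, by simp⟩⟩
  obtain ⟨φ₀, h₀⟩ := φ.exists_subst (Λ := L.lang) (fun
    | (none, _) => Term.zero
    | (some a, n) => .var (L := L.lang) (some a) n)
  have h : ∀ (N : FieldStructure L) (v : N.str.Assignment),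
      φ₀.Sat N.str v ↔ φ.Sat N.str (N.asg fun _ => 0) := by
    intro N v
    refine (h₀ N.str v).trans (iff_of_eq (congrArg (φ.Sat N.str ·) ?_))
    funext x
    rcases x with ⟨_ | a, n⟩
    · rfl
    · exact (IsEmpty.false a).elim
  have hcase : ∀ (N : FieldStructure L), N.IsModelOf K₀ →
      (φ.Sat N.str (N.asg fun _ => 0) ↔ φ.Sat K₀.str (K₀.asg fun _ => 0)) := by
    intro N hN
    constructor
    · intro hφ
      by_contra hno
      have := hN φ₀.neg (fun v => Formula.sat_neg.2 fun hv => hno ((h K₀ v).1 hv))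
        (N.asg fun _ => 0)
      rw [Formula.sat_neg] at this
      exact this ((h N _).2 hφ)
    · intro hφ
      exact (h N (N.asg fun _ => 0)).1 (hN φ₀ (fun v => (h K₀ v).2 hφ) _)
  exact (hcase M hP.model).trans (hcase M' hP'.model).symm

theorem IsDensePair.def_iff {M M' : FieldStructure L} {P : Set M.K} {P' : Set M'.K}
    (hT : IsOpenTheory K₀ χ) (hP : IsDensePair K₀ M P) (hP' : IsDensePair K₀ M' P')
    {Q : (Σ M : FieldStructure L, Set M.K) → Prop} (hQ : Def (pairFam L) fun p _ => Q p) :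
    Q ⟨M, P⟩ ↔ Q ⟨M', P'⟩ := by
  obtain ⟨φ, hφ⟩ := hQ
  exact (hφ ⟨M, P⟩ _).symm.trans (((hP.exists_isPartialIso hT hP').sat_iff hT φ hP hP'
    fun _ => ()).trans (hφ ⟨M', P'⟩ _))

/-- One model of `T_δ^*` is enough: with the kernel of its derivation as predicate it is a proper
dense pair, and completeness carries its bounds to all others. The remaining pairs, with `P` the
whole field, obey the bound for `T`. -/
theorem IsOpenTheory.eliminatesExistsInfinity_tPair (hT : IsOpenTheory K₀ χ)
    (hcons : ∃ N : Structure L.deltaLang, TDeltaStar K₀ χ N) :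
    EliminatesExistsInfinity (none : L.pairLang.Sorts) (TPair K₀) := by
  intro φ n
  obtain ⟨_, M', δ, -, hM', hc, hDL⟩ := hcons
  have hG : IsGenericDerivation K₀ χ M' δ := ⟨hM', hc, hDL⟩
  obtain ⟨φδ, hφδ⟩ := φ.exists_delta
  obtain ⟨N₁, hN₁⟩ := hT.eliminatesExistsInfinity_tDeltaStar φδ n
  obtain ⟨φu, hφu⟩ := φ.exists_univ
  obtain ⟨N₂, hN₂⟩ := hT.exists_bound φu n
  refine ⟨max N₁ N₂, ?_⟩
  rintro _ ⟨M, P, rfl, hM, hacl, hdense⟩ v hf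
  have := hT.charZero_of_model hM
  by_cases hne : ∃ x, x ∉ P
  · refine le_trans ?_ (le_max_left _ _)
    have hP : IsDensePair K₀ M P := ⟨hM, hacl.1, hacl.acl_subset, hdense, hne⟩
    set k := ((M.pairStr P).solutions φ v none n).ncard with hk
    by_contra hlt
    obtain ⟨α, hα⟩ := φ.exists_card_le (Λ := L.pairLang) none n k
    obtain ⟨β, hβ⟩ := φ.exists_card_le (Λ := L.pairLang) none n (k + 1)
    -- That some parameters give exactly `k` solutions is a sentence, so the size `k` also occurs in
    -- the pair made from the derivation, where it is at most `N₁`.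
    have hQ : Def (pairFam L) fun p _ => ∃ w : (pairFam L p).Assignment,
        (k : ℕ∞) ≤ ((pairFam L p).solutions φ w none n).encard ∧
          ¬ ((k + 1 : ℕ) : ℕ∞) ≤ ((pairFam L p).solutions φ w none n).encard :=
      (Def.and ⟨α, fun p w => hα (pairFam L p) w⟩
        (Def.not ⟨β, fun p w => hβ (pairFam L p) w⟩)).exAll
    obtain ⟨w, hw1, hw2⟩ := (hP.def_iff hT (hG.isDensePair hT) hQ).1 ⟨v, by
      change _ ≤ ((M.pairStr P).solutions φ v none n).encard
      rw [← hf.cast_ncard_eq, hk], by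
      change ¬ _ ≤ ((M.pairStr P).solutions φ v none n).encard
      rw [← hf.cast_ncard_eq, ← hk]
      exact_mod_cast Nat.not_succ_le_self k⟩
    have hsol : (M'.deltaStr δ).solutions φδ w none n =
        (M'.pairStr {x | δ x = 0}).solutions φ w none n :=
      Set.ext fun x => hφδ M' δ _
    have hfin : ((M'.pairStr {x | δ x = 0}).solutions φ w none n).Finite := by
      by_contra hinf
      exact hw2 (le_top.trans (Set.Infinite.encard_eq hinf).ge)
    have h1 := hN₁ (M'.deltaStr δ) ⟨M', δ, rfl, hM', hc, hDL⟩ w (by rw [hsol]; exact hfin)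
    rw [hsol] at h1
    change (k : ℕ∞) ≤ ((M'.pairStr {x | δ x = 0}).solutions φ w none n).encard at hw1
    rw [← hfin.cast_ncard_eq] at hw1
    have h2 : k ≤ ((M'.pairStr {x | δ x = 0}).solutions φ w none n).ncard := by
      exact_mod_cast hw1
    omega
  · refine le_trans ?_ (le_max_right _ _)
    obtain rfl : P = Set.univ := Set.eq_univ_of_forall fun x => by
      by_contra hx
      exact hne ⟨x, hx⟩
    have hsol : M.str.solutions φu v none n = (M.pairStr Set.univ).solutions φ v none n :=
      Set.ext fun x => hφu M _
    rw [← hsol] at hf ⊢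
    exact hN₂ M hM v hf

end Complete

end TopFieldDer

theorem theoremA6 {L : TopFieldDer.FieldLanguage.{u}} (K₀ : TopFieldDer.FieldStructure L)
    (χ : TopFieldDer.Formula L.lang) (hT : TopFieldDer.IsOpenTheory K₀ χ) :
    TopFieldDer.EliminatesExistsInfinity (none : L.deltaLang.Sorts)
        (TopFieldDer.TDeltaStar K₀ χ) ∧
      (IsEmpty L.Aux → (∃ N : TopFieldDer.Structure L.deltaLang, TopFieldDer.TDeltaStar K₀ χ N) →
        TopFieldDer.EliminatesExistsInfinity (none : L.pairLang.Sorts)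
          (TopFieldDer.TPair K₀)) := by
  exact ⟨hT.eliminatesExistsInfinity_tDeltaStar,
    fun _ hcons => hT.eliminatesExistsInfinity_tPair hcons⟩
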